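/- **Expressions.** Let $K$ be a field. An input string is a sequence of symbols, each of which is a decimal digit, a number of $K$ written as a single symbol, one of the operators $+,-,\times,\div$, or a parenthesis. Valid arithmetic expressions are given by the usual grammar: a *sum* is a term, or a sum followed by $+$ or $-$ and a term; a *term* is a factor, or a term followed by $\times$ or $\div$ and a factor; a *factor* is a number (a single number symbol or a nonempty sequence of decimal digits) or a parenthesized sum. So $\times,\div$ bind more strongly than $+,-$, and operators of equal precedence associate to the left. The string must be a sum in which no division by zero occurs; its value is then an element of $K$. **Model (AMPC).** Computation proceeds in synchronous rounds on $P$ machines with $S$ words of memory each; a word is either an integer of $b$ bits or a number of $K$. There is a sequence of distributed key–value stores $D_0,D_1,\dots$; keys are integer words, and a value consists of one integer word and one number. $D_0$ holds the $j$-th symbol of the input under key $j$ ($0\le j<n$). In round $t$ (for $t=0,1,\dots$) every machine queries $D_t$ adaptively and writes key–value pairs, which form $D_{t+1}$; no two writes of a round use the same key, and nothing else is kept between rounds. Per round, a machine has $S$ number registers and makes at most $S$ queries, writes and zero tests in total. Local computation on integers is free; numbers can only be moved, combined by $+,-,\times,\div$ (division by zero is not allowed), tested for being zero, or created from integer constants.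 The output is the number stored under key $0$ after the last round. The total memory is $P\cdot S$. **Statement.** There are absolute constants $C$ and $k$ such that for every $0<\varepsilon<1$ and every $n\ge 1$ there is a deterministic AMPC algorithm for strings of length $n$, not depending on $K$, with - at most $C/\varepsilon^{2}$ rounds, - $S\le C\,n^{\varepsilon}$ words of memory per machine, - total memory $P\cdot S\le C\,n\,(1+\log n)^{k}$, i.e. $\widetilde O(n)$ words, - integer words of $b\le C(1+\log n)$ bits, such that, for every field $K$ and every valid arithmetic expression over $K$ of length $n$, the algorithm obeys all rules of the model on this input and outputs the value of the expression. -/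

import Mathlib

/-! Arithmetic expressions as strings, and the adaptive massively parallel computation model. -/

namespace AMPC

/-! ### Arithmetic expressions -/

/-- The four binary operators. -/
inductive Op
  | add
  | sub
  | mul
  | div
deriving DecidableEq

/-- One symbol of an input string: a decimal digit, a number of `K` written as one symbol,
an operator, or a parenthesis. -/
inductive Sym (K : Type*)
  | digit (d : Fin 10)
  | lit (x : K)
  | op (o : Op)
  | lpar
  | rpar

/-- Binary expression trees with numbers of `K` at the leaves. -/
inductive Expr (K : Type*)
  | num (x : K)
  | bin (o : Op) (l r : Expr K)

open Classical in
/-- Apply an operator to two numbers; division by zero is undefined. -/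
noncomputable def Op.eval? {K : Type*} [Field K] : Op → K → K → Option K
  | .add, x, y => some (x + y)
  | .sub, x, y => some (x - y)
  | .mul, x, y => some (x * y)
  | .div, x, y => if y = 0 then none else some (x / y)

/-- The value of an expression tree; it is undefined if a division by zero occurs anywhere. -/
noncomputable def Expr.eval? {K : Type*} [Field K] : Expr K → Option K
  | .num x => some x
  | .bin o l r => l.eval?.bind fun x => r.eval?.bind fun y => o.eval? x y

/-- The number denoted by a string of decimal digits, most significant digit first. -/
def numeralValue (ds : List (Fin 10)) : ℕ :=
  Nat.ofDigits 10 (ds.map Fin.val).reverse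

/-- The syntactic categories of the grammar
`sum ::= term | sum (+|-) term`, `term ::= factor | term (×|÷) factor`,
`factor ::= number | ( sum )`. -/
inductive Category
  | sum
  | term
  | factor

/-- `Parses c w e`: the string `w` is an expression of category `c`, with expression tree `e`.
Multiplication and division bind more strongly than addition and subtraction, and operators of
equal precedence associate to the left. -/
inductive Parses {K : Type*} [Field K] : Category → List (Sym K) → Expr K → Prop
  | lit (x : K) : Parses .factor [.lit x] (.num x)
  | numeral (ds : List (Fin 10)) (hds : ds ≠ []) :
      Parses .factor (ds.map .digit) (.num (numeralValue ds : K))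
  | paren {w : List (Sym K)} {e : Expr K} (h : Parses .sum w e) :
      Parses .factor (.lpar :: (w ++ [.rpar])) e
  | ofFactor {w : List (Sym K)} {e : Expr K} (h : Parses .factor w e) : Parses .term w e
  | ofTerm {w : List (Sym K)} {e : Expr K} (h : Parses .term w e) : Parses .sum w e
  | mulDiv {u v : List (Sym K)} {e f : Expr K} (o : Op) (ho : o = .mul ∨ o = .div)
      (hu : Parses .term u e) (hv : Parses .factor v f) :
      Parses .term (u ++ .op o :: v) (.bin o e f)
  | addSub {u v : List (Sym K)} {e f : Expr K} (o : Op) (ho : o = .add ∨ o = .sub)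
      (hu : Parses .sum u e) (hv : Parses .term v f) :
      Parses .sum (u ++ .op o :: v) (.bin o e f)

/-- The string `w` is a valid arithmetic expression over `K`, and its value is `v`. -/
def HasValue {K : Type*} [Field K] (w : List (Sym K)) (v : K) : Prop :=
  ∃ e : Expr K, Parses .sum w e ∧ e.eval? = some v

/-! ### The computation model -/

/-- A value held under one key of a data store: an integer word and a number. -/
abbrev Cell (K : Type*) := ℕ × K

/-- A distributed data store: a partial map from keys (integer words) to cells. -/
abbrev Store (K : Type*) := ℕ → Option (Cell K)

/-- The program of one machine in one round, as an adaptive decision tree. `ρ` is the set of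
number registers. The integer word that a read returns is known to the machine from then on: all
its later actions may depend on it in an arbitrary way (local computation on integers is free).
Numbers are opaque: they can only be moved between the store and the registers, combined by the
field operations, and tested for being zero.

* `read key r next`: query `key`; a number found there goes to register `r`, and the integer word
  found there (`none` if the key is absent) goes to `next`;
* `const c r next`: put the integer constant `c` into register `r`;
* `op o i j r next`: put the result of `o` on the registers `i`, `j` into register `r`;
* `test i yes no`: branch on whether register `i` is zero;
* `write key tag r next`: write the integer word `tag` and the number in register `r` under
  `key`. -/
inductive Program (ρ : Type)
  | done
  | read (key : ℕ) (r : ρ) (next : Option ℕ → Program ρ)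
  | const (c : ℕ) (r : ρ) (next : Program ρ)
  | op (o : Op) (i j r : ρ) (next : Program ρ)
  | test (i : ρ) (yes no : Program ρ)
  | write (key tag : ℕ) (r : ρ) (next : Program ρ)

/-- What a running program does that is charged for: a query to the data store, a test of a number,
or a write. A `fault` is an attempted division by zero. -/
inductive Event (K : Type*)
  | read (key : ℕ)
  | test
  | write (key : ℕ) (c : Cell K)
  | fault

/-- The event respects the word length: keys and integer words have at most `b` bits. Faults are
never allowed. -/
def Event.Ok {K : Type*} (b : ℕ) : Event K → Prop
  | .read key => key < 2 ^ b
  | .test => True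
  | .write key c => key < 2 ^ b ∧ c.1 < 2 ^ b
  | .fault => False

/-- The key-value pair written by an event, if any. -/
def Event.written? {K : Type*} : Event K → Option (ℕ × Cell K)
  | .write key c => some (key, c)
  | _ => none

open Classical in
/-- Run a program against the data store `D` from the register contents `s`, and list the events
of the run. -/
noncomputable def Program.run {K : Type*} [Field K] {ρ : Type} (D : Store K) :
    Program ρ → (ρ → K) → List (Event K)
  | .done, _ => []
  | .read key r next, s =>
      .read key ::
        match D key with
        | none => (next none).run D s
        | some (tag, x) => (next (some tag)).run D (Function.update s r x)
  | .const c r next, s => next.run D (Function.update s r (c : K))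
  | .op o i j r next, s =>
      match o.eval? (s i) (s j) with
      | none => [.fault]
      | some x => next.run D (Function.update s r x)
  | .test i yes no, s => .test :: if s i = 0 then yes.run D s else no.run D s
  | .write key tag r next, s => .write key (tag, s r) :: next.run D s

/-- An algorithm for inputs of one fixed length: the number of machines, the memory per machine
(in words), the length of an integer word (in bits), the number of rounds, and the program of every
machine in every round. Programs do not mention the field of numbers. Machines keep nothing
between rounds, except what they write to the data store. -/
structure Algorithm where
  machines : ℕ
  memory : ℕ
  wordBits : ℕ
  rounds : ℕ
  program : ℕ → Fin machines → Program (Fin memory)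

variable {K : Type*} [Field K]

/-- The events of machine `i` in round `t`, if the round reads from the store `D`. All registers
start at zero. -/
noncomputable def Algorithm.events (A : Algorithm) (D : Store K) (t : ℕ) (i : Fin A.machines) :
    List (Event K) :=
  (A.program t i).run D 0

/-- All key-value pairs written in round `t`. -/
noncomputable def Algorithm.writes (A : Algorithm) (D : Store K) (t : ℕ) : List (ℕ × Cell K) :=
  (List.finRange A.machines).flatMap fun i => (A.events D t i).filterMap Event.written?

/-- Round `t`, reading from the store `D`, obeys the rules of the model: every machine makes at
most `memory` queries, tests and writes in total, every integer word has at most `wordBits` bits,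
nothing is divided by zero, and no two writes of the round go to the same key. -/
def Algorithm.LegalRound (A : Algorithm) (D : Store K) (t : ℕ) : Prop :=
  (∀ i, (A.events D t i).length ≤ A.memory ∧ ∀ ev ∈ A.events D t i, ev.Ok A.wordBits) ∧
    ((A.writes D t).map Prod.fst).Nodup

/-- The cell that holds one symbol of the input string. -/
def Sym.cell : Sym K → Cell K
  | .digit d => (d, 0)
  | .lit x => (10, x)
  | .op .add => (11, 0)
  | .op .sub => (12, 0)
  | .op .mul => (13, 0)
  | .op .div => (14, 0)
  | .lpar => (15, 0)
  | .rpar => (16, 0)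

/-- The data stores `D 0, D 1, …` on input `w`: `D 0` holds symbol number `j` of `w` under the
key `j`, and `D (t + 1)` holds exactly what is written in the round that reads from `D t`. -/
noncomputable def Algorithm.store (A : Algorithm) (w : List (Sym K)) : ℕ → Store K
  | 0 => fun key => w[key]?.map Sym.cell
  | t + 1 => fun key => (A.writes (A.store w t) t).lookup key

/-- On input `w` all rounds of `A` are legal, and in the end the number `v` stands under key 0. -/
def Algorithm.Outputs (A : Algorithm) (w : List (Sym K)) (v : K) : Prop :=
  (∀ t < A.rounds, A.LegalRound (A.store w t) t) ∧
    ∃ tag : ℕ, A.store w A.rounds 0 = some (tag, v)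

end AMPC

namespace AMPC

open Finset

/-! ### Matrices of the evaluation -/

/-! A row vector (s, t, d) with d ≠ 0 stands for a partial result with finished sum s/d and current
term t/d. Applying an operator with right operand p/q is multiplication by a 3×3 matrix `psiM`,
linear in (p, q). Since the current term is kept apart from the finished sum, precedence and
associativity take care of themselves, and since everything is homogeneous, the only division is
made in the very last round.

Each operand is grouped with the operator in front of it. The string thus becomes a word of matrices
and matching brackets, three tokens per symbol; started from (0, 0, 1), the word of a valid
expression gives k · (s, t, 1) with k ≠ 0 and s + t the value (`evaluates_of_parses`,
`wordTok_spec`). Matching brackets are next smaller values of the height function, and the size of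
the group around a token comes from next smaller values in the mirrored heights (`Grp.sz_eq`).
Heights are suffix sums; next smaller values are found in an m-ary tree of maxima.

The word is contracted in phases, with m about n^(ε/2). In phase l all groups of size less than s =
m^l are already evaluated (`Contracted`). One scan multiplies the evaluated tokens between
consecutive brackets of large groups. If a large group contains exactly one large group directly,
the last row of its value depends linearly on the last row of the inner value (`lamM_mul`), so a
second scan composes whole chains of such groups (`Contracted.chain`). What is left is a forest in
which every inner node branches and whose leaves are disjoint groups of size at least s; evaluating
an interval of it recursively costs O(1 + length/s) (`Contracted.content`). The groups to be
evaluated in this phase are the maximal ones with sizes from s up to less than ms. At most one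
starts in each interval of length s, and m consecutive intervals cost O(m) together
(`sum_slotCalls`), which balances the load. There are D = O(1/ε) phases of two D-level scans each,
hence O(1/ε²) rounds.

Control depends only on integer tags. The matrices that a machine writes are polynomials with
integer coefficients in the numbers it loads (`taskProg_run`), so the programs do not depend on the
field. `Design` and `Layout` turn a schedule of arrays into an algorithm of the model,
`Params.body_spec` checks every array, and `exists_algorithm` collects the bounds. -/

abbrev Mat (R : Type*) := Matrix (Fin 3) (Fin 3) R

section Matrices

variable {R : Type*} [CommRing R]

/-- The action of an operator with right operand `p / q`, where `p = x₀ + x₁` and `q = x₂` are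
read off the last row `x` of `X`, on row vectors (finished sum, current term, denominator). -/
def psiM (o : Op) (X : Mat R) : Mat R :=
  match o with
  | .add => !![X 2 2, 0, 0; X 2 2, 0, 0; 0, X 2 0 + X 2 1, X 2 2]
  | .sub => !![X 2 2, 0, 0; X 2 2, 0, 0; 0, -(X 2 0 + X 2 1), X 2 2]
  | .mul => !![X 2 2, 0, 0; 0, X 2 0 + X 2 1, 0; 0, 0, X 2 2]
  | .div => !![X 2 0 + X 2 1, 0, 0; 0, X 2 2, 0; 0, 0, X 2 0 + X 2 1]

/-- The linear map sending the last row of `X` to the last row of `A * psiM o X * B`. -/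
def lamM (o : Op) (A B : Mat R) : Mat R :=
  Matrix.of fun c i => (A * psiM o (Matrix.single 2 i 1) * B : Mat R) 2 c

/-- An input symbol is held as the constant matrix of its number, so entry (0, 0) is that number. -/
def litM (o : Op) (X : Mat R) : Mat R :=
  psiM o !![0, 0, 0; 0, 0, 0; 0, X 0 0, 1]

/-- Appending the digit `d` to the current term. -/
def digM (d : ℕ) : Mat R := !![1, 0, 0; 0, 10, 0; 0, (d : R), 1]

/-- `psiM` is linear in the last row of its argument, so a context with one hole acts on that row by
a 3×3 matrix. Nested contexts then compose by matrix multiplication, which is what a scan can do. -/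
theorem lamM_mul (o : Op) (A B X : Mat R) :
    ∀ c, (A * psiM o X * B : Mat R) 2 c = (X * (lamM o A B).transpose : Mat R) 2 c := by
  intro c
  cases o <;>
  · simp [lamM, psiM, Matrix.mul_apply, Fin.sum_univ_three, Matrix.single_apply]
    ring

/-- Chains preserve only last rows of group values; this is why that suffices. -/
theorem psiM_congr (o : Op) {X Y : Mat R} (h : ∀ c, X 2 c = Y 2 c) : psiM o X = psiM o Y := by
  cases o <;> simp [psiM, h]

variable {R' : Type*} [CommRing R']

theorem psiM_map (φ : R →+* R') (o : Op) (X : Mat R) :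
    (psiM o X).map φ = psiM o (X.map φ) := by
  cases o <;> ext i j <;> fin_cases i <;> fin_cases j <;> simp [psiM]

theorem mul_map (φ : R →+* R') (X Y : Mat R) : (X * Y).map φ = X.map φ * Y.map φ :=
  Matrix.map_mul

theorem lamM_map (φ : R →+* R') (o : Op) (A B : Mat R) :
    (lamM o A B).map φ = lamM o (A.map φ) (B.map φ) := by
  ext c i
  have h : (A * psiM o (Matrix.single 2 i 1) * B).map φ
      = A.map φ * psiM o (Matrix.single 2 i 1) * B.map φ := by
    rw [mul_map, mul_map, psiM_map, Matrix.map_single, map_one]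
  simpa [lamM] using congrFun (congrFun h 2) c

theorem litM_map (φ : R →+* R') (o : Op) (X : Mat R) :
    (litM o X).map φ = litM o (X.map φ) := by
  rw [litM, psiM_map, litM]
  congr 1
  ext i j; fin_cases i <;> fin_cases j <;> simp

theorem digM_map (φ : R →+* R') (d : ℕ) : (digM d : Mat R).map φ = digM d := by
  ext i j; fin_cases i <;> fin_cases j <;> simp [digM, map_ofNat]

end Matrices

/-! ### Symbolic matrices and adaptive reading -/

/-- Polynomial expressions in matrices that stand under the keys `κ`. -/
inductive MExpr (κ : Type)
  | var (k : κ)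
  | one
  | mul (a b : MExpr κ)
  | mulT (a b : MExpr κ)
  | psi (o : Op) (a : MExpr κ)
  | lam (o : Op) (a b : MExpr κ)
  | lit (o : Op) (a : MExpr κ)
  | dig (d : ℕ)

namespace MExpr

variable {κ : Type}

def eval {R : Type*} [CommRing R] (env : κ → Mat R) : MExpr κ → Mat R
  | var k => env k
  | one => 1
  | mul a b => a.eval env * b.eval env
  | mulT a b => a.eval env * (b.eval env).transpose
  | psi o a => psiM o (a.eval env)
  | lam o a b => lamM o (a.eval env) (b.eval env)
  | lit o a => litM o (a.eval env)
  | dig d => digM d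

open Classical in
noncomputable def vars : MExpr κ → Finset κ
  | var k => {k}
  | one => ∅
  | mul a b => a.vars ∪ b.vars
  | mulT a b => a.vars ∪ b.vars
  | psi _ a => a.vars
  | lam _ a b => a.vars ∪ b.vars
  | lit _ a => a.vars
  | dig _ => ∅

/-- Used to evaluate an expression once over integer polynomials, independently of the field, and
then to specialize the indeterminates to register contents. -/
theorem eval_map {R R' : Type*} [CommRing R] [CommRing R'] (φ : R →+* R') (env : κ → Mat R)
    (e : MExpr κ) : (e.eval env).map φ = e.eval fun k => (env k).map φ := by
  induction e with
  | var k => rfl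
  | one => simp [eval, Matrix.map_one]
  | mul a b iha ihb => simp only [eval, mul_map, iha, ihb]
  | mulT a b iha ihb => simp only [eval, mul_map, iha, ← ihb, Matrix.transpose_map]
  | psi o a ih => simp only [eval, psiM_map, ih]
  | lam o a b iha ihb => simp only [eval, lamM_map, iha, ihb]
  | lit o a ih => simp only [eval, litM_map, ih]
  | dig d => simp only [eval, digM_map]

theorem eval_congr {R : Type*} [CommRing R] {env env' : κ → Mat R} (e : MExpr κ)
    (h : ∀ k ∈ e.vars, env k = env' k) : e.eval env = e.eval env' := by
  induction e with
  | var k => exact h k (by simp [vars])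
  | one => rfl
  | mul a b iha ihb =>
    simp only [eval, iha fun k hk => h k (by simp [vars, hk]),
      ihb fun k hk => h k (by simp [vars, hk])]
  | mulT a b iha ihb =>
    simp only [eval, iha fun k hk => h k (by simp [vars, hk]),
      ihb fun k hk => h k (by simp [vars, hk])]
  | psi o a ih => simp only [eval, ih h]
  | lam o a b iha ihb =>
    simp only [eval, iha fun k hk => h k (by simp [vars, hk]),
      ihb fun k hk => h k (by simp [vars, hk])]
  | lit o a ih => simp only [eval, ih h]
  | dig d => rfl

end MExpr

/-- Adaptive reading of integer tags. -/
inductive RT (κ α : Type)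
  | ret (a : α)
  | read (k : κ) (next : ℕ → RT κ α)

namespace RT

variable {κ α β : Type}

def run (F : κ → ℕ) : RT κ α → α
  | ret a => a
  | read k next => (next (F k)).run F

def cost (F : κ → ℕ) : RT κ α → ℕ
  | ret _ => 0
  | read k next => (next (F k)).cost F + 1

def bind : RT κ α → (α → RT κ β) → RT κ β
  | ret a, f => f a
  | read k next, f => read k fun t => (next t).bind f

/-- Read the tag under `k`. -/
def get (k : κ) : RT κ ℕ := read k ret

instance : Monad (RT κ) where
  pure := ret
  bind := bind

theorem run_bind (F : κ → ℕ) (p : RT κ α) (f : α → RT κ β) :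
    (p >>= f).run F = (f (p.run F)).run F := by
  induction p with
  | ret a => rfl
  | read k next ih => exact ih (F k)

theorem cost_bind (F : κ → ℕ) (p : RT κ α) (f : α → RT κ β) :
    (p >>= f).cost F = p.cost F + (f (p.run F)).cost F := by
  induction p with
  | ret a => exact (Nat.zero_add _).symm
  | read k next ih =>
    have := ih (F k)
    change ((next (F k)) >>= f).cost F + 1 = (next (F k)).cost F + 1 + _
    rw [this]
    simp only [run]
    omega

@[simp] theorem run_pure (F : κ → ℕ) (a : α) : (pure a : RT κ α).run F = a := rfl
@[simp] theorem cost_pure (F : κ → ℕ) (a : α) : (pure a : RT κ α).cost F = 0 := rfl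
@[simp] theorem run_get (F : κ → ℕ) (k : κ) : (get k).run F = F k := rfl
@[simp] theorem cost_get (F : κ → ℕ) (k : κ) : (get k).cost F = 1 := rfl

/-- Do `p 0, …, p (n - 1)` and collect the results. -/
def collect [Inhabited α] (p : ℕ → RT κ α) : ℕ → RT κ (ℕ → α)
  | 0 => pure fun _ => default
  | n + 1 => do
    let f ← collect p n
    let a ← p n
    pure (Function.update f n a)

theorem run_collect [Inhabited α] (F : κ → ℕ) (p : ℕ → RT κ α) (n j : ℕ) (hj : j < n) :
    (collect p n).run F j = (p j).run F := by
  induction n with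
  | zero => omega
  | succ n ih =>
    simp only [collect, run_bind, run_pure, Function.update_apply]
    split_ifs with h
    · rw [h]
    · exact ih (by omega)

theorem cost_collect [Inhabited α] (F : κ → ℕ) (p : ℕ → RT κ α) (n : ℕ) :
    (collect p n).cost F = ∑ j ∈ range n, (p j).cost F := by
  induction n with
  | zero => rfl
  | succ n ih =>
    simp only [collect, cost_bind, cost_pure, Finset.sum_range_succ, ih, add_zero]

end RT

end AMPC

namespace AMPC

open Finset

set_option linter.unusedSectionVars false

/-! ### Compiling tasks to programs -/

section Compile

variable {K : Type*} [Field K] {κ ρ α σ V : Type}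

def tagAt (D : Store K) (a : Option ℕ) : ℕ := (a.bind D).elim 0 Prod.fst

/-- The default `d` will be an entry of the identity matrix, so that absent cells act as the neutral
element (0, 1). -/
def numAt (D : Store K) (a : Option ℕ) (d : ℕ) : K := (a.bind D).elim (d : K) Prod.snd

def ReadEvents (b : ℕ) (evs : List (Event K)) : Prop :=
  ∀ ev ∈ evs, ∃ key < 2 ^ b, ev = .read key

theorem ReadEvents.cons {b key : ℕ} {evs : List (Event K)} (hk : key < 2 ^ b)
    (h : ReadEvents b evs) : ReadEvents b (.read key :: evs) := by
  intro ev hev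
  rcases List.mem_cons.1 hev with rfl | hev
  · exact ⟨key, hk, rfl⟩
  · exact h ev hev

theorem ReadEvents.append {b : ℕ} {evs evs' : List (Event K)}
    (h : ReadEvents b evs) (h' : ReadEvents b evs') : ReadEvents b (evs ++ evs') := by
  intro ev hev
  rcases List.mem_append.1 hev with hev | hev
  · exact h ev hev
  · exact h' ev hev

theorem ReadEvents.nil {b : ℕ} : ReadEvents (K := K) b [] := by simp [ReadEvents]

theorem ReadEvents.written {b : ℕ} {evs : List (Event K)} (h : ReadEvents b evs) :
    evs.filterMap Event.written? = [] := by
  rw [List.filterMap_eq_nil_iff]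
  intro ev hev
  obtain ⟨key, -, rfl⟩ := h ev hev
  rfl

/-- A key without an address is answered by tag 0 without any query. -/
def RT.compile (adr : κ → Option ℕ) (r : ρ) : RT κ α → (α → Program ρ) → Program ρ
  | .ret a, f => f a
  | .read k next, f =>
    match adr k with
    | none => (next 0).compile adr r f
    | some key => .read key r fun o => (next (o.getD 0)).compile adr r f

open Classical in
theorem RT.compile_run (adr : κ → Option ℕ) (r : ρ) (f : α → Program ρ) (b : ℕ)
    (hadr : ∀ k key, adr k = some key → key < 2 ^ b) (D : Store K) (p : RT κ α) (s : ρ → K) :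
    ∃ evs s', (p.compile adr r f).run D s = evs ++ (f (p.run fun k => tagAt D (adr k))).run D s' ∧
      evs.length ≤ p.cost (fun k => tagAt D (adr k)) ∧ ReadEvents b evs := by
  induction p generalizing s with
  | ret a => exact ⟨[], s, rfl, le_rfl, .nil⟩
  | read k next ih =>
    simp only [RT.compile, RT.run, RT.cost]
    cases hk : adr k with
    | none =>
      have h0 : tagAt D none = 0 := rfl
      obtain ⟨evs, s', h1, h2, h3⟩ := ih 0 s
      rw [h0]
      exact ⟨evs, s', h1, by omega, h3⟩
    | some key =>
      simp only [Program.run]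
      cases hD : D key with
      | none =>
        have h0 : tagAt D (some key) = 0 := by simp [tagAt, hD]
        obtain ⟨evs, s', h1, h2, h3⟩ := ih 0 s
        rw [h0]
        refine ⟨.read key :: evs, s', ?_, by simpa using h2, h3.cons (hadr k key hk)⟩
        simp only [Option.getD_none, List.cons_append, List.cons.injEq, true_and]
        exact h1
      | some c =>
        have h0 : tagAt D (some key) = c.1 := by simp [tagAt, hD]
        obtain ⟨evs, s', h1, h2, h3⟩ := ih c.1 (Function.update s r c.2)
        rw [h0]
        refine ⟨.read key :: evs, s', ?_, by simpa using h2, h3.cons (hadr k key hk)⟩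
        simp only [Option.getD_some, List.cons_append, List.cons.injEq, true_and]
        exact h1

def loadProg (adr : V → Option ℕ) (reg : V → ρ) (dflt : V → ℕ) :
    List V → Program ρ → Program ρ
  | [], next => next
  -- The default is put in place before the query, because a query for an absent key leaves the
  -- register unchanged.
  | v :: l, next => .const (dflt v) (reg v) <|
    match adr v with
    | none => loadProg adr reg dflt l next
    | some key => .read key (reg v) fun _ => loadProg adr reg dflt l next

theorem loadProg_run (adr : V → Option ℕ) (reg : V → ρ) (dflt : V → ℕ) (b : ℕ)
    (hadr : ∀ v key, adr v = some key → key < 2 ^ b) (D : Store K) (next : Program ρ)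
    (l : List V) (hl : (l.map reg).Nodup) (s : ρ → K) :
    ∃ evs s', (loadProg adr reg dflt l next).run D s = evs ++ next.run D s' ∧
      evs.length ≤ l.length ∧ ReadEvents b evs ∧ (∀ r ∉ l.map reg, s' r = s r) ∧
      ∀ v ∈ l, s' (reg v) = numAt D (adr v) (dflt v) := by
  classical
  induction l generalizing s with
  | nil => exact ⟨[], s, rfl, le_rfl, .nil, fun _ _ => rfl, by simp⟩
  | cons v l ih =>
    rw [List.map_cons, List.nodup_cons] at hl
    simp only [loadProg, Program.run]
    have fin : ∀ (x : K) (s₀ : ρ → K), (∀ r, r ≠ reg v → s₀ r = s r) → s₀ (reg v) = x →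
        x = numAt D (adr v) (dflt v) → ∃ evs s',
          (loadProg adr reg dflt l next).run D s₀ = evs ++ next.run D s' ∧
          evs.length ≤ l.length ∧ ReadEvents b evs ∧ (∀ r ∉ (v :: l).map reg, s' r = s r) ∧
          ∀ v' ∈ v :: l, s' (reg v') = numAt D (adr v') (dflt v') := by
      intro x s₀ hs hx hn
      obtain ⟨evs, s', h1, h2, h3, h4, h5⟩ := ih hl.2 s₀
      refine ⟨evs, s', h1, h2, h3, ?_, ?_⟩
      · intro r hr
        rw [List.map_cons, List.mem_cons, not_or] at hr
        rw [h4 r hr.2, hs r hr.1]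
      · intro v' hv'
        rcases List.mem_cons.1 hv' with rfl | hv'
        · rw [h4 _ hl.1, hx, hn]
        · exact h5 v' hv'
    cases hv : adr v with
    | none =>
      obtain ⟨evs, s', h1, h2, h3⟩ := fin (dflt v) (Function.update s (reg v) (dflt v))
        (fun r hr => by simp [hr]) (by simp) (by simp [hv, numAt])
      exact ⟨evs, s', h1, by simp; omega, h3⟩
    | some key =>
      simp only [Program.run]
      cases hD : D key with
      | none =>
        obtain ⟨evs, s', h1, h2, h3, h4⟩ := fin (dflt v) (Function.update s (reg v) (dflt v))
          (fun r hr => by simp [hr]) (by simp) (by simp [hv, hD, numAt])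
        exact ⟨.read key :: evs, s', by simp only [h1, List.cons_append], by simpa using h2,
          h3.cons (hadr v key hv), h4⟩
      | some c =>
        obtain ⟨evs, s', h1, h2, h3, h4⟩ := fin c.2
          (Function.update (Function.update s (reg v) (dflt v)) (reg v) c.2)
          (fun r hr => by simp [hr]) (by simp) (by simp [hv, hD, numAt])
        exact ⟨.read key :: evs, s', by simp only [h1, List.cons_append], by simpa using h2,
          h3.cons (hadr v key hv), h4⟩

/-- Multiply register `t` by the registers of a list. -/
def mulProg (t : ρ) : List ρ → Program ρ → Program ρ
  | [], next => next
  | r :: l, next => .op .mul t r t (mulProg t l next)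

theorem mulProg_run (t : ρ) (l : List ρ) (ht : t ∉ l) (next : Program ρ) (D : Store K)
    (s : ρ → K) : ∃ s', (mulProg t l next).run D s = next.run D s' ∧
      s' t = s t * (l.map s).prod ∧ ∀ r ≠ t, s' r = s r := by
  classical
  induction l generalizing s with
  | nil => exact ⟨s, rfl, by simp, fun _ _ => rfl⟩
  | cons r l ih =>
    rw [List.mem_cons, not_or] at ht
    obtain ⟨s', h1, h2, h3⟩ := ih ht.2 (Function.update s t (s t * s r))
    refine ⟨s', ?_, ?_, ?_⟩
    · simp only [mulProg, Program.run, Op.eval?]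
      convert h1
    · have : l.map (Function.update s t (s t * s r)) = l.map s :=
        List.map_congr_left fun a ha => by
          rw [Function.update_of_ne]
          rintro rfl
          exact ht.2 ha
      rw [h2, this]
      simp [mul_assoc]
    · intro r' hr'
      rw [h3 r' hr', Function.update_of_ne hr']

/-- Add the value of a polynomial in the registers to the register `acc`. -/
noncomputable def polyProg (reg : σ → ρ) (acc t : ρ) (p : MvPolynomial σ ℤ) (next : Program ρ) :
    Program ρ :=
  p.support.toList.foldr (fun u nx => .const (p.coeff u).natAbs t <|
    mulProg t ((Finsupp.toMultiset u).toList.map reg) <|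
      if 0 ≤ p.coeff u then .op .add acc t acc nx else .op .sub acc t acc nx) next

theorem polyProg_run (reg : σ → ρ) (acc t : ρ) (hacc : acc ≠ t)
    (hreg : ∀ v, reg v ≠ acc ∧ reg v ≠ t) (p : MvPolynomial σ ℤ) (next : Program ρ)
    (D : Store K) (s : ρ → K) : ∃ s', (polyProg reg acc t p next).run D s = next.run D s' ∧
      s' acc = s acc + MvPolynomial.aeval (fun v => s (reg v)) p ∧
      ∀ r, r ≠ acc → r ≠ t → s' r = s r := by
  classical
  -- Monomials are added one by one. The model only offers natural constants, so a monomial with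
  -- negative coefficient is built from the absolute value and then subtracted.
  have key : ∀ (l : List (σ →₀ ℕ)) (s : ρ → K), ∃ s',
      (l.foldr (fun u nx => .const (p.coeff u).natAbs t <|
        mulProg t ((Finsupp.toMultiset u).toList.map reg) <|
        if 0 ≤ p.coeff u then .op .add acc t acc nx else .op .sub acc t acc nx) next).run D s
        = next.run D s' ∧
      s' acc = s acc + (l.map fun u => ((p.coeff u : ℤ) : K) * u.prod fun v n => s (reg v) ^ n).sum ∧
      ∀ r, r ≠ acc → r ≠ t → s' r = s r := by
    intro l
    induction l with
    | nil => exact fun s => ⟨s, rfl, by simp, fun _ _ _ => rfl⟩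
    | cons u l ih =>
      intro s
      simp only [List.foldr_cons, Program.run]
      obtain ⟨s₁, h1, h2, h3⟩ := mulProg_run t ((Finsupp.toMultiset u).toList.map reg)
        (by
          intro h
          obtain ⟨v, -, hv⟩ := List.mem_map.1 h
          exact (hreg v).2 hv)
        (if 0 ≤ p.coeff u then .op .add acc t acc (l.foldr (fun u nx =>
          .const (p.coeff u).natAbs t <| mulProg t ((Finsupp.toMultiset u).toList.map reg) <|
          if 0 ≤ p.coeff u then .op .add acc t acc nx else .op .sub acc t acc nx) next)
        else .op .sub acc t acc (l.foldr (fun u nx =>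
          .const (p.coeff u).natAbs t <| mulProg t ((Finsupp.toMultiset u).toList.map reg) <|
          if 0 ≤ p.coeff u then .op .add acc t acc nx else .op .sub acc t acc nx) next))
        D (Function.update s t ((p.coeff u).natAbs : K))
      have hs : ∀ v, (Function.update s t ((p.coeff u).natAbs : K)) (reg v) = s (reg v) :=
        fun v => Function.update_of_ne (hreg v).2 _ _
      have ht : s₁ t = ((p.coeff u).natAbs : K) * u.prod fun v n => s (reg v) ^ n := by
        rw [h2, Function.update_self, List.map_map]
        congr 1
        rw [show (Function.update s t ((p.coeff u).natAbs : K)) ∘ reg = fun v => s (reg v) from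
          funext hs, ← Multiset.prod_coe, ← Multiset.map_coe, Multiset.coe_toList,
          Finsupp.toMultiset_map, Finsupp.prod_toMultiset, Finsupp.prod_mapDomain_index]
        · simp
        · intro b n k
          exact pow_add b n k
      have hr1 : ∀ r, r ≠ t → s₁ r = s r := fun r hr => by
        rw [h3 r hr, Function.update_of_ne hr]
      have hint : ((p.coeff u : ℤ) : K) = if 0 ≤ p.coeff u then ((p.coeff u).natAbs : K)
          else -((p.coeff u).natAbs : K) := by
        split_ifs with h0
        · have h : p.coeff u = ((p.coeff u).natAbs : ℤ) := by omega
          exact (congrArg (Int.cast : ℤ → K) h).trans (Int.cast_natCast _)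
        · have h : p.coeff u = -((p.coeff u).natAbs : ℤ) := by omega
          exact (congrArg (Int.cast : ℤ → K) h).trans (by rw [Int.cast_neg, Int.cast_natCast])
      have fin : ∀ x : K, x = s acc + ((p.coeff u : ℤ) : K) * (u.prod fun v n => s (reg v) ^ n) →
          ∃ s', (l.foldr (fun u nx => .const (p.coeff u).natAbs t <|
        mulProg t ((Finsupp.toMultiset u).toList.map reg) <|
        if 0 ≤ p.coeff u then .op .add acc t acc nx else .op .sub acc t acc nx) next).run D
          (Function.update s₁ acc x) = next.run D s' ∧
          s' acc = s acc + ((u :: l).map fun u =>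
            ((p.coeff u : ℤ) : K) * u.prod fun v n => s (reg v) ^ n).sum ∧
          ∀ r, r ≠ acc → r ≠ t → s' r = s r := by
        intro x hx
        obtain ⟨s', k1, k2, k3⟩ := ih (Function.update s₁ acc x)
        have hv : ∀ v, Function.update s₁ acc x (reg v) = s (reg v) := fun v => by
          rw [Function.update_of_ne (hreg v).1, hr1 _ (hreg v).2]
        refine ⟨s', k1, ?_, ?_⟩
        · simp only [hv] at k2
          rw [k2, Function.update_self, hx, List.map_cons, List.sum_cons]
          ring
        · intro r hr hr'
          rw [k3 r hr hr', Function.update_of_ne hr, hr1 r hr']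
      rw [h1]
      split_ifs at hint ⊢ with h0
      · simp only [Program.run, Op.eval?]
        obtain ⟨s', k⟩ := fin (s₁ acc + s₁ t) (by rw [hr1 _ hacc, ht, hint])
        exact ⟨s', by convert k.1, k.2⟩
      · simp only [Program.run, Op.eval?]
        obtain ⟨s', k⟩ := fin (s₁ acc - s₁ t) (by rw [hr1 _ hacc, ht, hint]; ring)
        exact ⟨s', by convert k.1, k.2⟩
  obtain ⟨s', h1, h2, h3⟩ := key p.support.toList s
  refine ⟨s', h1, ?_, h3⟩
  rw [h2, MvPolynomial.aeval_def, MvPolynomial.eval₂_eq, Finset.sum_map_toList]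
  simp [Finsupp.prod]

/-- Write the values of polynomials. -/
noncomputable def outProg (reg : σ → ρ) (acc t : ρ) :
    List (ℕ × ℕ × MvPolynomial σ ℤ) → Program ρ
  | [] => .done
  | (key, tag, p) :: l =>
    .const 0 acc <| polyProg reg acc t p <| .write key tag acc <| outProg reg acc t l

theorem outProg_run (reg : σ → ρ) (acc t : ρ) (hacc : acc ≠ t)
    (hreg : ∀ v, reg v ≠ acc ∧ reg v ≠ t) (D : Store K) (l : List (ℕ × ℕ × MvPolynomial σ ℤ))
    (s : ρ → K) : (outProg reg acc t l).run D s = l.map fun x =>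
      .write x.1 (x.2.1, MvPolynomial.aeval (fun v => s (reg v)) x.2.2) := by
  classical
  induction l generalizing s with
  | nil => rfl
  | cons x l ih =>
    obtain ⟨key, tag, p⟩ := x
    obtain ⟨s', h1, h2, h3⟩ := polyProg_run reg acc t hacc hreg p
      (.write key tag acc <| outProg reg acc t l) D (Function.update s acc ((0 : ℕ) : K))
    have hv : ∀ v, Function.update s acc ((0 : ℕ) : K) (reg v) = s (reg v) := fun v =>
      Function.update_of_ne (hreg v).1 _ _
    have hv' : ∀ v, s' (reg v) = s (reg v) := fun v => by
      rw [h3 _ (hreg v).1 (hreg v).2, hv]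
    have hp : MvPolynomial.aeval (fun v => Function.update s acc ((0 : ℕ) : K) (reg v)) p
        = MvPolynomial.aeval (fun v => s (reg v)) p := by simp only [hv]
    rw [hp, Function.update_self] at h2
    simp only [outProg, Program.run, List.map_cons]
    refine Eq.trans (by convert h1) ?_
    simp only [Program.run, ih, h2, hv', Nat.cast_zero, zero_add]

end Compile

end AMPC

namespace AMPC

open Finset

set_option linter.unusedSectionVars false

/-! ### Programs of single machines. -/

section Tasks

variable {K : Type*} [Field K] {κ : Type}

/-- All entries of a block of `m` matrices. -/
def entries (m : ℕ) : List (ℕ × Fin 3 × Fin 3) :=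
  (List.range m).product ((List.finRange 3).product (List.finRange 3))

theorem mem_entries {m : ℕ} {x : ℕ × Fin 3 × Fin 3} : x ∈ entries m ↔ x.1 < m := by
  obtain ⟨j, a, b⟩ := x
  simp only [entries, List.pair_mem_product, List.mem_range, List.mem_finRange, and_true]

theorem nodup_entries (m : ℕ) : (entries m).Nodup :=
  List.nodup_range.product ((List.nodup_finRange 3).product (List.nodup_finRange 3))

theorem length_entries (m : ℕ) : (entries m).length = 9 * m := by
  have h : ((List.range m) ×ˢ ((List.finRange 3) ×ˢ (List.finRange 3))).length = m * (3 * 3) := by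
    simp only [List.length_product, List.length_range, List.length_finRange]
  exact h.trans (by ring)

/-- Matrices of indeterminates. -/
noncomputable def symEnv (κ : Type) (k : κ) : Mat (MvPolynomial (κ × Fin 3 × Fin 3) ℤ) :=
  Matrix.of fun i j => MvPolynomial.X (k, i, j)

open Classical in
noncomputable def blockVars (m : ℕ) (out : ℕ → ℕ × MExpr κ) : Finset κ :=
  (range m).biUnion fun j => (out j).2.vars

open Classical in
-- Registers 0 and 1 are the accumulator and the scratch register of `polyProg`; each loaded matrix
-- takes nine further registers.
noncomputable def varReg (S : ℕ) (L : List κ) (v : κ × Fin 3 × Fin 3) : Fin (S + 1) :=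
  Fin.ofNat (S + 1) (2 + 9 * L.idxOf v.1 + 3 * v.2.1 + v.2.2)

/-- The program of a machine: read tags adaptively, load the numbers that are needed,
and write a block of cells. -/
noncomputable def taskProg (S : ℕ) (adr : κ → Fin 3 → Fin 3 → Option ℕ) (m : ℕ)
    (wr : ℕ × Fin 3 × Fin 3 → ℕ) (p : RT κ (ℕ → ℕ × MExpr κ)) : Program (Fin (S + 1)) :=
  p.compile (fun k => adr k 0 0) 0 fun out =>
    let L := (blockVars m out).toList
    loadProg (fun v : κ × Fin 3 × Fin 3 => adr v.1 v.2.1 v.2.2) (varReg S L)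
      (fun v => if v.2.1 = v.2.2 then 1 else 0)
      (L.product ((List.finRange 3).product (List.finRange 3))) <|
    outProg (varReg S L) 0 (Fin.ofNat (S + 1) 1) <| (entries m).map fun x =>
      (wr x, (out x.1).1, (out x.1).2.eval (symEnv κ) x.2.1 x.2.2)

/-- The wide cells of a data store. -/
def wide (D : Store K) (adr : κ → Fin 3 → Fin 3 → Option ℕ) (k : κ) : ℕ × Mat K :=
  (tagAt D (adr k 0 0), Matrix.of fun i j => numAt D (adr k i j) (if i = j then 1 else 0))

/-- What a task computes from a wide store. -/
def RT.out (p : RT κ (ℕ → ℕ × MExpr κ)) (F : κ → ℕ × Mat K) (j : ℕ) : ℕ × Mat K :=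
  ((p.run (fun k => (F k).1) j).1, (p.run (fun k => (F k).1) j).2.eval fun k => (F k).2)

/-- A machine pays for its tag queries, for nine loads per matrix that occurs in its output, and for
nine writes per cell. The summand 10 leaves room for the register numbers, which are at most 2 +
9·|L| + 8 even for a key outside the list L. -/
theorem taskProg_run {S m b : ℕ} {adr : κ → Fin 3 → Fin 3 → Option ℕ}
    (wr : ℕ × Fin 3 × Fin 3 → ℕ) (p : RT κ (ℕ → ℕ × MExpr κ))
    (hadr : ∀ k i j key, adr k i j = some key → key < 2 ^ b) (D : Store K) (s : Fin (S + 1) → K)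
    (hS : p.cost (fun k => (wide D adr k).1) +
      9 * (blockVars m (p.run fun k => (wide D adr k).1)).card + 9 * m + 10 ≤ S) :
    ∃ evs, (taskProg S adr m wr p).run D s = evs ++ (entries m).map (fun x =>
        .write (wr x) ((p.out (wide D adr) x.1).1, (p.out (wide D adr) x.1).2 x.2.1 x.2.2)) ∧
      evs.length + 9 * m ≤ S ∧ ReadEvents b evs := by
  classical
  obtain ⟨evs, s₁, h1, h2, h3⟩ := RT.compile_run (fun k => adr k 0 0) (0 : Fin (S + 1))
    (fun out =>
    let L := (blockVars m out).toList
    loadProg (fun v : κ × Fin 3 × Fin 3 => adr v.1 v.2.1 v.2.2) (varReg S L)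
      (fun v => if v.2.1 = v.2.2 then 1 else 0)
      (L.product ((List.finRange 3).product (List.finRange 3))) <|
    outProg (varReg S L) 0 (Fin.ofNat (S + 1) 1) <| (entries m).map fun x =>
      (wr x, (out x.1).1, (out x.1).2.eval (symEnv κ) x.2.1 x.2.2)) b
      (fun k key h => hadr k 0 0 key h) D p s
  change p.cost (fun k => tagAt D (adr k 0 0)) +
    9 * (blockVars m (p.run fun k => tagAt D (adr k 0 0))).card + 9 * m + 10 ≤ S at hS
  set out := p.run fun k => tagAt D (adr k 0 0) with hout
  set L := (blockVars m out).toList with hL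
  have hlen : L.length = (blockVars m out).card := Finset.length_toList _
  have hbound : ∀ v : κ × Fin 3 × Fin 3, 2 + 9 * L.idxOf v.1 + 3 * v.2.1 + v.2.2 < S + 1 := by
    intro v
    have := List.idxOf_le_length (l := L) (a := v.1)
    have h1 := v.2.1.isLt
    have h2 := v.2.2.isLt
    omega
  have hregval : ∀ v, (varReg S L v).val = 2 + 9 * L.idxOf v.1 + 3 * v.2.1 + v.2.2 := fun v => by
    simp only [varReg, Fin.ofNat]
    exact Nat.mod_eq_of_lt (hbound v)
  have hone : (Fin.ofNat (S + 1) 1).val = 1 := Nat.mod_eq_of_lt (by omega)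
  have hreg : ∀ v, varReg S L v ≠ 0 ∧ varReg S L v ≠ Fin.ofNat (S + 1) 1 := by
    intro v
    constructor <;> intro h <;> have h' := congrArg Fin.val h <;> rw [hregval] at h'
    · simp at h'
    · rw [hone] at h'
      omega
  have hacc : (0 : Fin (S + 1)) ≠ Fin.ofNat (S + 1) 1 := by
    intro h
    have h' := congrArg Fin.val h
    rw [hone] at h'
    simp at h'
  have hnd : ((L.product ((List.finRange 3).product (List.finRange 3))).map (varReg S L)).Nodup := by
    refine List.Nodup.map_on ?_ ((Finset.nodup_toList _).product
      ((List.nodup_finRange 3).product (List.nodup_finRange 3)))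
    rintro ⟨k, i, j⟩ hk ⟨k', i', j'⟩ hk' h
    have h' := congrArg Fin.val h
    simp only [hregval] at h'
    have e1 := i.isLt
    have e2 := i'.isLt
    have e3 := j.isLt
    have e4 := j'.isLt
    have hj : (j : ℕ) = j' := by omega
    have hi : (i : ℕ) = i' := by omega
    have hkk : L.idxOf k = L.idxOf k' := by omega
    have hkL : k ∈ L := (List.pair_mem_product.1 hk).1
    rw [Fin.ext hi, Fin.ext hj, (List.idxOf_inj hkL).1 hkk]
  obtain ⟨evs₂, s₂, g1, g2, g3, -, g5⟩ := loadProg_run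
    (fun v : κ × Fin 3 × Fin 3 => adr v.1 v.2.1 v.2.2) (varReg S L)
    (fun v => if v.2.1 = v.2.2 then 1 else 0) b (fun v key h => hadr _ _ _ key h) D
    (outProg (varReg S L) 0 (Fin.ofNat (S + 1) 1) <| (entries m).map fun x =>
      (wr x, (out x.1).1, (out x.1).2.eval (symEnv κ) x.2.1 x.2.2)) _ hnd s₁
  refine ⟨evs ++ evs₂, ?_, ?_, h3.append g3⟩
  · rw [taskProg, h1, List.append_assoc]
    congr 1
    dsimp only
    rw [g1]
    congr 1
    rw [outProg_run _ _ _ hacc hreg, List.map_map]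
    refine List.map_congr_left ?_
    rintro ⟨j, i, i'⟩ hx
    have hj : j < m := mem_entries.1 hx
    simp only [Function.comp]
    congr 2
    -- The polynomial entries are specialized to the contents of the registers after loading.
    have e := MExpr.eval_map
      ((MvPolynomial.aeval (R := ℤ) fun v => s₂ (varReg S L v)).toRingHom) (symEnv κ) (out j).2
    have e' := congrFun (congrFun e i) i'
    simp only [Matrix.map_apply, AlgHom.toRingHom_eq_coe, RingHom.coe_coe] at e'
    rw [e']
    have hcong := MExpr.eval_congr (R := K)
      (env := fun k => (symEnv κ k).map (MvPolynomial.aeval (R := ℤ) fun v => s₂ (varReg S L v)))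
      (env' := fun k => (wide D adr k).2) (out j).2 (by
        intro k hk
        ext a c
        have hkL : k ∈ L := by
          rw [hL, Finset.mem_toList]
          exact Finset.mem_biUnion.2 ⟨j, Finset.mem_range.2 hj, hk⟩
        have := g5 (k, a, c) (by
          rw [List.pair_mem_product, List.pair_mem_product]
          exact ⟨hkL, List.mem_finRange _, List.mem_finRange _⟩)
        simp only [symEnv, Matrix.map_apply, Matrix.of_apply, MvPolynomial.aeval_X, wide]
        exact this)
    exact congrFun (congrFun hcong i) i'
  · have : (L.product ((List.finRange 3).product (List.finRange 3))).length = 9 * L.length := by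
      have h : (L ×ˢ ((List.finRange 3) ×ˢ (List.finRange 3))).length = L.length * (3 * 3) := by
        simp only [List.length_product, List.length_finRange]
      exact h.trans (by ring)
    rw [List.length_append]
    omega

end Tasks

end AMPC

namespace AMPC

open Finset

/-! ### Lookup in lists with distinct keys. -/

section Lookup

variable {α β : Type*} [BEq α] [LawfulBEq α]

theorem lookup_of_mem {l : List (α × β)} (h : (l.map Prod.fst).Nodup) {a : α} {b : β}
    (hm : (a, b) ∈ l) : l.lookup a = some b := by
  induction l with
  | nil => simp at hm
  | cons x l ih =>
    obtain ⟨a', b'⟩ := x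
    rw [List.map_cons, List.nodup_cons] at h
    rw [List.lookup_cons]
    rcases List.mem_cons.1 hm with h' | h'
    · obtain ⟨rfl, rfl⟩ := Prod.mk.inj h'
      simp
    · have : a ≠ a' := by
        rintro rfl
        exact h.1 (List.mem_map.2 ⟨_, h', rfl⟩)
      rw [beq_false_of_ne this]
      exact ih h.2 h'

theorem lookup_of_notMem {l : List (α × β)} {a : α} (hm : ∀ b, (a, b) ∉ l) :
    l.lookup a = none := by
  rw [List.lookup_eq_none_iff]
  rintro ⟨a', b⟩ hp
  rw [bne_iff_ne]
  rintro rfl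
  exact hm b hp

end Lookup

/-- A schedule of tasks. In round `t` every active machine `μ` writes the cells
`μ * m, …, μ * m + m - 1` of a wide store; `adr k` is the wide cell meant by the key `k`, and
`adr0 k` the input symbol. -/
structure Design (κ : Type) where
  P : ℕ
  m : ℕ
  S : ℕ
  b : ℕ
  T : ℕ
  n : ℕ
  root : ℕ
  adr : κ → ℕ
  adr0 : κ → ℕ
  act : ℕ → ℕ → Bool
  task : ℕ → ℕ → RT κ (ℕ → ℕ × MExpr κ)

namespace Design

variable {κ : Type} (d : Design κ)

/-- In round 0 the store is the raw input, and all nine entries of a wide cell are the same input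
cell. -/
def cellAdr (t : ℕ) (k : κ) (i j : Fin 3) : Option ℕ :=
  if t = 0 then if d.adr0 k < d.n then some (d.adr0 k) else none
  else if d.adr k < d.P * d.m then some (9 * d.adr k + 3 * i + j) else none

def outKey (μ : ℕ) (x : ℕ × Fin 3 × Fin 3) : ℕ := 9 * (μ * d.m + x.1) + 3 * x.2.1 + x.2.2

/-- Divide two entries of the root matrix. -/
def finalProg : Program (Fin (d.S + 1)) :=
  .read (9 * d.root + 7) 0 fun _ => .read (9 * d.root + 8) (Fin.ofNat _ 1) fun _ =>
    .op .div 0 (Fin.ofNat _ 1) 0 <| .write 0 0 0 .done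

noncomputable def prog (t μ : ℕ) : Program (Fin (d.S + 1)) :=
  if t < d.T then
    if d.act t μ then taskProg d.S (d.cellAdr t) d.m (d.outKey μ) (d.task t μ) else .done
  else if μ = 0 then d.finalProg else .done

noncomputable def algorithm : Algorithm where
  machines := d.P
  memory := d.S + 1
  wordBits := d.b
  rounds := d.T + 1
  program t μ := d.prog t μ

variable {d} {K : Type*} [Field K]

theorem writes_def (D : Store K) (t : ℕ) : d.algorithm.writes D t =
    (List.finRange d.P).flatMap fun μ : Fin d.P =>
      ((d.prog t μ).run D 0).filterMap Event.written? := rfl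

/-- Keys are numbers in mixed radix: entry and column are digits in base 3, and j < m is the digit
below the machine number. Hence no two writes of a round collide. -/
theorem outKey_inj {μ μ' : ℕ} {x x' : ℕ × Fin 3 × Fin 3} (hx : x.1 < d.m) (hx' : x'.1 < d.m)
    (h : d.outKey μ x = d.outKey μ' x') : μ = μ' ∧ x = x' := by
  obtain ⟨j, a, b⟩ := x
  obtain ⟨j', a', b'⟩ := x'
  simp only [outKey] at h hx hx'
  have e1 := a.isLt
  have e2 := a'.isLt
  have e3 := b.isLt
  have e4 := b'.isLt
  have hb : (b : ℕ) = b' := by omega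
  have ha : (a : ℕ) = a' := by omega
  have hj : μ * d.m + j = μ' * d.m + j' := by omega
  have hm : 0 < d.m := by omega
  have h1 : (μ * d.m + j) / d.m = μ := by
    rw [mul_comm, Nat.mul_add_div hm, Nat.div_eq_of_lt hx, add_zero]
  have h2 : (μ' * d.m + j') / d.m = μ' := by
    rw [mul_comm, Nat.mul_add_div hm, Nat.div_eq_of_lt hx', add_zero]
  have hμ : μ = μ' := by rw [← h1, hj, h2]
  subst hμ
  rw [Fin.ext ha, Fin.ext hb, show j = j' by omega]
  exact ⟨rfl, rfl⟩

/-- The intended wide stores `F 0, F 1, …` of a run on the input `w`. -/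
structure Runs (d : Design κ) (w : List (Sym K)) (F : ℕ → κ → ℕ × Mat K) : Prop where
  length : w.length = d.n
  input : ∀ k, F 0 k = (w[d.adr0 k]?).elim (0, 1) fun c => (c.cell.1, Matrix.of fun _ _ => c.cell.2)
  step : ∀ t < d.T, ∀ k, F (t + 1) k =
    if d.adr k < d.P * d.m ∧ d.act t (d.adr k / d.m) then
      (d.task t (d.adr k / d.m)).out (F t) (d.adr k % d.m) else (0, 1)
  cost : ∀ t < d.T, ∀ μ < d.P, d.act t μ → (d.task t μ).cost (fun k => (F t k).1) +
      9 * (blockVars d.m ((d.task t μ).run fun k => (F t k).1)).card + 9 * d.m + 10 ≤ d.S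
  tag : ∀ t < d.T, ∀ μ < d.P, d.act t μ → ∀ j < d.m, ((d.task t μ).out (F t) j).1 < 2 ^ d.b

section

variable {w : List (Sym K)} {F : ℕ → κ → ℕ × Mat K} (h : d.Runs w F)
  (hbn : d.n ≤ 2 ^ d.b) (hbP : 9 * (d.P * d.m) ≤ 2 ^ d.b)

theorem cellAdr_lt (hbn : d.n ≤ 2 ^ d.b) (hbP : 9 * (d.P * d.m) ≤ 2 ^ d.b) (t : ℕ) (k : κ)
    (i j : Fin 3) (key : ℕ) (hk : d.cellAdr t k i j = some key) : key < 2 ^ d.b := by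
  have e1 := i.isLt
  have e2 := j.isLt
  unfold cellAdr at hk
  split_ifs at hk <;> simp only [Option.some.injEq] at hk <;> omega

/-- The cells written by machine `μ` in round `t`. -/
noncomputable def cells (d : Design κ) (F : ℕ → κ → ℕ × Mat K) (t μ : ℕ) : List (ℕ × Cell K) :=
  if d.act t μ then (entries d.m).map fun x =>
    (d.outKey μ x, (((d.task t μ).out (F t) x.1).1, ((d.task t μ).out (F t) x.1).2 x.2.1 x.2.2))
  else []

include h hbn hbP in
theorem events_spec {t : ℕ} (ht : t < d.T) (D : Store K) (hD : wide D (d.cellAdr t) = F t)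
    (μ : Fin d.P) : (((d.prog t μ).run D 0).length ≤ d.S + 1 ∧
      ∀ ev ∈ (d.prog t μ).run D 0, ev.Ok d.b) ∧
    ((d.prog t μ).run D 0).filterMap Event.written? = d.cells F t μ := by
  unfold cells prog
  simp only [ht, if_true]
  by_cases hact : d.act t μ
  · simp only [hact, if_true]
    obtain ⟨evs, h1, h2, h3⟩ := taskProg_run (S := d.S) (m := d.m) (b := d.b)
      (adr := d.cellAdr t) (d.outKey μ) (d.task t μ) (cellAdr_lt hbn hbP t) D
      0 (by simpa only [hD] using h.cost t ht μ μ.isLt hact)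
    rw [h1]
    refine ⟨⟨?_, ?_⟩, ?_⟩
    · rw [List.length_append, List.length_map, length_entries]
      omega
    · intro ev hev
      rcases List.mem_append.1 hev with hev | hev
      · obtain ⟨key, hkey, rfl⟩ := h3 ev hev
        exact hkey
      · obtain ⟨x, hx, rfl⟩ := List.mem_map.1 hev
        have hx' := mem_entries.1 hx
        refine ⟨?_, ?_⟩
        · have e1 := x.2.1.isLt
          have e2 := x.2.2.isLt
          have e3 : (μ.val + 1) * d.m ≤ d.P * d.m := Nat.mul_le_mul_right _ μ.isLt
          rw [add_mul] at e3
          unfold outKey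
          omega
        · rw [hD]
          exact h.tag t ht μ μ.isLt hact x.1 hx'
    · rw [List.filterMap_append, h3.written, List.nil_append, List.filterMap_map, hD]
      exact congrFun List.filterMap_eq_map' _
  · simp [hact, Program.run]

include h hbn hbP in
theorem writes_eq {t : ℕ} (ht : t < d.T) (D : Store K) (hD : wide D (d.cellAdr t) = F t) :
    d.algorithm.writes D t = (List.finRange d.P).flatMap fun μ : Fin d.P => d.cells F t μ.val := by
  rw [writes_def]
  exact List.flatMap_congr fun μ _ => (events_spec h hbn hbP ht D hD μ).2

theorem nodup_cells (t : ℕ) :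
    (((List.finRange d.P).flatMap fun μ : Fin d.P => d.cells F t μ.val).map Prod.fst).Nodup := by
  rw [List.map_flatMap, List.nodup_flatMap]
  refine ⟨?_, ?_⟩
  · intro μ _
    unfold cells
    split_ifs
    · rw [List.map_map]
      exact (nodup_entries _).map_on fun x hx y hy hxy =>
        (outKey_inj (mem_entries.1 hx) (mem_entries.1 hy) hxy).2
    · simp
  · refine (List.nodup_finRange d.P).imp ?_
    intro μ μ' hne
    rw [Function.onFun, List.disjoint_left]
    intro key h1 h2
    unfold cells at h1 h2
    split_ifs at h1 h2
    · rw [List.map_map] at h1 h2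
      obtain ⟨x, hx, hx'⟩ := List.mem_map.1 h1
      obtain ⟨y, hy, hy'⟩ := List.mem_map.1 h2
      exact hne (Fin.ext (outKey_inj (mem_entries.1 hx) (mem_entries.1 hy) (hx'.trans hy'.symm)).1)
    all_goals simp at h1 h2

include h hbn hbP in
-- Induction over the rounds: once the wide store is as intended, the list of writes is determined
-- and its keys are distinct, so `lookup` returns the cell written. Cells of inactive machines and
-- cells out of range are absent and read as (0, 1).
theorem store_spec {t : ℕ} (ht : t ≤ d.T) :
    wide (d.algorithm.store w t) (d.cellAdr t) = F t := by
  induction t with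
  | zero =>
    funext k
    rw [h.input]
    simp only [wide, cellAdr, Algorithm.store, if_true, ← h.length, tagAt, numAt]
    by_cases hk : d.adr0 k < w.length
    · simp [hk]
    · simp only [hk, if_false, Option.bind_none, Option.elim_none]
      rw [List.getElem?_eq_none (by omega)]
      refine Prod.ext rfl ?_
      ext i j
      simp [Matrix.one_apply]
  | succ t ih =>
    have hD := ih (by omega)
    have hw := writes_eq h hbn hbP ht _ hD
    have hnd := nodup_cells (d := d) (F := F) t
    funext k
    rw [h.step t ht]
    have hlook : ∀ i j : Fin 3, d.adr k < d.P * d.m →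
        d.algorithm.store w (t + 1) (9 * d.adr k + 3 * i + j) =
        if d.act t (d.adr k / d.m) then
          some (((d.task t (d.adr k / d.m)).out (F t) (d.adr k % d.m)).1,
            ((d.task t (d.adr k / d.m)).out (F t) (d.adr k % d.m)).2 i j) else none := by
      intro i j hk
      have hm : 0 < d.m := Nat.pos_of_mul_pos_left (by omega : 0 < d.P * d.m)
      have hμ : d.adr k / d.m < d.P := Nat.div_lt_of_lt_mul (by rwa [mul_comm])
      have hkey : 9 * d.adr k + 3 * i + j = d.outKey (d.adr k / d.m) (d.adr k % d.m, i, j) := by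
        unfold outKey
        rw [mul_comm (d.adr k / d.m), Nat.div_add_mod]
      change List.lookup _ (d.algorithm.writes _ t) = _
      rw [hw]
      split_ifs with hact
      · apply lookup_of_mem hnd
        rw [List.mem_flatMap]
        refine ⟨⟨_, hμ⟩, List.mem_finRange _, ?_⟩
        simp only [cells, hact, if_true, List.mem_map]
        exact ⟨(d.adr k % d.m, i, j), mem_entries.2 (Nat.mod_lt _ hm), by rw [hkey]⟩
      · apply lookup_of_notMem
        intro c hc
        rw [List.mem_flatMap] at hc
        obtain ⟨μ, -, hc⟩ := hc
        unfold cells at hc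
        split_ifs at hc with hact'
        · obtain ⟨x, hx, hx'⟩ := List.mem_map.1 hc
          have := outKey_inj (mem_entries.1 hx) (Nat.mod_lt (d.adr k) hm)
            ((congrArg Prod.fst hx').trans hkey)
          rw [this.1] at hact'
          exact hact hact'
        · simp at hc
    simp only [wide, cellAdr, Nat.add_eq_zero_iff, one_ne_zero, and_false, if_false, tagAt, numAt]
    by_cases hk : d.adr k < d.P * d.m
    · simp only [hk, if_true, true_and, Option.bind_some, hlook _ _ hk]
      split_ifs with hact
      · rfl
      · refine Prod.ext rfl ?_
        ext i j
        simp [Matrix.one_apply]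
    · simp only [hk, if_false, false_and, Option.bind_none, Option.elim_none]
      refine Prod.ext rfl ?_
      ext i j
      simp [Matrix.one_apply]

include h hbn hbP in
-- `finalProg` has no default for absent cells, so the machine of the root must have been active in
-- the last regular round.
theorem algorithm_outputs {k₀ : κ} (hT : 0 < d.T) (hroot : d.root = d.adr k₀)
    (hrootP : d.root < d.P * d.m) (hact : d.act (d.T - 1) (d.root / d.m)) (hS : 10 ≤ d.S)
    (hq : (F d.T k₀).2 2 2 ≠ 0) :
    d.algorithm.Outputs w ((F d.T k₀).2 2 1 / (F d.T k₀).2 2 2) := by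
  have hP : 0 < d.P := Nat.pos_of_mul_pos_right (by omega : 0 < d.P * d.m)
  set D := d.algorithm.store w d.T with hDdef
  have hstore : ∀ i j : Fin 3, ∃ tag, D (9 * d.root + 3 * i + j) = some (tag, (F d.T k₀).2 i j) := by
    intro i j
    have h1 := store_spec h hbn hbP le_rfl
    have h2 : (wide D (d.cellAdr d.T) k₀).2 i j = (F d.T k₀).2 i j := by rw [← h1]
    obtain ⟨t, ht⟩ : ∃ t, d.T = t + 1 := ⟨d.T - 1, by omega⟩
    have hw := writes_eq h hbn hbP (t := t) (by omega) _ (store_spec h hbn hbP (by omega))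
    have hm : 0 < d.m := Nat.pos_of_mul_pos_left (by omega : 0 < d.P * d.m)
    have hμ : d.root / d.m < d.P := Nat.div_lt_of_lt_mul (by rwa [mul_comm])
    have hkey : 9 * d.root + 3 * i + j = d.outKey (d.root / d.m) (d.root % d.m, i, j) := by
      unfold outKey
      rw [mul_comm (d.root / d.m), Nat.div_add_mod]
    have hsome : ∃ c, D (9 * d.root + 3 * i + j) = some c := by
      have hact' : d.act t (d.root / d.m) := by simpa [ht] using hact
      rw [hDdef, ht]
      change ∃ c, List.lookup _ (d.algorithm.writes _ t) = some c
      rw [hw]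
      refine ⟨(((d.task t (d.root / d.m)).out (F t) (d.root % d.m)).1,
        ((d.task t (d.root / d.m)).out (F t) (d.root % d.m)).2 i j),
        lookup_of_mem (nodup_cells t) ?_⟩
      rw [List.mem_flatMap]
      refine ⟨⟨_, hμ⟩, List.mem_finRange _, ?_⟩
      simp only [cells, hact', if_true, List.mem_map]
      exact ⟨(d.root % d.m, i, j), mem_entries.2 (Nat.mod_lt _ hm), by rw [hkey]⟩
    obtain ⟨c, hc⟩ := hsome
    refine ⟨c.1, ?_⟩
    rw [← h2, hc]
    simp only [wide, cellAdr, Matrix.of_apply, show d.T ≠ 0 by omega, if_false, numAt, ← hroot,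
      hrootP, if_true, Option.bind_some, hc, Option.elim_some]
  have hkeyb : ∀ x < 9, 9 * d.root + x < 2 ^ d.b := fun x hx => by omega
  obtain ⟨t1, h1⟩ := hstore 2 1
  obtain ⟨t2, h2⟩ := hstore 2 2
  have h1' : D (9 * d.root + 7) = some (t1, (F d.T k₀).2 2 1) := h1
  have h2' : D (9 * d.root + 8) = some (t2, (F d.T k₀).2 2 2) := h2
  have hone : (Fin.ofNat (d.S + 1) 1) ≠ 0 := by
    intro e
    have e' := congrArg Fin.val e
    rw [Fin.val_ofNat, Nat.mod_eq_of_lt (by omega)] at e'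
    simp at e'
  have hev : ∀ μ : Fin d.P, (d.prog d.T μ).run D 0 = if μ.val = 0 then
      [.read (9 * d.root + 7), .read (9 * d.root + 8),
        .write 0 (0, (F d.T k₀).2 2 1 / (F d.T k₀).2 2 2)] else [] := by
    intro μ
    unfold prog finalProg
    simp only [lt_irrefl, if_false]
    split_ifs
    · generalize Fin.ofNat (d.S + 1) 1 = r at hone ⊢
      simp [Program.run, h1', h2', Op.eval?, hq, hone.symm]
    · rfl
  have hwr : d.algorithm.writes D d.T = [(0, (0, (F d.T k₀).2 2 1 / (F d.T k₀).2 2 2))] := by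
    rw [writes_def]
    simp only [hev]
    obtain ⟨p, hp⟩ : ∃ p, d.P = p + 1 := ⟨d.P - 1, by omega⟩
    have : ∀ (q : ℕ), q = p + 1 → (List.finRange q).flatMap (fun μ => List.filterMap Event.written?
        (if μ.val = 0 then [.read (9 * d.root + 7), .read (9 * d.root + 8),
        .write 0 (0, (F d.T k₀).2 2 1 / (F d.T k₀).2 2 2)] else []))
        = [(0, (0, (F d.T k₀).2 2 1 / (F d.T k₀).2 2 2))] := by
      rintro q rfl
      rw [List.finRange_succ, List.flatMap_cons, List.flatMap_map]
      simp [List.filterMap_cons, Event.written?]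
    exact this d.P hp
  refine ⟨?_, 0, ?_⟩
  · intro t ht
    rcases Nat.lt_succ_iff_lt_or_eq.1 ht with ht | rfl
    · have hD := store_spec h hbn hbP ht.le
      refine ⟨fun μ => (events_spec h hbn hbP ht _ hD μ).1, ?_⟩
      rw [writes_eq h hbn hbP ht _ hD]
      exact nodup_cells t
    · refine ⟨fun μ => ?_, ?_⟩
      · change ((d.prog d.T μ).run D 0).length ≤ d.S + 1 ∧ ∀ ev ∈ (d.prog d.T μ).run D 0, ev.Ok d.b
        rw [hev μ]
        split_ifs
        · refine ⟨by simp; omega, ?_⟩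
          intro ev hev
          simp only [List.mem_cons, List.not_mem_nil, or_false] at hev
          have h0 : 0 < 2 ^ d.b := by positivity
          rcases hev with rfl | rfl | rfl
          · exact hkeyb 7 (by omega)
          · exact hkeyb 8 (by omega)
          · exact ⟨h0, h0⟩
        · simp
      · rw [hwr]
        simp
  · change List.lookup _ (d.algorithm.writes D d.T) = _
    rw [hwr]
    simp

end

end Design

end AMPC

namespace AMPC

/-! ### Bracketed words of matrices -/

section Tokens

variable {K : Type*} [Field K]

/-- The operator coded by a tag. -/
def opOf (t : ℕ) : Op := if t = 12 then .sub else if t = 13 then .mul else if t = 14 then .div else .add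

/-- The operator in front of an item, given the code of the symbol in front of it. -/
def prevOp (p : ℕ) : ℕ := if 11 ≤ p ∧ p ≤ 14 then p else 11

/-- The tag of token number `e` of a symbol with code `c` between symbols with codes `p` and `q`:
`0` for a matrix, `1` for a closing bracket, and at least `2` for an opening bracket. -/
def tokTag (p c q e : ℕ) : ℕ :=
  if e = 0 then
    if c = 15 then prevOp p else if c = 16 then 1 else if c < 10 ∧ ¬ p < 10 then prevOp p else 0
  else if e = 1 then 0
  else if c < 10 ∧ ¬ q < 10 then 1 else 0

/-- A literal is a complete operand and carries its operator at once. A digit only extends the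
current numeral; the operator belongs to the bracket opened at the first digit. -/
def tokMat (p c e : ℕ) (X : Mat K) : Mat K :=
  if e = 0 ∧ c = 10 then litM (opOf (prevOp p)) X else if e = 1 ∧ c < 10 then digM c else 1

def tokOf (p c q e : ℕ) (X : Mat K) : ℕ × Mat K := (tokTag p c q e, tokMat p c e X)

def Sym.code (s : Sym K) : ℕ := s.cell.1

def Sym.mat (s : Sym K) : Mat K := Matrix.of fun _ _ => s.cell.2

/-- The code of the first symbol of a string that is followed by `q`. -/
def headCode (u : List (Sym K)) (q : ℕ) : ℕ := u.head?.elim q Sym.code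

def toks (p : ℕ) : List (Sym K) → ℕ → List (ℕ × Mat K)
  | [], _ => []
  | s :: u, q => tokOf p s.code (headCode u q) 0 s.mat :: tokOf p s.code (headCode u q) 1 s.mat ::
      tokOf p s.code (headCode u q) 2 s.mat :: toks s.code u q

/-- `Bal l X`: the word `l` is balanced, and its value is `X`. -/
inductive Bal : List (ℕ × Mat K) → Mat K → Prop
  | nil : Bal [] 1
  | leaf {A : Mat K} {l : List (ℕ × Mat K)} {X : Mat K} (h : Bal l X) : Bal ((0, A) :: l) (A * X)
  | group {o : ℕ} {A B : Mat K} {l l' : List (ℕ × Mat K)} {Y Z : Mat K} (ho : 2 ≤ o)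
      (h : Bal l Y) (h' : Bal l' Z) :
      Bal ((o, A) :: (l ++ (1, B) :: l')) (psiM (opOf o) Y * Z)

theorem Bal.append {l l' : List (ℕ × Mat K)} {X X' : Mat K} (h : Bal l X) (h' : Bal l' X') :
    Bal (l ++ l') (X * X') := by
  induction h with
  | nil => simpa using h'
  | leaf _ ih => rw [mul_assoc]; exact ih.leaf
  | group ho h _ _ ih =>
    rw [mul_assoc, List.cons_append, List.append_assoc]
    exact Bal.group ho h ih

theorem Bal.blank {l : List (ℕ × Mat K)} {X : Mat K} (h : Bal l X) : Bal ((0, 1) :: l) X := by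
  simpa using h.leaf (A := 1)

theorem toks_append (p : ℕ) (u v : List (Sym K)) (q : ℕ) :
    toks p (u ++ v) q = toks p u (headCode v q) ++ toks (u.getLast?.elim p Sym.code) v q := by
  induction u generalizing p with
  | nil => rfl
  | cons s u ih =>
    have h1 : headCode (u ++ v) q = headCode u (headCode v q) := by
      cases u <;> rfl
    have h2 : (s :: u).getLast?.elim p Sym.code = u.getLast?.elim s.code Sym.code := by
      cases u with
      | nil => rfl
      | cons a u => simp [List.getLast?_cons]
    rw [h2]
    simp only [List.cons_append, toks, ih, h1]

/-- Homogeneity: operand values are only ever known up to a nonzero factor, a common denominator. -/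
theorem psiM_smul (o : Op) (k : K) (X : Mat K) : psiM o (k • X) = k • psiM o X := by
  cases o <;> ext i j <;> fin_cases i <;> fin_cases j <;> simp [psiM] <;> ring

/-- A matrix with last row `(0, v, 1)`. -/
def valM (v : K) : Mat K := !![0, 0, 0; 0, 0, 0; 0, v, 1]

theorem Sym.code_op (o : Op) : 11 ≤ (Sym.op o : Sym K).code ∧ (Sym.op o : Sym K).code ≤ 14 ∧
    opOf (Sym.op o : Sym K).code = o := by
  cases o <;> simp [Sym.code, Sym.cell, opOf]

theorem prevOp_op (o : Op) : opOf (prevOp (Sym.op o : Sym K).code) = o := by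
  obtain ⟨h1, h2, h3⟩ := Sym.code_op (K := K) o
  rw [prevOp, if_pos ⟨h1, h2⟩, h3]

theorem two_le_prevOp (p : ℕ) : 2 ≤ prevOp p := by
  unfold prevOp; split_ifs <;> omega

theorem toks_op (p : ℕ) (o : Op) (v : List (Sym K)) (q : ℕ) : toks p (.op o :: v) q =
    (0, 1) :: (0, 1) :: (0, 1) :: toks (Sym.op o : Sym K).code v q := by
  obtain ⟨h1, h2, -⟩ := Sym.code_op (K := K) o
  have e1 : (Sym.op o : Sym K).code ≠ 15 := by omega
  have e2 : (Sym.op o : Sym K).code ≠ 16 := by omega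
  have e3 : ¬ (Sym.op o : Sym K).code < 10 := by omega
  have e4 : (Sym.op o : Sym K).code ≠ 10 := by omega
  simp [toks, tokOf, tokTag, tokMat, e1, e2, e3, e4]

/-- The last row of `digM d * X` involves rows 1 and 2 of `X`, so the induction carries row 1 as
well. For p < 10 the digit continues a numeral and opens no bracket, which is the form needed after
the first digit. -/
theorem bal_numeral (p q : ℕ) (hq : 10 ≤ q) (d : Fin 10) (ds : List (Fin 10)) :
    ∃ l X, toks p ((Sym.digit d : Sym K) :: ds.map .digit) q
      = ((if p < 10 then 0 else prevOp p), 1) :: (l ++ [(1, 1)]) ∧ Bal l X ∧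
      X 2 0 = 0 ∧ X 2 1 = ((numeralValue (d :: ds) : ℕ) : K) ∧ X 2 2 = 1 ∧
      X 1 0 = 0 ∧ X 1 1 = 10 ^ (ds.length + 1) ∧ X 1 2 = 0 := by
  have hd := d.isLt
  have hc : ∀ d : Fin 10, (Sym.digit d : Sym K).code = d := fun d => rfl
  induction ds generalizing p d with
  | nil =>
    refine ⟨[(0, digM d)], digM d * 1, ?_, Bal.nil.leaf, ?_⟩
    · have : ¬ q < 10 := by omega
      by_cases hp : p < 10 <;>
      simp [toks, tokOf, tokTag, tokMat, hc, hd, hp, headCode, this, hd.ne,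
        show (d : ℕ) ≠ 15 by omega, show (d : ℕ) ≠ 16 by omega]
    · simp [digM, numeralValue]
  | cons d' ds ih =>
    obtain ⟨l, X, h1, h2, h3, h4, h5, h6, h7, h8⟩ := ih (d : ℕ) d' d'.isLt
    refine ⟨(0, digM d) :: (0, 1) :: (0, 1) :: l, digM d * X, ?_, h2.blank.blank.leaf, ?_⟩
    · rw [List.map_cons, toks, hc, h1]
      have hd' := d'.isLt
      by_cases hp : p < 10 <;>
      simp [tokOf, tokTag, tokMat, hd, hp, headCode, hc, hd', hd.ne,
        show (d : ℕ) ≠ 15 by omega, show (d : ℕ) ≠ 16 by omega]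
    · have hn : numeralValue (d :: d' :: ds) =
          numeralValue (d' :: ds) + 10 ^ (ds.length + 1) * d := by
        unfold numeralValue
        rw [List.map_cons, List.reverse_cons, Nat.ofDigits_append, Nat.ofDigits_singleton,
          List.length_reverse, List.length_map, List.length_cons]
      simp only [digM, Matrix.mul_apply, Fin.sum_univ_three, h3, h4, h5, h6, h7, h8, hn]
      simp
      refine ⟨by ring, by ring⟩

/-- What the tokens of a string of each grammatical category evaluate to. -/
def Evaluates (c : Category) (u : List (Sym K)) (v : K) : Prop :=
  ∀ p q : ℕ, 10 ≤ p → 10 ≤ q →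
    match c with
    | .factor => ∃ k : K, k ≠ 0 ∧ Bal (toks p u q) (k • psiM (opOf (prevOp p)) (valM v))
    | .term => (opOf (prevOp p) = .add ∨ opOf (prevOp p) = .sub) →
        ∃ k : K, k ≠ 0 ∧ Bal (toks p u q) (k • psiM (opOf (prevOp p)) (valM v))
    | .sum => opOf (prevOp p) = .add → ∃ (k s t : K) (X : Mat K), k ≠ 0 ∧ Bal (toks p u q) X ∧
        X 2 0 = k * s ∧ X 2 1 = k * t ∧ X 2 2 = k ∧ s + t = v

/-- A factor behind an operator o is one group or one literal, acting as a multiple of `psiM o`. For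
a term one needs that o is + or −: then multiplying by the matrix of a later × or ÷ amounts to
changing the operand, whereas behind × or ÷ this would contradict left associativity. For a sum, +
is the operator assumed in front of its first term, and the last row is tracked as k · (s, t, 1). -/
theorem evaluates_of_parses {c : Category} {u : List (Sym K)} {e : Expr K} (h : Parses c u e) :
    ∀ v, e.eval? = some v → Evaluates c u v := by
  induction h with
  | lit x =>
    intro v hv p q _ _
    obtain rfl : x = v := by simpa [Expr.eval?] using hv
    refine ⟨1, one_ne_zero, ?_⟩
    have := (Bal.nil (K := K)).blank.blank.leaf (A := litM (opOf (prevOp p)) (Sym.lit x).mat)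
    simpa [toks, tokOf, tokTag, tokMat, Sym.code, Sym.cell, litM, valM, Sym.mat] using this
  | numeral ds hds =>
    intro v hv p q hp hq
    obtain rfl : (numeralValue ds : K) = v := by simpa [Expr.eval?] using hv
    obtain ⟨d, ds, rfl⟩ := List.exists_cons_of_ne_nil hds
    obtain ⟨l, X, h1, h2, h3, h4, h5, -⟩ := bal_numeral (K := K) p q hq d ds
    refine ⟨1, one_ne_zero, ?_⟩
    rw [List.map_cons, h1, if_neg (by omega)]
    have := h2.group (A := 1) (B := 1) (two_le_prevOp p) Bal.nil
    rw [mul_one] at this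
    rw [one_smul, psiM_congr _ (Y := X)]
    · exact this
    · intro c
      fin_cases c <;> simp [valM, h3, h4, h5]
  | @paren w e _ ih =>
    intro v hv p q hp hq
    obtain ⟨k, s, t, X, hk, hX, h0, h1, h2, hst⟩ := ih v hv 15 16 (by omega) (by omega) rfl
    refine ⟨k, hk, ?_⟩
    have e1 : toks p (Sym.lpar :: (w ++ [Sym.rpar])) q = (prevOp p, 1) ::
        (((0, 1) :: (0, 1) :: toks 15 w 16) ++ (1, 1) :: [(0, 1), (0, 1)]) := by
      simp [toks, tokOf, tokTag, tokMat, Sym.code, Sym.cell, toks_append, headCode]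
    rw [e1]
    have := hX.blank.blank.group (A := 1) (B := 1) (two_le_prevOp p) (Bal.nil (K := K)).blank.blank
    rw [mul_one] at this
    have hv' : psiM (opOf (prevOp p)) X = k • psiM (opOf (prevOp p)) (valM v) := by
      rw [← psiM_smul, ← hst]
      cases opOf (prevOp p) <;> simp [psiM, valM, h0, h1, h2, mul_add]
    rw [← hv']
    exact this
  | ofFactor _ ih =>
    intro v hv p q hp hq _
    exact ih v hv p q hp hq
  | ofTerm _ ih =>
    intro v hv p q hp hq hadd
    obtain ⟨k, hk, h⟩ := ih v hv p q hp hq (Or.inl hadd)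
    refine ⟨k, 0, v, _, hk, h, ?_⟩
    rw [hadd]
    simp [psiM, valM]
  | @mulDiv u w e f o ho _ _ ihu ihw =>
    intro v hv p q hp hq hpo
    simp only [Expr.eval?, Option.bind_eq_some_iff] at hv
    obtain ⟨x, hx, y, hy, hxy⟩ := hv
    obtain ⟨ho1, ho2, -⟩ := Sym.code_op (K := K) o
    obtain ⟨k, hk, h⟩ := ihu x hx p (Sym.op o : Sym K).code hp (by omega) hpo
    obtain ⟨k', hk', h'⟩ := ihw y hy (Sym.op o : Sym K).code q (by omega) hq
    rw [prevOp_op] at h'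
    have hB := h.append h'.blank.blank.blank
    rw [toks_append, toks_op, show headCode (Sym.op o :: w) q = (Sym.op o : Sym K).code from rfl]
    rcases ho with rfl | rfl
    · obtain rfl : x * y = v := by simpa [Op.eval?] using hxy
      refine ⟨k * k', mul_ne_zero hk hk', ?_⟩
      convert hB using 1
      rcases hpo with hpo | hpo <;> rw [hpo] <;> ext i j <;> fin_cases i <;> fin_cases j <;>
        simp [psiM, valM, Matrix.mul_apply, Fin.sum_univ_three] <;> ring
    · have hy0 : y ≠ 0 := by
        rintro rfl
        simp [Op.eval?] at hxy
      obtain rfl : x / y = v := by simpa [Op.eval?, hy0] using hxy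
      -- Division multiplies the denominator by the divisor, so y joins the common factor; it is
      -- nonzero because the division is legal.
      refine ⟨k * k' * y, mul_ne_zero (mul_ne_zero hk hk') hy0, ?_⟩
      convert hB using 1
      rcases hpo with hpo | hpo <;> rw [hpo] <;> ext i j <;> fin_cases i <;> fin_cases j <;>
        simp [psiM, valM, Matrix.mul_apply, Fin.sum_univ_three] <;> field_simp
  | @addSub u w e f o ho _ _ ihu ihw =>
    intro v hv p q hp hq hadd
    simp only [Expr.eval?, Option.bind_eq_some_iff] at hv
    obtain ⟨x, hx, y, hy, hxy⟩ := hv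
    obtain ⟨ho1, ho2, -⟩ := Sym.code_op (K := K) o
    obtain ⟨k, s, t, X, hk, hX, h0, h1, h2, hst⟩ :=
      ihu x hx p (Sym.op o : Sym K).code hp (by omega) hadd
    obtain ⟨k', hk', h'⟩ := ihw y hy (Sym.op o : Sym K).code q (by omega) hq
      (by rw [prevOp_op]; exact ho)
    rw [prevOp_op] at h'
    have hB := hX.append h'.blank.blank.blank
    rw [toks_append, toks_op, show headCode (Sym.op o :: w) q = (Sym.op o : Sym K).code from rfl]
    rcases ho with rfl | rfl
    · obtain rfl : x + y = v := by simpa [Op.eval?] using hxy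
      refine ⟨k * k', s + t, y, _, mul_ne_zero hk hk', hB, ?_⟩
      simp [psiM, valM, Matrix.mul_apply, Fin.sum_univ_three, h0, h1, h2, hst.symm]
      refine ⟨?_, ?_⟩ <;> ring
    · obtain rfl : x - y = v := by simpa [Op.eval?] using hxy
      refine ⟨k * k', s + t, -y, _, mul_ne_zero hk hk', hB, ?_⟩
      simp [psiM, valM, Matrix.mul_apply, Fin.sum_univ_three, h0, h1, h2, hst.symm]
      refine ⟨?_, ?_, ?_⟩ <;> ring

end Tokens

end AMPC

namespace AMPC

set_option linter.unusedSectionVars false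

/-! ### Balanced intervals -/

section Intervals

variable {K : Type*} [Field K]

/-- `Seg tok j k X`: the tokens number `j, …, k - 1` are balanced, with value `X`. -/
inductive Seg (tok : ℕ → ℕ × Mat K) : ℕ → ℕ → Mat K → Prop
  | nil (j : ℕ) : Seg tok j j 1
  | leaf {j k : ℕ} {X : Mat K} (ht : (tok j).1 = 0) (h : Seg tok (j + 1) k X) :
      Seg tok j k ((tok j).2 * X)
  | group {j k' k : ℕ} {Y Z : Mat K} (ho : 2 ≤ (tok j).1) (h : Seg tok (j + 1) k' Y)
      (hc : (tok k').1 = 1) (h' : Seg tok (k' + 1) k Z) :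
      Seg tok j k (psiM (opOf (tok j).1) Y * Z)

/-- The tokens `p` and `k` are matching brackets around an interval of value `Y`. -/
structure Grp (tok : ℕ → ℕ × Mat K) (p k : ℕ) (Y : Mat K) : Prop where
  op : 2 ≤ (tok p).1
  seg : Seg tok (p + 1) k Y
  cl : (tok k).1 = 1

variable {tok : ℕ → ℕ × Mat K}

theorem Seg.le {j k : ℕ} {X : Mat K} (h : Seg tok j k X) : j ≤ k := by
  induction h <;> omega

theorem Grp.lt {p k : ℕ} {X : Mat K} (h : Grp tok p k X) : p < k := h.seg.le

/-- Passes from words to positions, where heights and scans are defined. -/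
theorem Bal.seg {l : List (ℕ × Mat K)} {X : Mat K} (h : Bal l X) (j : ℕ)
    (hl : ∀ r (hr : r < l.length), tok (j + r) = l[r]) : Seg tok j (j + l.length) X := by
  induction h generalizing j with
  | nil => exact .nil j
  | @leaf A l X _ ih =>
    have h0 : tok j = (0, A) := hl 0 (by simp)
    have h1 := ih (j + 1) fun r hr => by
      have := hl (r + 1) (by simpa using hr)
      rw [add_assoc, add_comm 1 r]
      simpa using this
    have h2 := Seg.leaf (j := j) (by rw [h0]) h1
    rw [h0, add_assoc, add_comm 1] at h2
    simpa using h2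
  | @group o A B l l' Y Z ho _ _ ih ih' =>
    have h0 : tok j = (o, A) := hl 0 (by simp)
    have h1 := ih (j + 1) fun r hr => by
      have := hl (r + 1) (by simp; omega)
      rw [add_assoc, add_comm 1 r, this]
      simp [hr]
    have hc : tok (j + 1 + l.length) = (1, B) := by
      have := hl (l.length + 1) (by simp)
      rw [add_assoc, add_comm 1, this]
      simp
    have h2 := ih' (j + 1 + l.length + 1) fun r hr => by
      have := hl (l.length + 1 + (r + 1)) (by simp; omega)
      rw [show j + 1 + l.length + 1 + r = j + (l.length + 1 + (r + 1)) by omega, this]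
      simp [List.getElem_append, show l.length + 1 + r - l.length = r + 1 by omega,
        show ¬ l.length + 1 + r < l.length by omega, ← add_assoc]
    have h3 := Seg.group (j := j) (by rw [h0]; exact ho) h1 (by rw [hc]) h2
    rw [h0] at h3
    convert h3 using 1
    simp
    omega

theorem Seg.exists_grp {j k : ℕ} {X : Mat K} (h : Seg tok j k X) :
    ∀ p, j ≤ p → p < k → 2 ≤ (tok p).1 → ∃ k' Y, k' < k ∧ Grp tok p k' Y := by
  induction h with
  | nil => intros; omega
  | @leaf j k X ht _ ih =>
    intro p hj hk ho
    refine ih p ?_ hk ho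
    rcases hj.eq_or_lt with rfl | hj
    · omega
    · exact hj
  | @group j k' k Y Z ho h hc h' ih ih' =>
    intro p hj hk hp
    have hle := h'.le
    rcases hj.eq_or_lt with rfl | hj
    · exact ⟨k', Y, hle, hp, h, hc⟩
    · rcases lt_trichotomy p k' with hpk | rfl | hpk
      · obtain ⟨k'', Y', h1, h2⟩ := ih p hj hpk hp
        exact ⟨k'', Y', by omega, h2⟩
      · omega
      · exact ih' p hpk hk hp

/-- The contribution of a token to the height, plus one, negated: `0` for opening brackets, `2`
for closing brackets, and `1` for matrices. -/
def heightTag (t : ℕ) : ℕ := if t = 0 then 1 else if t = 1 then 2 else 0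

/-- `H j` is the number of brackets that are open in front of token `j`, up to a constant. -/
def IsHeight (tok : ℕ → ℕ × Mat K) (H : ℕ → ℕ) (N : ℕ) : Prop :=
  ∀ i < N, H (i + 1) + heightTag (tok i).1 = H i + 1

variable {H : ℕ → ℕ} {N : ℕ}

theorem IsHeight.leaf (hH : IsHeight tok H N) {i : ℕ} (hi : i < N) (h : (tok i).1 = 0) :
    H (i + 1) = H i := by
  have := hH i hi
  simp only [heightTag, h, if_true] at this
  omega

theorem IsHeight.op (hH : IsHeight tok H N) {i : ℕ} (hi : i < N) (h : 2 ≤ (tok i).1) :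
    H (i + 1) = H i + 1 := by
  have := hH i hi
  simp only [heightTag, show (tok i).1 ≠ 0 by omega, show (tok i).1 ≠ 1 by omega, if_false] at this
  omega

theorem IsHeight.cl (hH : IsHeight tok H N) {i : ℕ} (hi : i < N) (h : (tok i).1 = 1) :
    H (i + 1) + 1 = H i := by
  have := hH i hi
  simp only [heightTag, h, one_ne_zero, if_false, if_true] at this
  omega

theorem Seg.height (hH : IsHeight tok H N) {j k : ℕ} {X : Mat K} (h : Seg tok j k X) (hk : k ≤ N) :
    H k = H j ∧ ∀ i, j ≤ i → i ≤ k → H j ≤ H i := by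
  induction h with
  | nil j =>
    refine ⟨rfl, fun i h1 h2 => ?_⟩
    rw [le_antisymm h2 h1]
  | @leaf j k X ht h ih =>
    have hle := h.le
    obtain ⟨h1, h2⟩ := ih hk
    have h3 := hH.leaf (by omega) ht
    rw [h3] at h1 h2
    refine ⟨h1, fun i hi hi' => ?_⟩
    rcases hi.eq_or_lt with rfl | hi
    · exact le_rfl
    · exact h2 i hi hi'
  | @group j k' k Y Z ho h hc h' ih ih' =>
    have hle := h.le
    have hle' := h'.le
    obtain ⟨h1, h2⟩ := ih (by omega)
    obtain ⟨h3, h4⟩ := ih' hk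
    have h5 := hH.op (by omega) ho
    have h6 := hH.cl (by omega) hc
    refine ⟨by omega, fun i hi hi' => ?_⟩
    rcases hi.eq_or_lt with rfl | hi
    · exact le_rfl
    · rcases le_or_gt i k' with hk' | hk'
      · have := h2 i hi hk'
        omega
      · have := h4 i hk' hi'
        omega

theorem Grp.height (hH : IsHeight tok H N) {p k : ℕ} {X : Mat K} (h : Grp tok p k X) (hk : k < N) :
    H (p + 1) = H p + 1 ∧ H (k + 1) = H p ∧ H k = H p + 1 ∧ ∀ i, p < i → i ≤ k → H p < H i := by
  have hlt := h.lt
  obtain ⟨h1, h2⟩ := h.seg.height hH hk.le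
  have h3 := hH.op (by omega) h.op
  have h4 := hH.cl hk h.cl
  refine ⟨h3, by omega, by omega, fun i hi hi' => ?_⟩
  have := h2 i hi hi'
  omega

/-! ### Next smaller values -/

open Classical in
/-- One more than the first position after `j` with a smaller value, or zero if there is none. -/
noncomputable def ns (g : ℕ → ℕ) (M j : ℕ) : ℕ :=
  if h : ∃ i, j < i ∧ i < M ∧ g i < g j then Nat.find h + 1 else 0

theorem ns_eq_zero {g : ℕ → ℕ} {M j : ℕ} (h : ∀ i, j < i → i < M → g j ≤ g i) : ns g M j = 0 := by
  rw [ns, dif_neg]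
  rintro ⟨i, h1, h2, h3⟩
  have := h i h1 h2
  omega

theorem ns_eq_succ {g : ℕ → ℕ} {M j i : ℕ} (hj : j < i) (hi : i < M) (hg : g i < g j)
    (h : ∀ i', j < i' → i' < i → g j ≤ g i') : ns g M j = i + 1 := by
  classical
  have hex : ∃ i, j < i ∧ i < M ∧ g i < g j := ⟨i, hj, hi, hg⟩
  rw [ns, dif_pos hex]
  congr 1
  rw [Nat.find_eq_iff]
  refine ⟨⟨hj, hi, hg⟩, ?_⟩
  rintro i' hi' ⟨h1, h2, h3⟩
  have := h i' h1 hi'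
  omega

theorem ns_cases (g : ℕ → ℕ) (M j : ℕ) :
    (ns g M j = 0 ∧ ∀ i, j < i → i < M → g j ≤ g i) ∨
    ∃ i, ns g M j = i + 1 ∧ j < i ∧ i < M ∧ g i < g j ∧ ∀ i', j < i' → i' < i → g j ≤ g i' := by
  classical
  by_cases h : ∃ i, j < i ∧ i < M ∧ g i < g j
  · right
    refine ⟨Nat.find h, by rw [ns, dif_pos h], (Nat.find_spec h).1, (Nat.find_spec h).2.1,
      (Nat.find_spec h).2.2, fun i' h1 h2 => ?_⟩
    by_contra h3
    exact Nat.find_min h h2 ⟨h1, h2.trans (Nat.find_spec h).2.1, by omega⟩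
  · left
    push Not at h
    exact ⟨ns_eq_zero h, h⟩

theorem ns_le (g : ℕ → ℕ) (M j : ℕ) : ns g M j ≤ M := by
  rcases ns_cases g M j with ⟨h, -⟩ | ⟨i, h, -, h', -⟩ <;> omega

/-- The heights, followed by their mirror image. -/
def mirror (H : ℕ → ℕ) (N i : ℕ) : ℕ := if i < N then H i else H (2 * N - 1 - i)

/-- The position of the closing bracket of the innermost group that contains the token `j`. -/
noncomputable def nx (H : ℕ → ℕ) (N j : ℕ) : ℕ := ns (mirror H N) (2 * N) j - 2

/-- The size of the innermost group that contains the token `j` strictly or as closing bracket;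
zero if there is none. -/
noncomputable def sz (H : ℕ → ℕ) (N j : ℕ) : ℕ :=
  if ns (mirror H N) (2 * N) j = 0 ∨ ns (mirror H N) (2 * N) (2 * N - 1 - j) = 0 then 0
  else ns (mirror H N) (2 * N) j + ns (mirror H N) (2 * N) (2 * N - 1 - j) - (2 * N + 1)

theorem sz_zero (H : ℕ → ℕ) (N : ℕ) : sz H N 0 = 0 := by
  rw [sz, if_pos]
  right
  apply ns_eq_zero
  intros
  omega

theorem sz_le (H : ℕ → ℕ) (N j : ℕ) : sz H N j ≤ 2 * N := by
  unfold sz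
  have h1 := ns_le (mirror H N) (2 * N) j
  have h2 := ns_le (mirror H N) (2 * N) (2 * N - 1 - j)
  split_ifs <;> omega

/-- All heights inside the group exceed the height at p, which recurs at k + 1. So the next smaller
value to the right is met by k + 1, the one to the left by p, and the group found lies within this
one. -/
theorem Grp.sz_le (hH : IsHeight tok H N) {p k i : ℕ} {X : Mat K} (h : Grp tok p k X)
    (hk : k + 1 < N) (hi : p < i) (hi' : i ≤ k) : 0 < sz H N i ∧ sz H N i ≤ k + 1 - p := by
  obtain ⟨h1, h2, h3, h4⟩ := h.height hH (by omega)
  have hr : ∃ r, ns (mirror H N) (2 * N) i = r + 1 ∧ i < r ∧ r ≤ k + 1 := by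
    rcases ns_cases (mirror H N) (2 * N) i with ⟨-, h5⟩ | ⟨r, h5, h6, h7, h8, h9⟩
    · have := h5 (k + 1) (by omega) (by omega)
      have := h4 i hi hi'
      simp only [mirror, hk, if_true, show i < N by omega] at *
      omega
    · refine ⟨r, h5, h6, ?_⟩
      by_contra hc
      have := h9 (k + 1) (by omega) (by omega)
      have := h4 i hi hi'
      simp only [mirror, hk, if_true, show i < N by omega] at *
      omega
  have hl : ∃ l, ns (mirror H N) (2 * N) (2 * N - 1 - i) = l + 1 ∧ 2 * N - 1 - i < l ∧
      l ≤ 2 * N - 1 - p := by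
    have e1 : mirror H N (2 * N - 1 - i) = H i := by
      rw [mirror, if_neg (by omega)]
      congr 1
      omega
    have e2 : mirror H N (2 * N - 1 - p) = H p := by
      rw [mirror, if_neg (by omega)]
      congr 1
      omega
    rcases ns_cases (mirror H N) (2 * N) (2 * N - 1 - i) with ⟨-, h5⟩ | ⟨r, h5, h6, h7, h8, h9⟩
    · have := h5 (2 * N - 1 - p) (by omega) (by omega)
      have := h4 i hi hi'
      omega
    · refine ⟨r, h5, h6, ?_⟩
      by_contra hc
      have := h9 (2 * N - 1 - p) (by omega) (by omega)
      have := h4 i hi hi'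
      omega
  obtain ⟨r, hr1, hr2, hr3⟩ := hr
  obtain ⟨l, hl1, hl2, hl3⟩ := hl
  rw [sz, hr1, hl1, if_neg (by omega)]
  omega

/-- For a token directly inside the group, the bounds of `Grp.sz_le` are attained. The offsets in
`nx` and `sz` undo the +1 in `ns`, the step from k to k + 1, and the reflection i ↦ 2N − 1 − i. -/
theorem Grp.sz_eq (hH : IsHeight tok H N) {p k i : ℕ} {X : Mat K} (h : Grp tok p k X)
    (hk : k + 1 < N) (hi : p < i) (hi' : i ≤ k) (hHi : H i = H p + 1) :
    sz H N i = k + 1 - p ∧ nx H N i = k := by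
  obtain ⟨h1, h2, h3, h4⟩ := h.height hH (by omega)
  have hr : ns (mirror H N) (2 * N) i = k + 1 + 1 := by
    apply ns_eq_succ
    · omega
    · omega
    · simp only [mirror, hk, if_true, show i < N by omega]
      omega
    · intro i' h5 h6
      have := h4 i' (by omega) (by omega)
      simp only [mirror, show i' < N by omega, if_true, show i < N by omega]
      omega
  have hl : ns (mirror H N) (2 * N) (2 * N - 1 - i) = 2 * N - 1 - p + 1 := by
    have e : ∀ i < N, mirror H N (2 * N - 1 - i) = H i := fun i hi => by
      rw [mirror, if_neg (by omega)]
      congr 1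
      omega
    apply ns_eq_succ
    · omega
    · omega
    · rw [e _ (by omega), e _ (by omega)]
      omega
    · intro i' h5 h6
      have := h4 (2 * N - 1 - i') (by omega) (by omega)
      rw [e _ (by omega), show i' = 2 * N - 1 - (2 * N - 1 - i') by omega, e _ (by omega)]
      omega
  rw [sz, nx, hr, hl, if_neg (by omega)]
  omega

end Intervals

/-! ### The word of an input string -/

section Word

variable {K : Type*} [Field K]

/-- The code of symbol number `i` of the bracketed string. -/
def symCode (w : List (Sym K)) (i : ℕ) : ℕ :=
  if i = 0 then 15 else if i ≤ w.length then (w[i - 1]?).elim 0 Sym.code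
  else if i = w.length + 1 then 16 else 11

def symMat (w : List (Sym K)) (i : ℕ) : Mat K :=
  if i = 0 ∨ w.length < i then 1 else (w[i - 1]?).elim 1 Sym.mat

def wordTok (w : List (Sym K)) (j : ℕ) : ℕ × Mat K :=
  tokOf (symCode w (j / 3 - 1)) (symCode w (j / 3)) (symCode w (j / 3 + 1)) (j % 3) (symMat w (j / 3))

theorem toks_length (p : ℕ) (u : List (Sym K)) (q : ℕ) : (toks p u q).length = 3 * u.length := by
  induction u generalizing p with
  | nil => rfl
  | cons s u ih => simp only [toks, List.length_cons, ih]; ring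

theorem toks_getElem (c : ℕ → ℕ) (x : ℕ → Mat K) (p q : ℕ) (u : List (Sym K)) (i : ℕ)
    (hp : c (i - 1) = p) (hq : c (i + u.length) = q)
    (hc : ∀ r (hr : r < u.length), c (i + r) = u[r].code ∧ x (i + r) = u[r].mat)
    (r : ℕ) (hr : r < (toks p u q).length) :
    tokOf (c ((3 * i + r) / 3 - 1)) (c ((3 * i + r) / 3)) (c ((3 * i + r) / 3 + 1))
      ((3 * i + r) % 3) (x ((3 * i + r) / 3)) = (toks p u q)[r] := by
  induction u generalizing p i r with
  | nil => simp [toks] at hr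
  | cons s u ih =>
    have h0 := hc 0 (by simp)
    have hn : c (i + 1) = headCode u q := by
      cases u with
      | nil => exact hq
      | cons s' u => exact (hc 1 (by simp)).1
    simp only [List.getElem_cons_zero, add_zero] at h0
    simp only [toks]
    by_cases hr3 : r < 3
    · have e1 : (3 * i + r) / 3 = i := by omega
      have e2 : (3 * i + r) % 3 = r := by omega
      rw [e1, e2, hp, h0.1, h0.2, hn]
      interval_cases r <;> rfl
    · obtain ⟨r, rfl⟩ : ∃ r', r = r' + 3 := ⟨r - 3, by omega⟩
      have e : 3 * i + (r + 3) = 3 * (i + 1) + r := by ring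
      rw [e]
      exact ih s.code (i + 1) (by simpa using h0.1)
        (by rw [← hq, List.length_cons]; congr 1; omega)
        (fun r' hr' => by
          have := hc (r' + 1) (by simpa using hr')
          rw [show i + 1 + r' = i + (r' + 1) by omega]
          simpa using this) r (by simpa [toks] using hr)

/-- The string is put into one outer pair of brackets, so that the whole input is a single group
starting at token 0 with operator +. Beyond its end there are only neutral tokens. -/
theorem wordTok_spec {w : List (Sym K)} {v : K} (h : HasValue w v) :
    (∃ k s t X, k ≠ 0 ∧ Grp (wordTok w) 0 (3 * w.length + 3) X ∧ (wordTok w 0).1 = 11 ∧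
      X 2 0 = k * s ∧ X 2 1 = k * t ∧ X 2 2 = k ∧ s + t = v) ∧
    ∀ j, 3 * w.length + 3 < j → wordTok w j = (0, 1) := by
  obtain ⟨e, he, hv⟩ := h
  obtain ⟨k, s, t, X, hk, hX, h0, h1, h2, hst⟩ :=
    evaluates_of_parses he v hv 15 16 (by omega) (by omega) rfl
  refine ⟨⟨k, s, t, X, hk, ⟨?_, ?_, ?_⟩, ?_, h0, h1, h2, hst⟩, ?_⟩
  · simp [wordTok, tokOf, tokTag, symCode, prevOp]
  · have hs := hX.seg (tok := wordTok w) 3 fun r hr => by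
      refine toks_getElem (symCode w) (symMat w) 15 16 w 1 ?_ ?_ ?_ r hr
      · simp [symCode]
      · simp [symCode, add_comm 1]
      · intro r hr
        have : 1 + r ≤ w.length := by omega
        have h2 : ¬ w.length < 1 + r := by omega
        simp [symCode, symMat, this, h2, hr]
    rw [toks_length, add_comm] at hs
    have e1 : wordTok w 1 = (0, 1) := by simp [wordTok, tokOf, tokTag, tokMat, symCode]
    have e2 : wordTok w 2 = (0, 1) := by simp [wordTok, tokOf, tokTag, tokMat, symCode]
    have := (hs.leaf (j := 2) (by rw [e2])).leaf (j := 1) (by rw [e1])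
    rwa [e1, e2, one_mul, one_mul] at this
  · have e1 : (3 * w.length + 3) / 3 = w.length + 1 := by omega
    have e2 : (3 * w.length + 3) % 3 = 0 := by omega
    simp [wordTok, tokOf, tokTag, symCode, e1, e2]
  · simp [wordTok, tokOf, tokTag, symCode, prevOp]
  · intro j hj
    have hd : w.length + 1 ≤ j / 3 := by omega
    rcases hd.eq_or_lt with hd | hd
    · have e2 : j % 3 ≠ 0 := by omega
      simp [wordTok, tokOf, tokTag, tokMat, symCode, ← hd, e2]
    · have c1 : symCode w (j / 3) = 11 := by
        rw [symCode, if_neg (by omega), if_neg (by omega), if_neg (by omega)]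
      simp [wordTok, tokOf, tokTag, tokMat, c1]

end Word

end AMPC

namespace AMPC

set_option linter.unusedSectionVars false

/-! ### Scans -/

section Scan

variable {K : Type*} [Field K]

/-- Combination of neighbouring elements: the tags are combined by `f`, and the matrices are
multiplied up to the first element with a nonzero tag. -/
def comb (f : ℕ → ℕ → ℕ) (x y : ℕ × Mat K) : ℕ × Mat K :=
  (f x.1 y.1, if x.1 = 0 then x.2 * y.2 else x.2)

/-- The laws under which `comb` is associative with neutral element (0, 1). The last one says that a
product that has stopped at a nonzero tag stays stopped. -/
structure TagOp (f : ℕ → ℕ → ℕ) : Prop where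
  assoc : ∀ a b c, f (f a b) c = f a (f b c)
  zero_left : ∀ a, f 0 a = a
  zero_right : ∀ a, f a 0 = a
  left_eq_zero : ∀ a b, f a b = 0 → a = 0

/-- The first nonzero tag. -/
def firstTag (a b : ℕ) : ℕ := if a = 0 then b else a

theorem tagOp_first : TagOp firstTag where
  assoc a b c := by unfold firstTag; split_ifs <;> rfl
  zero_left a := by simp [firstTag]
  zero_right a := by unfold firstTag; split_ifs <;> omega
  left_eq_zero a b h := by unfold firstTag at h; split_ifs at h <;> omega

/-- Used for the heights only; the matrices carried along there are all 1. -/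
theorem tagOp_add : TagOp (· + ·) where
  assoc := add_assoc
  zero_left := zero_add
  zero_right := add_zero
  left_eq_zero a b h := by omega

variable {f : ℕ → ℕ → ℕ}

theorem comb_assoc (hf : TagOp f) (x y z : ℕ × Mat K) :
    comb f (comb f x y) z = comb f x (comb f y z) := by
  unfold comb
  refine Prod.ext (hf.assoc _ _ _) ?_
  by_cases hx : x.1 = 0
  · simp only [hx, if_true, hf.zero_left]
    split_ifs
    · rw [mul_assoc]
    · rfl
  · have : f x.1 y.1 ≠ 0 := fun h => hx (hf.left_eq_zero _ _ h)
    simp [hx, this]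

theorem comb_one (hf : TagOp f) (x : ℕ × Mat K) : comb f x (0, 1) = x := by
  unfold comb
  refine Prod.ext (hf.zero_right _) ?_
  simp

theorem one_comb (hf : TagOp f) (x : ℕ × Mat K) : comb f (0, 1) x = x := by
  unfold comb
  refine Prod.ext (hf.zero_left _) ?_
  simp

/-- The combination of the `n` elements from `j` on. -/
def scanN (f : ℕ → ℕ → ℕ) (x : ℕ → ℕ × Mat K) : ℕ → ℕ → ℕ × Mat K
  | _, 0 => (0, 1)
  | j, n + 1 => comb f (x j) (scanN f x (j + 1) n)

theorem scanN_add (hf : TagOp f) (x : ℕ → ℕ × Mat K) (j n n' : ℕ) :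
    scanN f x j (n + n') = comb f (scanN f x j n) (scanN f x (j + n) n') := by
  induction n generalizing j with
  | zero => rw [zero_add, scanN, one_comb hf, add_zero]
  | succ n ih =>
    rw [show n + 1 + n' = n + n' + 1 by ring, scanN, ih, scanN, comb_assoc hf,
      show j + 1 + n = j + (n + 1) by ring]

theorem scanN_eq_one (hf : TagOp f) {x : ℕ → ℕ × Mat K} {j : ℕ} (h : ∀ i, j ≤ i → x i = (0, 1))
    (n : ℕ) : scanN f x j n = (0, 1) := by
  induction n generalizing j with
  | zero => rfl
  | succ n ih => rw [scanN, h j le_rfl, one_comb hf, ih fun i hi => h i (by omega)]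

/-- The combination of the elements from `j` on, up to `M`. -/
def suf (f : ℕ → ℕ → ℕ) (x : ℕ → ℕ × Mat K) (M j : ℕ) : ℕ × Mat K := scanN f x j (M - j)

theorem suf_step (x : ℕ → ℕ × Mat K) {M j : ℕ} (hj : j < M) :
    suf f x M j = comb f (x j) (suf f x M (j + 1)) := by
  unfold suf
  rw [show M - j = M - (j + 1) + 1 by omega, scanN]

theorem suf_of_le (x : ℕ → ℕ × Mat K) {M j : ℕ} (hj : M ≤ j) : suf f x M j = (0, 1) := by
  rw [suf, Nat.sub_eq_zero_of_le hj, scanN]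

theorem suf_zero {x : ℕ → ℕ × Mat K} {M j : ℕ} (hj : j < M) (hx : (x j).1 = 0) :
    suf firstTag x M j = ((suf firstTag x M (j + 1)).1, (x j).2 * (suf firstTag x M (j + 1)).2) := by
  rw [suf_step x hj, comb, hx]
  simp [firstTag]

theorem suf_one {x : ℕ → ℕ × Mat K} {M j : ℕ} (hj : j < M) (hx : x j = (0, 1)) :
    suf firstTag x M j = suf firstTag x M (j + 1) := by
  rw [suf_step x hj, hx, one_comb tagOp_first]

theorem suf_barrier {x : ℕ → ℕ × Mat K} {M j : ℕ} (hj : j < M) (hx : (x j).1 ≠ 0) :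
    suf firstTag x M j = x j := by
  rw [suf_step x hj, comb]
  simp [firstTag, hx]

/-- Between a position and the barrier found from there, there are no barriers. -/
theorem suf_spec {x : ℕ → ℕ × Mat K} {M : ℕ} (hx : ∀ i < M, (x i).1 = 0 ∨ (x i).1 = i + 1)
    (j : ℕ) : ((suf firstTag x M j).1 = 0 ∧ ∀ i, j ≤ i → i < M → (x i).1 = 0) ∨
    ∃ q, (suf firstTag x M j).1 = q + 1 ∧ j ≤ q ∧ q < M ∧ (x q).1 = q + 1 ∧
      ∀ i, j ≤ i → i < q → (x i).1 = 0 := by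
  rcases le_or_gt M j with hj | hj
  · left
    rw [suf_of_le x hj]
    exact ⟨rfl, fun i h1 h2 => by omega⟩
  · induction hn : M - j generalizing j with
    | zero => omega
    | succ n ih =>
      by_cases h0 : (x j).1 = 0
      · rw [suf_zero hj h0]
        rcases Nat.lt_or_ge (j + 1) M with hj' | hj'
        · rcases ih (j + 1) hj' (by omega) with ⟨h1, h2⟩ | ⟨q, h1, h2, h3, h4, h5⟩
          · left
            refine ⟨h1, fun i hi hi' => ?_⟩
            rcases hi.eq_or_lt with rfl | hi
            · exact h0
            · exact h2 i hi hi'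
          · right
            refine ⟨q, h1, by omega, h3, h4, fun i hi hi' => ?_⟩
            rcases hi.eq_or_lt with rfl | hi
            · exact h0
            · exact h5 i hi hi'
        · left
          rw [suf_of_le x hj']
          refine ⟨rfl, fun i hi hi' => ?_⟩
          rw [show i = j by omega]
          exact h0
      · right
        rw [suf_barrier hj h0]
        have := (hx j hj).resolve_left h0
        exact ⟨j, this, le_rfl, hj, this, fun i hi hi' => by omega⟩

end Scan

/-! ### One phase of the contraction -/

section Phase

variable {K : Type*} [Field K] {tok : ℕ → ℕ × Mat K} {H : ℕ → ℕ} {N : ℕ}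

/-- The innermost group around token `j` has size less than `s`. -/
def Small (H : ℕ → ℕ) (N s j : ℕ) : Prop := 0 < sz H N j ∧ sz H N j < s

noncomputable instance (H : ℕ → ℕ) (N s j : ℕ) : Decidable (Small H N s j) :=
  inferInstanceAs (Decidable (_ ∧ _))

/-- The elements `x` describe the word in which all groups of size less than `s` are evaluated:
the value stands at the opening bracket of the group, and the larger groups are barriers. -/
structure Contracted (tok : ℕ → ℕ × Mat K) (H : ℕ → ℕ) (N s : ℕ) (x : ℕ → ℕ × Mat K) : Prop where
  tag : ∀ j < 2 * N, (x j).1 = 0 ∨ (x j).1 = j + 1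
  inner : ∀ j < N, Small H N s j → x j = (0, 1)
  leaf : ∀ j < N, ¬ Small H N s j → (tok j).1 = 0 → x j = (0, (tok j).2)
  cl : ∀ j < N, ¬ Small H N s j → (tok j).1 = 1 → x j = (j + 1, 1)
  op : ∀ j < N, ¬ Small H N s j → 2 ≤ (tok j).1 → ¬ Small H N s (j + 1) → x j = (j + 1, 1)
  val : ∀ j k Y, k + 1 < N → ¬ Small H N s j → Grp tok j k Y → Small H N s (j + 1) →
    x j = (0, psiM (opOf (tok j).1) Y)

/-- The next barrier after `j` is an opening bracket. -/
def OpenStop (tok : ℕ → ℕ × Mat K) (S : ℕ → ℕ × Mat K) (j : ℕ) : Prop :=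
  (S j).1 ≠ 0 ∧ 2 ≤ (tok ((S j).1 - 1)).1

/-- The token after an opening bracket lies directly inside the group, so its `sz` is exactly the
size of the group. -/
theorem Grp.size_of_not_small (hH : IsHeight tok H N) {s p k : ℕ} {Y : Mat K}
    (h : Grp tok p k Y) (hk : k + 1 < N) (hs : ¬ Small H N s (p + 1)) : s ≤ k + 1 - p := by
  have h1 := h.height hH (by omega)
  have hlt := h.lt
  have h2 := h.sz_eq hH hk (by omega : p < p + 1) (by omega) h1.1
  unfold Small at hs
  rw [h2.1] at hs
  omega

theorem Grp.size_of_small (hH : IsHeight tok H N) {s p k : ℕ} {Y : Mat K}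
    (h : Grp tok p k Y) (hk : k + 1 < N) (hs : Small H N s (p + 1)) : k + 1 - p < s := by
  have h1 := h.height hH (by omega)
  have hlt := h.lt
  have h2 := h.sz_eq hH hk (by omega : p < p + 1) (by omega) h1.1
  unfold Small at hs
  rw [h2.1] at hs
  omega

theorem Grp.small_inner (hH : IsHeight tok H N) {s p k i : ℕ} {Y : Mat K}
    (h : Grp tok p k Y) (hk : k + 1 < N) (hs : k + 1 - p < s) (hi : p < i) (hi' : i ≤ k) :
    Small H N s i := by
  have := h.sz_le hH hk hi hi'
  unfold Small
  omega

/-- Tokens at the height of p + 1 have this very group as their innermost one. -/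
theorem Grp.not_small_direct (hH : IsHeight tok H N) {s p k i : ℕ} {Y : Mat K}
    (h : Grp tok p k Y) (hk : k + 1 < N) (hs : s ≤ k + 1 - p) (hi : p < i) (hi' : i ≤ k)
    (hHi : H i = H (p + 1)) : ¬ Small H N s i := by
  have h1 := h.height hH (by omega)
  have h2 := h.sz_eq hH hk hi hi' (by omega)
  unfold Small
  rw [h2.1]
  omega

variable {s : ℕ} {x : ℕ → ℕ × Mat K}

theorem suf_skip {M : ℕ} {x : ℕ → ℕ × Mat K} {j k : ℕ} (hjk : j ≤ k) (hk : k ≤ M)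
    (h : ∀ i, j ≤ i → i < k → x i = (0, 1)) : suf firstTag x M j = suf firstTag x M k := by
  induction hjk with
  | refl => rfl
  | @step k hjk ih =>
    have hjk : j ≤ k := hjk
    rw [ih (by omega) fun i hi hi' => h i hi (by omega),
      suf_one (by omega) (h k hjk (by omega))]

/-- A balanced interval outside of the small groups consists of evaluated tokens up to its
end, or up to the first large group. -/
theorem Contracted.first (hx : Contracted tok H N s x) (hH : IsHeight tok H N) {j k : ℕ} {X : Mat K}
    (h : Seg tok j k X) (hk : k + 1 < N)
    (hdir : ∀ i, j ≤ i → i ≤ k → H i = H j → ¬ Small H N s i) :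
    suf firstTag x (2 * N) j = ((suf firstTag x (2 * N) k).1, X * (suf firstTag x (2 * N) k).2) ∨
    ∃ q k' Y Z M, j ≤ q ∧ k' < k ∧ Grp tok q k' Y ∧ ¬ Small H N s (q + 1) ∧
      Seg tok (k' + 1) k Z ∧ X = M * psiM (opOf (tok q).1) Y * Z ∧
      suf firstTag x (2 * N) j = (q + 1, M) ∧ H q = H j := by
  induction h with
  | nil j => left; simp
  | @leaf j k X ht h ih =>
    have hle := h.le
    have h0 := hH.leaf (i := j) (by omega) ht
    have h1 := hx.leaf j (by omega) (hdir j le_rfl (by omega) rfl) ht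
    have h2 := suf_zero (M := 2 * N) (x := x) (j := j) (by omega) (by rw [h1])
    rw [h1] at h2
    rcases ih hk (fun i hi hi' hHi => hdir i (by omega) hi' (hHi.trans h0)) with
      h3 | ⟨q, k', Y, Z, M, g1, g2, g3, g4, g5, g6, g7, g8⟩
    · left
      rw [h2, h3, mul_assoc]
    · right
      refine ⟨q, k', Y, Z, (tok j).2 * M, by omega, g2, g3, g4, g5, ?_, ?_, g8.trans h0⟩
      · rw [g6]; simp only [mul_assoc]
      · rw [h2, g7]
  | @group j k' k Y Z ho h hc h' _ ih =>
    have hle := h.le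
    have hle' := h'.le
    have hg : Grp tok j k' Y := ⟨ho, h, hc⟩
    have hh := hg.height hH (by omega)
    have hnj := hdir j le_rfl (by omega) rfl
    by_cases hsm : Small H N s (j + 1)
    · have hsize := hg.size_of_small hH (by omega) hsm
      have h1 := hx.val j k' Y (by omega) hnj hg hsm
      have h2 := suf_zero (M := 2 * N) (x := x) (j := j) (by omega) (by rw [h1])
      have h3 := suf_skip (M := 2 * N) (x := x) (j := j + 1) (k := k' + 1) (by omega) (by omega)
        fun i hi hi' => hx.inner i (by omega)
          (hg.small_inner hH (by omega) hsize (by omega) (by omega))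
      rw [h1, h3] at h2
      rcases ih hk (fun i hi hi' hHi => hdir i (by omega) hi' (hHi.trans hh.2.1)) with
        h4 | ⟨q, k'', Y', Z', M, g1, g2, g3, g4, g5, g6, g7, g8⟩
      · left
        rw [h2, h4, mul_assoc]
      · right
        refine ⟨q, k'', Y', Z', psiM (opOf (tok j).1) Y * M, by omega, g2, g3, g4, g5, ?_, ?_,
          g8.trans hh.2.1⟩
        · rw [g6]; simp only [mul_assoc]
        · rw [h2, g7]
    · right
      have h1 := hx.op j (by omega) hnj ho hsm
      refine ⟨j, k', Y, Z, 1, le_rfl, by omega, hg, hsm, h', by rw [one_mul], ?_, rfl⟩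
      rw [suf_barrier (by omega) (by rw [h1]; simp), h1]

/-- The previous lemma for an interval that ends at the closing bracket of a large group. -/
theorem Contracted.first_cl (hx : Contracted tok H N s x) (hH : IsHeight tok H N) {j k : ℕ}
    {X : Mat K} (h : Seg tok j k X) (hk : k + 1 < N) (hcl : (tok k).1 = 1)
    (hdir : ∀ i, j ≤ i → i ≤ k → H i = H j → ¬ Small H N s i) :
    suf firstTag x (2 * N) j = (k + 1, X) ∨
    ∃ q k' Y Z M, j ≤ q ∧ k' < k ∧ Grp tok q k' Y ∧ ¬ Small H N s (q + 1) ∧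
      Seg tok (k' + 1) k Z ∧ X = M * psiM (opOf (tok q).1) Y * Z ∧
      suf firstTag x (2 * N) j = (q + 1, M) ∧ H q = H j := by
  have hb : suf firstTag x (2 * N) k = (k + 1, 1) := by
    have := hx.cl k (by omega) (hdir k h.le le_rfl (h.height hH (by omega)).1) hcl
    rw [suf_barrier (by omega) (by rw [this]; simp), this]
  have := hx.first hH h hk hdir
  rw [hb, mul_one] at this
  exact this

/-! #### Chains of large groups -/

open Classical in
/-- The elements whose scan composes chains of groups that contain exactly one large group. -/
noncomputable def layer (tok : ℕ → ℕ × Mat K) (nxt : ℕ → ℕ) (x S : ℕ → ℕ × Mat K) (j : ℕ) :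
    ℕ × Mat K :=
  if (x j).1 = 0 then (0, 1)
  else if (tok j).1 < 2 then (j + 1, 1)
  else if (S (j + 1)).1 = 0 then (j + 1, 1)
  else if (tok ((S (j + 1)).1 - 1)).1 < 2 then (j + 1, 1)
  else if (S (nxt (S (j + 1)).1 + 1)).1 = 0 then (j + 1, 1)
  else if 2 ≤ (tok ((S (nxt (S (j + 1)).1 + 1)).1 - 1)).1 then (j + 1, 1)
  else (0, lamM (opOf (tok ((S (j + 1)).1 - 1)).1) (S (j + 1)).2 (S (nxt (S (j + 1)).1 + 1)).2)

theorem layer_tag (nxt : ℕ → ℕ) (S : ℕ → ℕ × Mat K) (j : ℕ) :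
    (layer tok nxt x S j).1 = 0 ∨ (layer tok nxt x S j).1 = j + 1 := by
  unfold layer
  split_ifs <;> simp

theorem Grp.nx_succ (hH : IsHeight tok H N) {p k : ℕ} {Y : Mat K} (h : Grp tok p k Y)
    (hk : k + 1 < N) : nx H N (p + 1) = k := by
  have hlt := h.lt
  exact (h.sz_eq hH hk (by omega) (by omega) (h.height hH (by omega)).1).2

theorem row_mul {A B : Mat K} (h : ∀ c, A 2 c = B 2 c) (C : Mat K) (c : Fin 3) :
    (A * C : Mat K) 2 c = (B * C : Mat K) 2 c := by
  simp only [Matrix.mul_apply, h]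

/-- From a large group, the chain scan leads to a large group that does not contain exactly one
large group, and composes the maps in between. -/
theorem Contracted.chain (hx : Contracted tok H N s x) (hH : IsHeight tok H N) {p k : ℕ} {Y : Mat K}
    (h : Grp tok p k Y) (hk : k + 1 < N) (hp : ¬ Small H N s p) (hs : ¬ Small H N s (p + 1)) :
    let S := suf firstTag x (2 * N)
    let S' := suf firstTag (layer tok (nx H N) x S) (2 * N)
    ∃ e k' Y', p ≤ e ∧ k' ≤ k ∧ Grp tok e k' Y' ∧ ¬ Small H N s (e + 1) ∧ (S' p).1 = e + 1 ∧
      (∀ c, Y 2 c = (Y' * (S' p).2.transpose : Mat K) 2 c) ∧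
      (¬ OpenStop tok S (e + 1) ∨ OpenStop tok S (e + 1) ∧
        OpenStop tok S (nx H N (S (e + 1)).1 + 1)) := by
  intro S S'
  -- Induction on the size of the group: either the chain stops here, or it goes on with the only
  -- large group inside.
  induction hn : k - p using Nat.strong_induction_on generalizing p k Y with
  | _ n ih =>
  have hlt := h.lt
  have hh := h.height hH (by omega)
  have hsize := h.size_of_not_small hH hk hs
  have hxp : x p = (p + 1, 1) := hx.op p (by omega) hp h.op hs
  have hop := h.op
  have fin : layer tok (nx H N) x S p = (p + 1, 1) →
      (¬ OpenStop tok S (p + 1) ∨ OpenStop tok S (p + 1) ∧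
        OpenStop tok S (nx H N (S (p + 1)).1 + 1)) →
      ∃ e k' Y', p ≤ e ∧ k' ≤ k ∧ Grp tok e k' Y' ∧ ¬ Small H N s (e + 1) ∧ (S' p).1 = e + 1 ∧
      (∀ c, Y 2 c = (Y' * (S' p).2.transpose : Mat K) 2 c) ∧
      (¬ OpenStop tok S (e + 1) ∨ OpenStop tok S (e + 1) ∧
        OpenStop tok S (nx H N (S (e + 1)).1 + 1)) := by
    intro h1 h2
    have h3 : S' p = (p + 1, 1) := by
      have := suf_barrier (x := layer tok (nx H N) x S) (M := 2 * N) (j := p) (by omega)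
        (by rw [h1]; simp)
      exact this.trans h1
    refine ⟨p, k, Y, le_rfl, le_rfl, h, hs, by rw [h3], ?_, h2⟩
    intro c
    rw [h3, Matrix.transpose_one, mul_one]
  have hdir : ∀ i, p + 1 ≤ i → i ≤ k → H i = H (p + 1) → ¬ Small H N s i :=
    fun i hi hi' hHi => h.not_small_direct hH hk hsize (by omega) hi' hHi
  rcases hx.first_cl hH h.seg hk h.cl hdir with h1 | ⟨q, k', Yq, Z, M, g1, g2, g3, g4, g5, g6, g7, g8⟩
  · have h1' : S (p + 1) = (k + 1, Y) := h1
    apply fin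
    · unfold layer
      simp [h1', h.cl, hxp, show ¬ (tok p).1 < 2 by omega]
    · left
      simp [OpenStop, h1', h.cl]
  · have g7' : S (p + 1) = (q + 1, M) := g7
    have hgop := g3.op
    have hglt := g3.lt
    have hgh := g3.height hH (by omega)
    have hnx : nx H N (q + 1) = k' := g3.nx_succ hH (by omega)
    have hdir' : ∀ i, k' + 1 ≤ i → i ≤ k → H i = H (k' + 1) → ¬ Small H N s i :=
      fun i hi hi' hHi => hdir i (by omega) hi' (by omega)
    have ho1 : OpenStop tok S (p + 1) := by
      simp [OpenStop, g7', hgop]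
    rcases hx.first_cl hH g5 hk h.cl hdir' with h1 | ⟨q2, k2, Y2, Z2, M2, j1, j2, j3, -, -, -, j7, -⟩
    · have h1' : S (k' + 1) = (k + 1, Z) := h1
      have hlay : layer tok (nx H N) x S p = (0, lamM (opOf (tok q).1) M Z) := by
        unfold layer
        simp [h1', g7', hnx, h.cl, hxp, show ¬ (tok p).1 < 2 by omega,
          show ¬ (tok q).1 < 2 by omega]
      have hq : ¬ Small H N s q := hdir q g1 (by omega) g8
      obtain ⟨e, ke, Ye, k1, k2, k3, k4, k5, k6, k7⟩ := ih (k' - q) (by omega) g3 (by omega) hq g4 rfl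
      -- The value scan stops at q, so no element in between is a barrier, and `layer` is neutral
      -- there.
      have hskip : S' (p + 1) = S' q := by
        apply suf_skip g1 (by omega)
        intro i hi hi'
        have := suf_spec (M := 2 * N) hx.tag (p + 1)
        rw [g7] at this
        rcases this with ⟨h, -⟩ | ⟨q', e1, -, -, -, e5⟩
        · simp at h
        · simp only [Nat.add_right_cancel_iff] at e1
          subst e1
          unfold layer
          rw [if_pos (e5 i hi hi')]
      have hSp : S' p = ((S' q).1, lamM (opOf (tok q).1) M Z * (S' q).2) := by
        have := suf_zero (x := layer tok (nx H N) x S) (M := 2 * N) (j := p) (by omega)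
          (by rw [hlay])
        rw [hlay] at this
        rw [← hskip]
        exact this
      refine ⟨e, ke, Ye, by omega, by omega, k3, k4, by rw [hSp]; exact k5, ?_, k7⟩
      intro c
      -- Last rows are multiplied from the right by transposes, so the outer map comes last, as the
      -- scan from left to right requires.
      rw [hSp, g6, lamM_mul, row_mul k6, Matrix.transpose_mul, mul_assoc]
    · have j7' : S (k' + 1) = (q2 + 1, M2) := j7
      have := j3.op
      apply fin
      · unfold layer
        simp [j7', g7', hnx, hxp, show ¬ (tok p).1 < 2 by omega, show ¬ (tok q).1 < 2 by omega, this]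
      · right
        refine ⟨ho1, ?_⟩
        simp [OpenStop, g7', hnx, j7', this]

/-! #### Sequential evaluation of a group -/

open Classical in
/-- Evaluate the word from `j` on up to the end of the group around `j`. -/
noncomputable def content (tok : ℕ → ℕ × Mat K) (nxt : ℕ → ℕ) (S S' : ℕ → ℕ × Mat K) :
    ℕ → ℕ → Mat K
  | 0, _ => 1
  | n + 1, j =>
    if (S j).1 = 0 then 1
    else if (tok ((S j).1 - 1)).1 < 2 then (S j).2
    else (S j).2 * psiM (opOf (tok ((S j).1 - 1)).1)
        (content tok nxt S S' n (S' ((S j).1 - 1)).1 * (S' ((S j).1 - 1)).2.transpose) *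
      content tok nxt S S' n (nxt (S j).1 + 1)

open Classical in
/-- The number of recursive calls of `content`. -/
noncomputable def calls (tok : ℕ → ℕ × Mat K) (nxt : ℕ → ℕ) (S S' : ℕ → ℕ × Mat K) : ℕ → ℕ → ℕ
  | 0, _ => 1
  | n + 1, j =>
    if (S j).1 = 0 then 1
    else if (tok ((S j).1 - 1)).1 < 2 then 1
    else 1 + calls tok nxt S S' n (S' ((S j).1 - 1)).1 + calls tok nxt S S' n (nxt (S j).1 + 1)

/-- The witness F counts the large groups that end the chains without containing a large group
themselves, and t counts the large groups directly in the interval. The F groups are disjoint and of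
size at least s, whence F·s ≤ k − j. A chain ending in such a leaf adds 1 ≤ 4·1 − 2 calls. A chain
ending in a branching group has at least two large groups inside, so by induction it adds at most 1
+ 4F' − 2·2 ≤ 4F' − 2 calls. The term 2t in the claim is what makes this induction close. -/
theorem Contracted.content (hx : Contracted tok H N s x) (hH : IsHeight tok H N) {j k : ℕ} {X : Mat K}
    (h : Seg tok j k X) (hk : k + 1 < N) (hcl : (tok k).1 = 1)
    (hdir : ∀ i, j ≤ i → i ≤ k → H i = H j → ¬ Small H N s i) (n : ℕ) (hn : k - j < n) :
    let S := suf firstTag x (2 * N)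
    let S' := suf firstTag (layer tok (nx H N) x S) (2 * N)
    AMPC.content tok (nx H N) S S' n j = X ∧
    ∃ t F, calls tok (nx H N) S S' n j + 2 * t ≤ 1 + 4 * F ∧ F * s ≤ k - j ∧
      (¬ OpenStop tok S j → F = 0 ∧ t = 0) ∧ (OpenStop tok S j → 1 ≤ t ∧
        (OpenStop tok S (nx H N (S j).1 + 1) → 2 ≤ t)) := by
  intro S S'
  induction n generalizing j k X with
  | zero => omega
  | succ n ih =>
  rcases hx.first_cl hH h hk hcl hdir with h1 | ⟨q, k', Y, Z, M, g1, g2, g3, g4, g5, g6, g7, g8⟩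
  · have h1' : S j = (k + 1, X) := h1
    refine ⟨by simp [AMPC.content, h1', hcl], 0, 0, by simp [calls, h1', hcl], by omega, by simp, ?_⟩
    intro hos
    simp [OpenStop, h1', hcl] at hos
  · have g7' : S j = (q + 1, M) := g7
    have hgop := g3.op
    have hglt := g3.lt
    have hgh := g3.height hH (by omega)
    have hnx : nx H N (q + 1) = k' := g3.nx_succ hH (by omega)
    have hqs : ¬ Small H N s q := hdir q g1 (by omega) g8
    have hsize := g3.size_of_not_small hH (by omega) g4
    obtain ⟨e, ke, Ye, c1, c2, c3, c4, c5, c6, c7⟩ := hx.chain hH g3 (by omega) hqs g4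
    change (S' q).1 = _ at c5
    change ∀ c, Y 2 c = (Ye * (S' q).2.transpose : Mat K) 2 c at c6
    change ¬ OpenStop tok S (e + 1) ∨ OpenStop tok S (e + 1) ∧
        OpenStop tok S (nx H N (S (e + 1)).1 + 1) at c7
    have hesize := c3.size_of_not_small hH (by omega) c4
    have helt := c3.lt
    obtain ⟨i1, te, Fe, i2, i3, i4, i5⟩ := ih c3.seg (by omega) c3.cl
      (fun i hi hi' hHi => c3.not_small_direct hH (by omega) hesize (by omega) hi' hHi) (by omega)
    obtain ⟨l1, t', F', l2, l3, l4, l5⟩ := ih g5 hk hcl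
      (fun i hi hi' hHi => hdir i (by omega) hi' (by omega)) (by omega)
    have hlt2 : ¬ (tok q).1 < 2 := by omega
    refine ⟨?_, ?_⟩
    · simp only [AMPC.content, g7', hnx, Nat.add_sub_cancel, hlt2, if_false, Nat.succ_ne_zero,
        c5, i1, l1]
      rw [g6, psiM_congr _ c6]
    · have hcalls : calls tok (nx H N) S S' (n + 1) j = 1 + calls tok (nx H N) S S' n (e + 1) +
          calls tok (nx H N) S S' n (k' + 1) := by
        simp only [calls, g7', hnx, Nat.add_sub_cancel, hlt2, if_false, Nat.succ_ne_zero, c5]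
      have hos : OpenStop tok S j := by simp [OpenStop, g7', hgop]
      have hsnd : OpenStop tok S (nx H N (S j).1 + 1) → 1 ≤ t' := by
        rw [g7', hnx]
        exact fun h => (l5 h).1
      rw [hcalls]
      -- Either the end of the chain is a leaf, which is paid for by its own size, or it branches
      -- and is paid for by the leaves inside.
      rcases c7 with c7 | ⟨c7, c7'⟩
      · obtain ⟨rfl, rfl⟩ := i4 c7
        refine ⟨t' + 1, F' + 1, by omega, ?_, fun hno => (hno hos).elim, fun _ => ⟨by omega, ?_⟩⟩
        · rw [add_mul]
          omega
        · intro h2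
          have := hsnd h2
          omega
      · have hte := (i5 c7).2 c7'
        refine ⟨t' + 1, F' + Fe, by omega, ?_, fun hno => (hno hos).elim, fun _ => ⟨by omega, ?_⟩⟩
        · rw [add_mul]
          omega
        · intro h2
          have := hsnd h2
          omega

end Phase

end AMPC

namespace AMPC

set_option linter.unusedSectionVars false

/-! ### From groups of size less than s to groups of size less than s'. -/

section Step

variable {K : Type*} [Field K] {tok : ℕ → ℕ × Mat K} {H : ℕ → ℕ} {N s s' : ℕ}
  {x : ℕ → ℕ × Mat K}

theorem Small.mono {j : ℕ} (h : Small H N s j) (hs : s ≤ s') : Small H N s' j :=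
  ⟨h.1, h.2.trans_le hs⟩

/-- All opening brackets belong to groups. -/
structure Closed (tok : ℕ → ℕ × Mat K) (N : ℕ) : Prop where
  grp : ∀ p, 2 ≤ (tok p).1 → ∃ k Y, k + 1 < N ∧ Grp tok p k Y

/-- The maximal groups of size less than `s'`, if their size is at least `s`. -/
def IsRoot (tok : ℕ → ℕ × Mat K) (H : ℕ → ℕ) (N s s' j : ℕ) : Prop :=
  2 ≤ (tok j).1 ∧ ¬ Small H N s (j + 1) ∧ Small H N s' (j + 1) ∧ ¬ Small H N s' j

noncomputable instance (s s' j : ℕ) : Decidable (IsRoot tok H N s s' j) :=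
  inferInstanceAs (Decidable (_ ∧ _))

noncomputable def rootElt (tok : ℕ → ℕ × Mat K) (H : ℕ → ℕ) (N s s' j : ℕ) : ℕ × Mat K :=
  if IsRoot tok H N s s' j then (j + 1, 1) else (0, 1)

/-- The value of the group that starts at the position `p - 1` of the interval number `u` of
length `s`; zero stands for no position. -/
noncomputable def slotVal (tok : ℕ → ℕ × Mat K) (nxt : ℕ → ℕ) (S S' : ℕ → ℕ × Mat K)
    (fuel s p u : ℕ) : Mat K :=
  if p ≠ 0 ∧ (p - 1) / s = u then
    psiM (opOf (tok (p - 1)).1)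
      (content tok nxt S S' fuel (S' (p - 1)).1 * (S' (p - 1)).2.transpose)
  else 1

noncomputable def slotCalls (tok : ℕ → ℕ × Mat K) (nxt : ℕ → ℕ) (S S' : ℕ → ℕ × Mat K)
    (fuel s p u : ℕ) : ℕ :=
  if p ≠ 0 ∧ (p - 1) / s = u then calls tok nxt S S' fuel (S' (p - 1)).1 else 0

/-- The elements of the next phase. -/
noncomputable def nextElt (tok : ℕ → ℕ × Mat K) (H : ℕ → ℕ) (N s s' : ℕ) (x : ℕ → ℕ × Mat K)
    (out : ℕ → Mat K) (j : ℕ) : ℕ × Mat K :=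
  if Small H N s' j then (0, 1)
  else if 2 ≤ (tok j).1 ∧ Small H N s' (j + 1) then
    if Small H N s (j + 1) then x j else (0, out (j / s))
  else if (tok j).1 = 0 then (0, (tok j).2) else (j + 1, 1)

/-- The elements before the first phase. -/
def firstElt (tok : ℕ → ℕ × Mat K) (j : ℕ) : ℕ × Mat K :=
  if (tok j).1 = 0 then (0, (tok j).2) else (j + 1, 1)

theorem contracted_first : Contracted tok H N 1 (firstElt tok) := by
  have hs : ∀ j, ¬ Small H N 1 j := fun j h => by unfold Small at h; omega
  refine ⟨?_, ?_, ?_, ?_, ?_, ?_⟩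
  · intro j _
    unfold firstElt
    split_ifs <;> simp
  · exact fun j _ h => (hs j h).elim
  · intro j _ _ h
    simp [firstElt, h]
  · intro j _ _ h
    simp [firstElt, h]
  · intro j _ _ h _
    simp [firstElt, show (tok j).1 ≠ 0 by omega]
  · exact fun j k Y _ _ _ h => (hs _ h).elim

/-- Roots are maximal, hence disjoint: a root inside the group of another one would itself lie in a
group of size less than s'. -/
theorem IsRoot.lt_of_lt (hH : IsHeight tok H N) {q q' k : ℕ} {Y : Mat K}
    (h : IsRoot tok H N s s' q) (h' : IsRoot tok H N s s' q') (hg : Grp tok q k Y) (hk : k + 1 < N)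
    (hq : q < q') : k < q' := by
  by_contra hc
  exact h'.2.2.2 (hg.small_inner hH hk (hg.size_of_small hH hk h.2.2.1) hq (by omega))

theorem rootElt_tag (j : ℕ) : (rootElt tok H N s s' j).1 = 0 ∨ (rootElt tok H N s s' j).1 = j + 1 := by
  unfold rootElt
  split_ifs <;> simp

theorem isRoot_of_rootElt {j : ℕ} (h : (rootElt tok H N s s' j).1 = j + 1) :
    IsRoot tok H N s s' j := by
  unfold rootElt at h
  split_ifs at h with h'
  exact h'

/-- The first root from the start of the interval of a root on is that root. -/
theorem IsRoot.suf_eq (hH : IsHeight tok H N) (hc : Closed tok N) {q : ℕ} (hs : 0 < s)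
    (h : IsRoot tok H N s s' q) :
    (suf firstTag (rootElt tok H N s s') (2 * N) (q / s * s)).1 = q + 1 := by
  obtain ⟨k, Y, hk, hg⟩ := hc.grp q h.1
  have hlt := hg.lt
  have hle : q / s * s ≤ q := Nat.div_mul_le_self q s
  have hx : (rootElt tok H N s s' q).1 = q + 1 := by simp [rootElt, h]
  rcases suf_spec (M := 2 * N) (x := rootElt tok H N s s') (fun i _ => rootElt_tag i)
    (q / s * s) with ⟨-, h1⟩ | ⟨q', h1, h2, h3, h4, h5⟩
  · have := h1 q hle (by omega)
    omega
  · rw [h1]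
    have hq' := isRoot_of_rootElt h4
    rcases lt_trichotomy q' q with hlt' | rfl | hlt'
    · exfalso
      obtain ⟨k', Y', hk', hg'⟩ := hc.grp q' hq'.1
      have := hq'.lt_of_lt hH h hg' hk' hlt'
      have hsz := hg'.size_of_not_small hH hk' hq'.2.1
      have hdm := Nat.div_add_mod q s
      have := Nat.mod_lt q hs
      rw [mul_comm] at hdm
      omega
    · rfl
    · have := h5 q hle hlt'
      omega

/-- The chain is first followed from the root to its end, the end is evaluated recursively, and the
composed map brings the last row back to the root. -/
theorem IsRoot.content (hx : Contracted tok H N s x) (hH : IsHeight tok H N) (hss : s ≤ s')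
    {q k : ℕ} {Y : Mat K} (h : IsRoot tok H N s s' q) (hg : Grp tok q k Y) (hk : k + 1 < N) :
    let S := suf firstTag x (2 * N)
    let S' := suf firstTag (layer tok (nx H N) x S) (2 * N)
    psiM (opOf (tok q).1) (content tok (nx H N) S S' (2 * N) (S' q).1 * (S' q).2.transpose) =
      psiM (opOf (tok q).1) Y ∧
    ∃ F, calls tok (nx H N) S S' (2 * N) (S' q).1 ≤ 1 + 4 * F ∧ F * s ≤ k + 1 - q := by
  intro S S'
  obtain ⟨e, ke, Ye, c1, c2, c3, c4, c5, c6, -⟩ :=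
    hx.chain hH hg hk (fun hq => h.2.2.2 (hq.mono hss)) h.2.1
  change (S' q).1 = _ at c5
  change ∀ c, Y 2 c = (Ye * (S' q).2.transpose : Mat K) 2 c at c6
  have hesize := c3.size_of_not_small hH (by omega) c4
  obtain ⟨i1, t, F, i2, i3, -⟩ := hx.content hH c3.seg (by omega) c3.cl
    (fun i hi hi' hHi => c3.not_small_direct hH (by omega) hesize (by omega) hi' hHi) (2 * N)
    (by omega)
  rw [c5]
  change calls tok (nx H N) S S' (2 * N) (e + 1) + _ ≤ _ at i2
  refine ⟨?_, F, by omega, by omega⟩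
  change AMPC.content tok (nx H N) S S' (2 * N) (e + 1) = Ye at i1
  rw [i1, psiM_congr _ c6]

/-- Only the opening brackets of roots obtain a new value. Each finds it in the slot of its interval
of length s, which no other root shares. -/
theorem Contracted.next (hx : Contracted tok H N s x) (hH : IsHeight tok H N) (hc : Closed tok N)
    (hs : 0 < s) (hss : s ≤ s') :
    let S := suf firstTag x (2 * N)
    let S' := suf firstTag (layer tok (nx H N) x S) (2 * N)
    Contracted tok H N s' (nextElt tok H N s s' x fun u => slotVal tok (nx H N) S S' (2 * N) s
      (suf firstTag (rootElt tok H N s s') (2 * N) (u * s)).1 u) := by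
  intro S S'
  refine ⟨?_, ?_, ?_, ?_, ?_, ?_⟩
  · intro j hj
    unfold nextElt
    have := hx.tag j hj
    split_ifs <;> simp [this]
  · intro j _ h
    simp [nextElt, h]
  · intro j _ h ht
    simp [nextElt, h, ht]
  · intro j _ h ht
    simp [nextElt, h, ht]
  · intro j _ h ho h'
    simp [nextElt, h, h', show (tok j).1 ≠ 0 by omega]
  · intro j k Y hk h hg h'
    have hn := fun hq : Small H N s j => h (hq.mono hss)
    simp only [nextElt, h, hg.op, h', if_false, true_and, if_true]
    split_ifs with h1
    · exact hx.val j k Y hk hn hg h1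
    · have hr : IsRoot tok H N s s' j := ⟨hg.op, h1, h', h⟩
      rw [slotVal, hr.suf_eq hH hc hs, if_pos ⟨by omega, by rw [Nat.add_sub_cancel]⟩]
      simp only [Nat.add_sub_cancel]
      rw [(hr.content hx hH hss hg hk).1]

/-- A sum over disjoint intervals. -/
theorem sum_slots {z q : ℕ → ℕ} {m : ℕ} (I : ℕ)
    (h1 : ∀ u, z u ≠ 0 → u * s ≤ q u ∧ q u ≤ (u + 1) * s ∧ z u ≤ m * s)
    (h2 : ∀ u u', u < u' → z u ≠ 0 → z u' ≠ 0 → q u + z u ≤ q u') :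
    ∑ b ∈ Finset.range m, z (I + b) ≤ 2 * (m * s) := by
  -- y is the right end of the last interval used so far, or the starting point. That interval
  -- starts by the end of the window and has length at most m·s, which gives the factor 2.
  have key : ∀ n, ∃ y, I * s + ∑ b ∈ Finset.range n, z (I + b) ≤ y ∧ y ≤ (I + n) * s + m * s ∧
      ∀ u, I + n ≤ u → z u ≠ 0 → y ≤ q u := by
    intro n
    induction n with
    | zero =>
      refine ⟨I * s, by simp, by simp, fun u hu hz => ?_⟩
      exact (Nat.mul_le_mul_right s hu).trans (h1 u hz).1
    | succ n ih =>
      obtain ⟨y, a1, a2, a3⟩ := ih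
      rw [Finset.sum_range_succ]
      by_cases hz : z (I + n) = 0
      · refine ⟨y, by omega, a2.trans ?_, fun u hu hz => a3 u (by omega) hz⟩
        gcongr
        omega
      · obtain ⟨b1, b2, b3⟩ := h1 _ hz
        have := a3 _ le_rfl hz
        refine ⟨q (I + n) + z (I + n), by omega, ?_, fun u hu hz' => h2 _ _ (by omega) hz hz'⟩
        rw [← add_assoc]
        omega
  obtain ⟨y, a1, a2, -⟩ := key m
  rw [add_mul] at a2
  omega

/-- Each slot costs one call plus four per s tokens of its root. The roots that start in a window of
length m·s are disjoint and shorter than m·s, so together they have at most 2·m·s tokens: m + 4·2m =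
9m. -/
theorem sum_slotCalls (hx : Contracted tok H N s x) (hH : IsHeight tok H N) (hc : Closed tok N)
    (hs : 0 < s) {m : ℕ} (hss : s' = m * s) (hm : 0 < m) (I : ℕ) :
    let S := suf firstTag x (2 * N)
    let S' := suf firstTag (layer tok (nx H N) x S) (2 * N)
    ∑ b ∈ Finset.range m, slotCalls tok (nx H N) S S' (2 * N) s
      (suf firstTag (rootElt tok H N s s') (2 * N) ((I + b) * s)).1 (I + b) ≤ 9 * m := by
  intro S S'
  have hle : s ≤ s' := by rw [hss]; exact Nat.le_mul_of_pos_left s hm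
  have key : ∀ u, ∃ z q, slotCalls tok (nx H N) S S' (2 * N) s
      (suf firstTag (rootElt tok H N s s') (2 * N) (u * s)).1 u * s ≤ s + 4 * z ∧
      (z ≠ 0 → u * s ≤ q ∧ q ≤ (u + 1) * s ∧ z ≤ m * s ∧
        ∃ k Y, k + 1 < N ∧ Grp tok q k Y ∧ IsRoot tok H N s s' q ∧ q / s = u ∧ k + 1 = q + z) := by
    intro u
    unfold slotCalls
    split_ifs with h
    · set p := (suf firstTag (rootElt tok H N s s') (2 * N) (u * s)).1 with hp
      rcases suf_spec (M := 2 * N) (x := rootElt tok H N s s') (fun i _ => rootElt_tag i)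
        (u * s) with ⟨h1, -⟩ | ⟨q, h1, h2, -, h4, -⟩
      · exact (h.1 h1).elim
      · rw [← hp] at h1
        rw [h1, Nat.add_sub_cancel] at h ⊢
        have hq := isRoot_of_rootElt h4
        obtain ⟨k, Y, hk, hg⟩ := hc.grp q hq.1
        obtain ⟨-, F, g1, g2⟩ := hq.content hx hH hle hg hk
        have hlt := hg.lt
        have hsz := hg.size_of_small hH hk hq.2.2.1
        refine ⟨k + 1 - q, q, ?_, fun _ => ⟨h2, ?_, by omega, k, Y, hk, hg, hq, h.2, by omega⟩⟩
        · refine (Nat.mul_le_mul_right s g1).trans ?_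
          rw [add_mul, one_mul, mul_assoc]
          omega
        · rw [← h.2]
          exact (Nat.lt_mul_of_div_lt (Nat.lt_succ_self (q / s)) hs).le
    · exact ⟨0, 0, by omega, by simp⟩
  choose z q h1 h2 using key
  have hsum := sum_slots (z := z) (q := q) (s := s) (m := m) I
    (fun u hu => ⟨(h2 u hu).1, (h2 u hu).2.1, (h2 u hu).2.2.1⟩) fun u u' huu hz hz' => by
      obtain ⟨-, -, -, k, Y, hk, hg, hr, e1, e2⟩ := h2 u hz
      obtain ⟨-, -, -, k', Y', hk', hg', hr', e1', e2'⟩ := h2 u' hz'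
      rw [← e2]
      refine hr.lt_of_lt hH hr' hg hk ?_
      by_contra hcon
      have := Nat.div_le_div_right (c := s) (not_lt.1 hcon)
      omega
  refine Nat.le_of_mul_le_mul_right ?_ hs
  rw [Finset.sum_mul]
  refine (Finset.sum_le_sum fun b _ => h1 (I + b)).trans ?_
  rw [Finset.sum_add_distrib, Finset.sum_const, Finset.card_range, ← Finset.mul_sum, smul_eq_mul,
    mul_assoc]
  omega

/-- No group is larger than the word, and token 0 lies strictly inside none, so its element holds
the value of the whole word. -/
theorem Contracted.final (hx : Contracted tok H N s x) (hH : IsHeight tok H N) (hN : N < s)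
    {k : ℕ} {X : Mat K} (hk : k + 1 < N) (hg : Grp tok 0 k X) :
    x 0 = (0, psiM (opOf (tok 0).1) X) := by
  refine hx.val 0 k X hk ?_ hg ?_
  · intro h
    rw [Small, sz_zero] at h
    omega
  · by_contra hc
    have := hg.size_of_not_small hH hk hc
    omega

end Step

end AMPC

namespace AMPC

open Finset

set_option linter.unusedSectionVars false

/-! ### Block tasks -/

section Block

variable {κ : Type} {K : Type*} [Field K]

instance : Inhabited (MExpr κ) := ⟨.one⟩

/-- The cell computed by an adaptive reading. -/
def RT.val (p : RT κ (ℕ × MExpr κ)) (F : κ → ℕ × Mat K) : ℕ × Mat K :=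
  ((p.run fun k => (F k).1).1, (p.run fun k => (F k).1).2.eval fun k => (F k).2)

/-- Read the tags under the keys `key 0, …, key (L - 1)`, and then compute `m` cells. -/
def blockTask (key : ℕ → κ) (L : ℕ) (cell : (ℕ → ℕ) → ℕ → RT κ (ℕ × MExpr κ)) (m : ℕ) :
    RT κ (ℕ → ℕ × MExpr κ) :=
  RT.collect (fun i => RT.get (key i)) L >>= fun f => RT.collect (cell f) m

/-- The tags read by a block task. -/
def tagsOf (F : κ → ℕ) (key : ℕ → κ) (L i : ℕ) : ℕ := if i < L then F (key i) else 0

theorem run_collect_get (F : κ → ℕ) (key : ℕ → κ) (L : ℕ) :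
    (RT.collect (fun i => RT.get (key i)) L).run F = tagsOf F key L := by
  funext i
  unfold tagsOf
  split_ifs with h
  · rw [RT.run_collect _ _ _ _ h, RT.run_get]
  · induction L with
    | zero => rfl
    | succ L ih =>
      simp only [RT.collect, RT.run_bind, RT.run_pure]
      rw [Function.update_of_ne (by omega)]
      exact ih (by omega)

theorem blockTask_out (F : κ → ℕ × Mat K) (key : ℕ → κ) (L : ℕ)
    (cell : (ℕ → ℕ) → ℕ → RT κ (ℕ × MExpr κ)) {m j : ℕ} (hj : j < m) :
    (blockTask key L cell m).out F j = (cell (tagsOf (fun k => (F k).1) key L) j).val F := by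
  simp only [RT.out, RT.val, blockTask, RT.run_bind, run_collect_get, RT.run_collect _ _ _ _ hj]

theorem blockTask_cost (F : κ → ℕ) (key : ℕ → κ) (L : ℕ)
    (cell : (ℕ → ℕ) → ℕ → RT κ (ℕ × MExpr κ)) (m : ℕ) :
    (blockTask key L cell m).cost F = L + ∑ j ∈ range m, (cell (tagsOf F key L) j).cost F := by
  simp only [blockTask, RT.cost_bind, run_collect_get, RT.cost_collect, RT.cost_get, sum_const,
    card_range, smul_eq_mul, mul_one]

theorem blockTask_vars (F : κ → ℕ) (key : ℕ → κ) (L : ℕ)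
    (cell : (ℕ → ℕ) → ℕ → RT κ (ℕ × MExpr κ)) (m : ℕ) :
    (blockVars m ((blockTask key L cell m).run F)).card ≤
      ∑ j ∈ range m, ((cell (tagsOf F key L) j).run F).2.vars.card := by
  classical
  unfold blockVars
  refine card_biUnion_le.trans (sum_le_sum fun j hj => ?_)
  simp only [blockTask, RT.run_bind, run_collect_get, RT.run_collect _ _ _ _ (mem_range.1 hj),
    le_refl]

theorem blockTask_vars' (F : κ → ℕ) (key : ℕ → κ) (L : ℕ)
    (cell : (ℕ → ℕ) → ℕ → RT κ (ℕ × MExpr κ)) (m : ℕ) (V : Finset κ)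
    (h : ∀ j < m, ((cell (tagsOf F key L) j).run F).2.vars ⊆ V) :
    (blockVars m ((blockTask key L cell m).run F)).card ≤ V.card := by
  classical
  unfold blockVars
  refine card_le_card (biUnion_subset.2 fun j hj => ?_)
  simp only [blockTask, RT.run_bind, run_collect_get, RT.run_collect _ _ _ _ (mem_range.1 hj)]
  exact h j (mem_range.1 hj)

end Block

/-! ### Arrays -/

/-- A schedule of arrays. Every array of `names` is computed in one round, its `stage`, and
copied in the later rounds. An array has `NB` blocks of `m` cells. -/
structure Layout (ι : Type) where
  names : Finset ι
  m : ℕ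
  NB : ℕ
  S : ℕ
  b : ℕ
  T : ℕ
  n : ℕ
  root : ι
  stage : ι → ℕ
  body : ι → ℕ → RT (ι × ℕ) (ℕ → ℕ × MExpr (ι × ℕ))

namespace Layout

variable {ι : Type} (d : Layout ι)

open Classical in
-- Keys that name no cell get the first address out of range, and thus read as absent.
noncomputable def adr (k : ι × ℕ) : ℕ :=
  if h : k.1 ∈ d.names ∧ k.2 < d.NB * d.m then
    (d.names.equivFin ⟨k.1, h.1⟩ * d.NB) * d.m + k.2
  else d.names.card * d.NB * d.m

noncomputable def name (i : ℕ) : Option ι :=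
  if h : i < d.names.card then some (d.names.equivFin.symm ⟨i, h⟩).1 else none

def copy (ν : ι) (B : ℕ) : RT (ι × ℕ) (ℕ → ℕ × MExpr (ι × ℕ)) :=
  blockTask (fun _ => (ν, 0)) 0 (fun _ j => do
    let t ← RT.get (ν, B * d.m + j)
    pure (t, .var (ν, B * d.m + j))) d.m

noncomputable def design : Design (ι × ℕ) where
  P := d.names.card * d.NB
  m := d.m
  S := d.S
  b := d.b
  T := d.T
  n := d.n
  root := d.adr (d.root, 0)
  adr := d.adr
  adr0 := Prod.snd
  act t μ := (d.name (μ / d.NB)).elim false fun ν => decide (d.stage ν ≤ t)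
  task t μ := (d.name (μ / d.NB)).elim (pure default) fun ν =>
    if d.stage ν = t then d.body ν (μ % d.NB) else d.copy ν (μ % d.NB)

variable {K : Type*} [Field K] (w : List (Sym K)) (g : ι → ℕ → ℕ × Mat K)

open Classical in
/-- The intended contents of the arrays. -/
noncomputable def store : ℕ → ι × ℕ → ℕ × Mat K
  | 0, k => (w[k.2]?).elim (0, 1) fun c => (c.cell.1, Matrix.of fun _ _ => c.cell.2)
  | t + 1, k => if k.1 ∈ d.names ∧ k.2 < d.NB * d.m ∧ d.stage k.1 ≤ t then g k.1 k.2 else (0, 1)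

variable {d w g}

theorem store_of_stage_lt {t : ℕ} {ν : ι} (hν : ν ∈ d.names) (ht : d.stage ν < t) (i : ℕ) :
    d.store w g t (ν, i) = if i < d.NB * d.m then g ν i else (0, 1) := by
  obtain ⟨t, rfl⟩ : ∃ t', t = t' + 1 := ⟨t - 1, by omega⟩
  simp [store, hν, Nat.le_of_lt_succ ht]

theorem adr_lt_iff (k : ι × ℕ) : d.adr k < d.names.card * d.NB * d.m ↔
    k.1 ∈ d.names ∧ k.2 < d.NB * d.m := by
  classical
  unfold adr
  split_ifs with h
  · simp only [h, and_self, iff_true]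
    have h1 : d.names.equivFin ⟨k.1, h.1⟩ + 1 ≤ d.names.card := Fin.isLt _
    have h2 := Nat.mul_le_mul_right (d.NB * d.m) h1
    rw [add_mul] at h2
    have := h.2
    rw [mul_assoc, mul_assoc]
    omega
  · simp [h]

theorem adr_spec (hm : 0 < d.m) {ν : ι} {i : ℕ} (hν : ν ∈ d.names) (hi : i < d.NB * d.m) :
    d.name (d.adr (ν, i) / d.m / d.NB) = some ν ∧ d.adr (ν, i) / d.m % d.NB = i / d.m ∧
      d.adr (ν, i) % d.m = i % d.m := by
  classical
  have hB : i / d.m < d.NB := Nat.div_lt_of_lt_mul (by rwa [mul_comm])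
  have hN : 0 < d.NB := (Nat.zero_le _).trans_lt hB
  have h1 : d.adr (ν, i) = (d.names.equivFin ⟨ν, hν⟩ * d.NB) * d.m + i := by
    unfold adr
    rw [dif_pos ⟨hν, hi⟩]
  have h2 : d.adr (ν, i) / d.m = d.names.equivFin ⟨ν, hν⟩ * d.NB + i / d.m := by
    rw [h1, mul_comm _ d.m, Nat.mul_add_div hm]
  rw [h2]
  refine ⟨?_, ?_, ?_⟩
  · rw [mul_comm, Nat.mul_add_div hN, Nat.div_eq_of_lt hB, add_zero, name, dif_pos (Fin.isLt _)]
    simp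
  · rw [mul_comm, Nat.mul_add_mod, Nat.mod_eq_of_lt hB]
  · rw [h1, mul_comm _ d.m, Nat.mul_add_mod]

theorem name_spec {i : ℕ} {ν : ι} (h : d.name i = some ν) : ν ∈ d.names := by
  unfold name at h
  split_ifs at h
  simp only [Option.some.injEq] at h
  rw [← h]
  exact Subtype.coe_prop _

theorem copy_out (F : ι × ℕ → ℕ × Mat K) (ν : ι) (B : ℕ) {j : ℕ} (hj : j < d.m) :
    (d.copy ν B).out F j = F (ν, B * d.m + j) := by
  rw [copy, blockTask_out _ _ _ _ hj]
  rfl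

theorem copy_cost (F : ι × ℕ → ℕ) (ν : ι) (B : ℕ) : (d.copy ν B).cost F +
    9 * (blockVars d.m ((d.copy ν B).run F)).card ≤ 10 * d.m := by
  classical
  have h1 : (d.copy ν B).cost F = d.m := by
    rw [copy, blockTask_cost]
    simp [RT.cost_bind]
  have h2 : (blockVars d.m ((d.copy ν B).run F)).card ≤ d.m := by
    refine (blockTask_vars F _ _ _ _).trans ?_
    simp [RT.run_bind, MExpr.vars]
  omega

/-- An array is correct in the round of its stage by assumption, and in all later rounds because it
is copied. Hence each body needs to be checked at one round only. -/
theorem runs (hm : 0 < d.m) (hw : w.length = d.n)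
    (hout : ∀ ν ∈ d.names, ∀ B < d.NB, ∀ j < d.m,
      (d.body ν B).out (d.store w g (d.stage ν)) j = g ν (B * d.m + j))
    (hcost : ∀ ν ∈ d.names, ∀ B < d.NB,
      (d.body ν B).cost (fun k => (d.store w g (d.stage ν) k).1) +
      9 * (blockVars d.m ((d.body ν B).run fun k => (d.store w g (d.stage ν) k).1)).card +
      9 * d.m + 10 ≤ d.S)
    (htag : ∀ ν ∈ d.names, ∀ i < d.NB * d.m, (g ν i).1 < 2 ^ d.b)
    (hS : 19 * d.m + 10 ≤ d.S) : d.design.Runs w (d.store w g) := by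
  classical
  have hpos : ∀ {B j}, B < d.NB → j < d.m → B * d.m + j < d.NB * d.m := by
    intro B j hB hj
    have := Nat.mul_le_mul_right d.m (Nat.succ_le_of_lt hB)
    rw [Nat.succ_mul] at this
    omega
  have hkey : ∀ t ν B, ν ∈ d.names → B < d.NB → d.stage ν ≤ t → ∀ j < d.m,
      (if d.stage ν = t then d.body ν B else d.copy ν B).out (d.store w g t) j =
        g ν (B * d.m + j) := by
    intro t ν B hν hB ht j hj
    split_ifs with h
    · rw [← h]
      exact hout ν hν B hB j hj
    · rw [copy_out _ _ _ hj, store_of_stage_lt hν (by omega), if_pos (hpos hB hj)]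
  refine ⟨hw, fun k => rfl, ?_, ?_, ?_⟩
  · rintro t - ⟨ν, i⟩
    change (if ν ∈ d.names ∧ i < d.NB * d.m ∧ d.stage ν ≤ t then g ν i else (0, 1)) =
      if d.adr (ν, i) < d.names.card * d.NB * d.m ∧ d.design.act t (d.adr (ν, i) / d.m) then
        (d.design.task t (d.adr (ν, i) / d.m)).out (d.store w g t) (d.adr (ν, i) % d.m) else (0, 1)
    simp only [adr_lt_iff]
    by_cases h : ν ∈ d.names ∧ i < d.NB * d.m
    · obtain ⟨h1, h2, h3⟩ := adr_spec hm h.1 h.2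
      have hB : i / d.m < d.NB := Nat.div_lt_of_lt_mul (by rw [mul_comm]; exact h.2)
      simp only [design, h1, Option.elim_some, decide_eq_true_eq, h, true_and]
      split_ifs with hst hst'
      · have := hkey t ν (i / d.m) h.1 hB hst (i % d.m) (Nat.mod_lt _ hm)
        rw [if_pos hst', mul_comm, Nat.div_add_mod] at this
        rw [h2, h3, this]
      · have := hkey t ν (i / d.m) h.1 hB hst (i % d.m) (Nat.mod_lt _ hm)
        rw [if_neg hst', mul_comm, Nat.div_add_mod] at this
        rw [h2, h3, this]
      · rfl
    · rw [if_neg (by tauto), if_neg (by tauto)]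
  · intro t ht μ hμ hact
    change μ < d.names.card * d.NB at hμ
    have hN : 0 < d.NB := Nat.pos_of_mul_pos_left (by omega : 0 < d.names.card * d.NB)
    have hB := Nat.mod_lt μ hN
    simp only [design] at hact ⊢
    cases hn : d.name (μ / d.NB) with
    | none => simp [hn] at hact
    | some ν =>
      simp only [hn, Option.elim_some] at hact ⊢
      split_ifs with h
      · rw [← h]
        exact hcost ν (name_spec hn) _ hB
      · have := copy_cost (d := d) (fun k => (d.store w g t k).1) ν (μ % d.NB)
        omega
  · intro t ht μ hμ hact j hj
    change μ < d.names.card * d.NB at hμ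
    have hN : 0 < d.NB := Nat.pos_of_mul_pos_left (by omega : 0 < d.names.card * d.NB)
    have hB := Nat.mod_lt μ hN
    simp only [design] at hact hj ⊢
    cases hn : d.name (μ / d.NB) with
    | none => simp [hn] at hact
    | some ν =>
      simp only [hn, Option.elim_some, decide_eq_true_eq] at hact ⊢
      rw [hkey t ν _ (name_spec hn) hB hact j hj]
      exact htag ν (name_spec hn) _ (hpos hB hj)

theorem outputs (hm : 0 < d.m) (hR : d.design.Runs w (d.store w g)) (hbn : d.n ≤ 2 ^ d.b)
    (hbP : 9 * (d.names.card * d.NB * d.m) ≤ 2 ^ d.b) (hroot : d.root ∈ d.names)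
    (hNB : 0 < d.NB) (hT : d.stage d.root < d.T) (hS : 10 ≤ d.S) (hq : (g d.root 0).2 2 2 ≠ 0) :
    d.design.algorithm.Outputs w ((g d.root 0).2 2 1 / (g d.root 0).2 2 2) := by
  have hpos : 0 < d.NB * d.m := Nat.mul_pos hNB hm
  have hst : d.store w g d.T (d.root, 0) = g d.root 0 := by
    rw [store_of_stage_lt hroot hT, if_pos hpos]
  have := Design.algorithm_outputs hR hbn hbP (k₀ := (d.root, 0)) (by change 0 < d.T; omega) rfl
    ((adr_lt_iff _).2 ⟨hroot, hpos⟩)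
    (by
      obtain ⟨h1, -, -⟩ := adr_spec hm hroot hpos
      simp only [design, h1, Option.elim_some, decide_eq_true_eq]
      omega) hS
    (by change (d.store w g d.T (d.root, 0)).2 2 2 ≠ 0; rw [hst]; exact hq)
  change d.design.algorithm.Outputs w ((d.store w g d.T (d.root, 0)).2 2 1 /
    (d.store w g d.T (d.root, 0)).2 2 2) at this
  rwa [hst] at this

end Layout

end AMPC

namespace AMPC

open Finset

set_option linter.unusedSectionVars false

/-! ### Blockwise scans -/

section BlockScan

variable {K : Type*} [Field K] {f : ℕ → ℕ → ℕ}

theorem scanN_congr {x y : ℕ → ℕ × Mat K} {j n : ℕ} (h : ∀ i, j ≤ i → i < j + n → x i = y i) :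
    scanN f x j n = scanN f y j n := by
  induction n generalizing j with
  | zero => rfl
  | succ n ih => rw [scanN, scanN, h j le_rfl (by omega), ih fun i h1 h2 => h i (by omega) (by omega)]

theorem scanN_shift (x : ℕ → ℕ × Mat K) (b j n : ℕ) :
    scanN f (fun i => x (b + i)) j n = scanN f x (b + j) n := by
  induction n generalizing j with
  | zero => rfl
  | succ n ih => rw [scanN, scanN, ih, add_assoc]

theorem scanN_mul (hf : TagOp f) (x : ℕ → ℕ × Mat K) (L j n : ℕ) :
    scanN f (fun i => scanN f x (i * L) L) j n = scanN f x (j * L) (n * L) := by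
  induction n generalizing j with
  | zero => simp [scanN]
  | succ n ih =>
    rw [scanN, ih, add_mul n, one_mul, add_comm (n * L), scanN_add hf, add_mul, one_mul]

/-- The combination of the elements of the `i`-th interval of length `m ^ r` and the following
ones, up to the end of the interval of length `m ^ (r + 1)`. -/
def preScan (f : ℕ → ℕ → ℕ) (x : ℕ → ℕ × Mat K) (m r i : ℕ) : ℕ × Mat K :=
  scanN f x (i * m ^ r) ((m - i % m) * m ^ r)

/-- The combination of the elements from `j` on, up to the end of the interval of length
`m ^ (r + 1)`. -/
def blockScan (f : ℕ → ℕ → ℕ) (x : ℕ → ℕ × Mat K) (m r j : ℕ) : ℕ × Mat K :=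
  scanN f x j (m ^ (r + 1) - j % m ^ (r + 1))

variable {x : ℕ → ℕ × Mat K} {m : ℕ}

theorem preScan_zero {B j : ℕ} (hj : j < m) :
    scanN f (fun i => x (B * m + i)) j (m - j) = preScan f x m 0 (B * m + j) := by
  rw [scanN_shift, preScan, pow_zero, mul_one, mul_one, Nat.mul_add_mod_of_lt hj]

/-- At a multiple of m, `preScan` combines all m children and thus is the scan of a whole interval
of the next level. -/
theorem preScan_succ (hf : TagOp f) {B j r : ℕ} (hj : j < m) :
    scanN f (fun i => preScan f x m r (m * (B * m + i))) j (m - j) =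
      preScan f x m (r + 1) (B * m + j) := by
  have : (fun i => preScan f x m r (m * (B * m + i))) = fun i =>
      (fun i' => scanN f x (i' * m ^ (r + 1)) (m ^ (r + 1))) (B * m + i) := by
    funext i
    rw [preScan, Nat.mul_mod_right, Nat.sub_zero]
    ring_nf
  rw [this, scanN_shift (fun i' => scanN f x (i' * m ^ (r + 1)) (m ^ (r + 1))), scanN_mul hf,
    preScan, Nat.mul_add_mod_of_lt hj]

theorem blockScan_zero (j : ℕ) : blockScan f x m 0 j = preScan f x m 0 j := by
  simp [blockScan, preScan]

/-- To get from the end of the interval of length m^(r+1) to the end of its parent, one appends the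
siblings to the right, which is a single `preScan`; the last sibling has none. -/
theorem blockScan_succ (hf : TagOp f) (hm : 0 < m) (r j : ℕ) :
    blockScan f x m (r + 1) j = if j / m ^ (r + 1) % m = m - 1 then blockScan f x m r j
      else comb f (blockScan f x m r j) (preScan f x m (r + 1) (j / m ^ (r + 1) + 1)) := by
  have hL : 0 < m ^ (r + 1) := by positivity
  unfold blockScan preScan
  rw [pow_succ m (r + 1), Nat.mod_mul]
  set L := m ^ (r + 1)
  have h1 := Nat.mod_lt j hL
  have h2 := Nat.mod_lt (j / L) hm
  have h3 := Nat.div_add_mod j L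
  set i := j / L
  obtain ⟨c, hc⟩ : ∃ c, m = i % m + 1 + c := ⟨m - (i % m + 1), by omega⟩
  have h4 : L * m - (j % L + L * (i % m)) = (L - j % L) + c * L := by
    have : L * m = L * (i % m) + L + c * L := by
      conv_lhs => rw [hc]
      ring
    omega
  rw [h4]
  split_ifs with h
  · rw [show c = 0 by omega, zero_mul, add_zero]
  · rw [scanN_add hf]
    have h5 : (i + 1) % m = i % m + 1 := by
      rw [Nat.add_mod, Nat.mod_eq_of_lt (by omega : 1 < m), Nat.mod_eq_of_lt (by omega)]
    rw [h5, show m - (i % m + 1) = c by omega]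
    congr 2
    rw [add_mul, one_mul, mul_comm i]
    omega

/-- The elements number `0, …, M - 1`, continued by neutral elements. -/
def cut (M : ℕ) (x : ℕ → ℕ × Mat K) (i : ℕ) : ℕ × Mat K := if i < M then x i else (0, 1)

theorem preScan_cut_of_le (hf : TagOp f) {M : ℕ} (hm : 0 < m) {r i : ℕ} (hi : M ≤ i) :
    preScan f (cut M x) m r i = (0, 1) := by
  refine scanN_eq_one hf (fun i' hi' => ?_) _
  have : i ≤ i * m ^ r := Nat.le_mul_of_pos_right _ (by positivity)
  rw [cut, if_neg (by omega)]

theorem blockScan_cut_of_le (hf : TagOp f) {M : ℕ} {r j : ℕ} (hj : M ≤ j) :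
    blockScan f (cut M x) m r j = (0, 1) := by
  refine scanN_eq_one hf (fun i' hi' => ?_) _
  rw [cut, if_neg (by omega)]

theorem blockScan_eq_suf (hf : TagOp f) {M r : ℕ} (hM : M ≤ m ^ (r + 1)) (j : ℕ) :
    blockScan f (cut M x) m r j = suf f x M j := by
  rcases Nat.lt_or_ge j M with hj | hj
  · rw [blockScan, suf, Nat.mod_eq_of_lt (by omega),
      show m ^ (r + 1) - j = (M - j) + (m ^ (r + 1) - M) by omega, scanN_add hf,
      scanN_eq_one hf (j := j + (M - j)), comb_one hf]
    · exact scanN_congr fun i h1 h2 => by rw [cut, if_pos (by omega)]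
    · intro i hi
      rw [cut, if_neg (by omega)]
  · rw [suf_of_le x hj, blockScan_cut_of_le hf hj]

theorem scanN_tag_le {B : ℕ} (h : ∀ i, (x i).1 ≤ B) (j n : ℕ) :
    (scanN firstTag x j n).1 ≤ B := by
  induction n generalizing j with
  | zero => exact Nat.zero_le _
  | succ n ih =>
    simp only [scanN, comb, firstTag]
    split_ifs
    · exact ih _
    · exact h j

theorem scanN_tag_le_add {M B : ℕ} (h : ∀ i, (x i).1 ≤ B) (j n : ℕ) :
    (scanN (· + ·) (cut M x) j n).1 ≤ (M - j) * B := by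
  induction n generalizing j with
  | zero => exact Nat.zero_le _
  | succ n ih =>
    simp only [scanN, comb]
    have h1 := ih (j + 1)
    have h2 := h j
    rcases Nat.lt_or_ge j M with hj | hj
    · rw [show M - j = M - (j + 1) + 1 by omega, add_mul, one_mul, cut, if_pos hj]
      omega
    · rw [Nat.sub_eq_zero_of_le (by omega : M ≤ j + 1)] at h1
      rw [Nat.sub_eq_zero_of_le hj, cut, if_neg (by omega)]
      simpa using h1

variable {κ : Type}

/-- Symbolic combination. -/
def scanX (f : ℕ → ℕ → ℕ) (tag : ℕ → ℕ) (key : ℕ → κ) : ℕ → ℕ → ℕ × MExpr κ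
  | _, 0 => (0, .one)
  | j, n + 1 => (f (tag j) (scanX f tag key (j + 1) n).1,
      if tag j = 0 then .mul (.var (key j)) (scanX f tag key (j + 1) n).2 else .var (key j))

theorem scanX_eval (tag : ℕ → ℕ) (key : ℕ → κ) (env : κ → Mat K) (j n : ℕ) :
    ((scanX f tag key j n).1, (scanX f tag key j n).2.eval env) =
      scanN f (fun i => (tag i, env (key i))) j n := by
  induction n generalizing j with
  | zero => rfl
  | succ n ih =>
    simp only [scanX, scanN, comb, ← ih (j + 1)]
    refine Prod.ext rfl ?_
    dsimp only
    split_ifs <;> rfl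

theorem scanX_vars [DecidableEq κ] (tag : ℕ → ℕ) (key : ℕ → κ) (j n : ℕ) :
    (scanX f tag key j n).2.vars ⊆ (range (j + n)).image key := by
  induction n generalizing j with
  | zero => simp [scanX, MExpr.vars]
  | succ n ih =>
    have hj : key j ∈ (range (j + (n + 1))).image key := mem_image_of_mem _ (by simp)
    have := ih (j + 1)
    rw [show j + 1 + n = j + (n + 1) by ring] at this
    simp only [scanX]
    split_ifs
    · intro k hk
      simp only [MExpr.vars, mem_union, mem_singleton] at hk
      rcases hk with rfl | hk
      · exact hj
      · exact this hk
    · simpa [MExpr.vars] using hj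

/-- Scan the values under the keys `src 0, …, src (m - 1)`. -/
def preTask (f : ℕ → ℕ → ℕ) (src : ℕ → κ) (m : ℕ) : RT κ (ℕ → ℕ × MExpr κ) :=
  blockTask src m (fun tag j => pure (scanX f tag src j (m - j))) m

theorem preTask_out (F : κ → ℕ × Mat K) (src : ℕ → κ) {j : ℕ} (hj : j < m) :
    (preTask f src m).out F j = scanN f (fun i => F (src i)) j (m - j) := by
  rw [preTask, blockTask_out _ _ _ _ hj, RT.val, RT.run_pure, scanX_eval]
  exact scanN_congr fun i h1 h2 => by rw [tagsOf, if_pos (by omega)]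

theorem preTask_cost (F : κ → ℕ) (src : ℕ → κ) : (preTask f src m).cost F +
    9 * (blockVars m ((preTask f src m).run F)).card ≤ 10 * m := by
  classical
  have h1 : (preTask f src m).cost F = m := by
    rw [preTask, blockTask_cost]
    simp
  have h2 : (blockVars m ((preTask f src m).run F)).card ≤ m := by
    refine (blockTask_vars' F _ _ _ _ ((range m).image src) fun j hj => ?_).trans
      (card_image_le.trans (by simp))
    have := scanX_vars (f := f) (tagsOf F src m) src j (m - j)
    rwa [show j + (m - j) = m by omega] at this
  omega

end BlockScan

/-! ### Searching for larger values -/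

section Search

/-- The supremum of `h` on the interval number `i` of length `L`. -/
def unitMax (h : ℕ → ℕ) (L i : ℕ) : ℕ := (Ico (i * L) ((i + 1) * L)).sup h

/-- The supremum up to interval number `i` of length `L`, from a multiple of `m` on. -/
def preMax (h : ℕ → ℕ) (m L i : ℕ) : ℕ := (Ico ((i - i % m) * L) ((i + 1) * L)).sup h

variable {h : ℕ → ℕ} {m : ℕ}

theorem lt_unitMax {L i v : ℕ} (hL : 0 < L) : v < unitMax h L i ↔ ∃ k, k / L = i ∧ v < h k := by
  unfold unitMax
  simp only [Finset.lt_sup_iff, mem_Ico]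
  constructor
  · rintro ⟨k, ⟨h1, h2⟩, h3⟩
    exact ⟨k, Nat.div_eq_of_lt_le h1 h2, h3⟩
  · rintro ⟨k, rfl, h3⟩
    exact ⟨k, ⟨Nat.div_mul_le_self k L, Nat.lt_mul_of_div_lt (Nat.lt_succ_self _) hL⟩, h3⟩

theorem lt_unitMax_mul {L i v : ℕ} (hL : 0 < L) (hm : 0 < m) :
    v < unitMax h (L * m) i ↔ ∃ c, c / m = i ∧ v < unitMax h L c := by
  rw [lt_unitMax (by positivity)]
  simp only [lt_unitMax hL]
  constructor
  · rintro ⟨k, rfl, hk⟩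
    exact ⟨k / L, Nat.div_div_eq_div_mul _ _ _, k, rfl, hk⟩
  · rintro ⟨c, rfl, k, rfl, hk⟩
    exact ⟨k, (Nat.div_div_eq_div_mul _ _ _).symm, hk⟩

theorem unitMax_one (i : ℕ) : unitMax h 1 i = h i := by
  simp [unitMax]

/-- The last prefix maximum among siblings is the maximum of the parent, so no separate array of
interval maxima is needed. -/
theorem preMax_last (hm : 0 < m) (L i : ℕ) : preMax h m L (m * i + (m - 1)) = unitMax h (L * m) i := by
  have h1 : (m * i + (m - 1)) % m = m - 1 := by
    rw [Nat.mul_add_mod, Nat.mod_eq_of_lt (by omega)]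
  rw [preMax, h1, unitMax]
  congr 2
  · rw [Nat.add_sub_cancel]; ring
  · rw [show m * i + (m - 1) + 1 = m * (i + 1) by rw [mul_add]; omega]; ring

theorem sup_unitMax (L b j : ℕ) :
    (range (j + 1)).sup (fun i => unitMax h L (b + i)) = (Ico (b * L) ((b + j + 1) * L)).sup h := by
  induction j with
  | zero => simp [unitMax]
  | succ j ih =>
    rw [range_add_one, sup_insert, ih, unitMax, sup_comm, ← sup_union, ← add_assoc b j 1, Ico_union_Ico_eq_Ico]
    · exact Nat.mul_le_mul_right _ (by omega)
    · exact Nat.mul_le_mul_right _ (by omega)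

theorem preMax_eq {L B j : ℕ} (hj : j < m) :
    (range (j + 1)).sup (fun i => unitMax h L (B * m + i)) = preMax h m L (B * m + j) := by
  rw [sup_unitMax, preMax, Nat.mul_add_mod_of_lt hj, Nat.add_sub_cancel]

theorem lt_preMax {L I c v : ℕ} (hc : c < m) :
    v < preMax h m L (I * m + c) ↔ ∃ c' ≤ c, v < unitMax h L (I * m + c') := by
  rw [← preMax_eq hc, Finset.lt_sup_iff]
  simp

open Classical in
/-- One more than the first number with property `p`, or zero. -/
noncomputable def first (p : ℕ → Prop) : ℕ := if h : ∃ i, p i then Nat.find h + 1 else 0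

theorem first_eq_succ {p : ℕ → Prop} {i : ℕ} (hi : p i) (h : ∀ i' < i, ¬ p i') : first p = i + 1 := by
  classical
  rw [first, dif_pos ⟨i, hi⟩, add_left_inj, Nat.find_eq_iff]
  exact ⟨hi, fun i' => h i'⟩

theorem first_eq_zero {p : ℕ → Prop} (h : ∀ i, ¬ p i) : first p = 0 := by
  rw [first, dif_neg (by simpa using h)]

theorem first_cases (p : ℕ → Prop) : (first p = 0 ∧ ∀ i, ¬ p i) ∨
    ∃ i, first p = i + 1 ∧ p i ∧ ∀ i' < i, ¬ p i' := by
  classical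
  by_cases h : ∃ i, p i
  · right
    exact ⟨Nat.find h, by rw [first, dif_pos h], Nat.find_spec h, fun i' hi' => Nat.find_min h hi'⟩
  · left
    push Not at h
    exact ⟨first_eq_zero h, h⟩

/-- One more than the number of the first interval of length `L`, after the one with `j`, that
contains a value larger than `h j`; or zero. -/
noncomputable def nextLarger (h : ℕ → ℕ) (L j : ℕ) : ℕ := first fun i => j / L < i ∧ h j < unitMax h L i

/-- An interval that comes before all candidates within the parent of j does not come after j. -/
theorem nextLarger_of_sibling {L j c : ℕ}
    (hc : first (fun c => c < m ∧ j / L < j / (L * m) * m + c ∧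
      h j < unitMax h L (j / (L * m) * m + c)) = c + 1) :
    nextLarger h L j = j / (L * m) * m + c + 1 := by
  rcases first_cases (fun c => c < m ∧ j / L < j / (L * m) * m + c ∧
      h j < unitMax h L (j / (L * m) * m + c)) with ⟨h0, -⟩ | ⟨c', h1, h2, h3⟩
  · omega
  · obtain rfl : c' = c := by omega
    refine first_eq_succ ⟨h2.2.1, h2.2.2⟩ fun i hi hp => ?_
    have hle : j / (L * m) * m ≤ j / L := by
      rw [← Nat.div_div_eq_div_mul]
      exact Nat.div_mul_le_self _ _
    obtain ⟨d, rfl⟩ : ∃ d, i = j / (L * m) * m + d := ⟨i - j / (L * m) * m, by omega⟩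
    exact h3 d (by omega) ⟨by omega, hp⟩

/-- If no sibling qualifies, the answer lies in a later parent, namely in the first one with a
larger value. Inside that parent the prefix maxima are monotone, so the answer is the threshold that
a binary search finds. -/
theorem nextLarger_of_no_sibling {L j : ℕ} (hL : 0 < L) (hm : 0 < m)
    (hc : first (fun c => c < m ∧ j / L < j / (L * m) * m + c ∧
      h j < unitMax h L (j / (L * m) * m + c)) = 0) :
    (nextLarger h (L * m) j = 0 → nextLarger h L j = 0) ∧
    ∀ I, nextLarger h (L * m) j = I + 1 → ∃ c < m, nextLarger h L j = I * m + c + 1 ∧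
      ∀ c' < m, h j < preMax h m L (I * m + c') ↔ c ≤ c' := by
  rcases first_cases (fun c => c < m ∧ j / L < j / (L * m) * m + c ∧
      h j < unitMax h L (j / (L * m) * m + c)) with ⟨-, h0⟩ | ⟨c', h1, h2, h3⟩
  swap
  · omega
  have hno : ∀ i, j / L < i → h j < unitMax h L i → j / (L * m) < i / m := by
    intro i hi hv
    have hle : j / (L * m) ≤ i / m := by
      rw [← Nat.div_div_eq_div_mul]
      exact Nat.div_le_div_right hi.le
    refine hle.lt_of_ne fun he => h0 (i % m) ?_
    have := Nat.div_add_mod i m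
    rw [he, mul_comm, this]
    exact ⟨Nat.mod_lt _ hm, hi, hv⟩
  rcases first_cases (fun I => j / (L * m) < I ∧ h j < unitMax h (L * m) I) with
    ⟨g0, g1⟩ | ⟨I, g0, ⟨g1, g1'⟩, g2⟩
  · refine ⟨fun _ => first_eq_zero fun i hi => g1 (i / m) ⟨hno i hi.1 hi.2, ?_⟩, ?_⟩
    · exact (lt_unitMax_mul hL hm).2 ⟨i, rfl, hi.2⟩
    · intro I hI
      unfold nextLarger at hI
      omega
  · refine ⟨fun hz => ?_, ?_⟩
    · unfold nextLarger at hz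
      omega
    · intro I' hI'
      obtain rfl : I = I' := by
        unfold nextLarger at hI'
        omega
      obtain ⟨i0, e1, e2⟩ := (lt_unitMax_mul hL hm).1 g1'
      rcases first_cases (fun c => h j < unitMax h L (I * m + c)) with ⟨-, k1⟩ | ⟨c, -, k1, k2⟩
      · refine (k1 (i0 % m) ?_).elim
        rw [← e1, mul_comm, Nat.div_add_mod]
        exact e2
      · have hcm : c < m := by
          by_contra hcon
          refine k2 (i0 % m) ((Nat.mod_lt _ hm).trans_le (by omega)) ?_
          rw [← e1, mul_comm, Nat.div_add_mod]
          exact e2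
        refine ⟨c, hcm, first_eq_succ ⟨?_, k1⟩ ?_, ?_⟩
        · have : j / L < I * m := by
            rw [← Nat.div_div_eq_div_mul] at g1
            exact Nat.lt_mul_of_div_lt g1 hm
          omega
        · rintro i hi ⟨p1, p2⟩
          have h1 := hno i p1 p2
          have h2 : I ≤ i / m := by
            by_contra hcon
            exact g2 (i / m) (by omega) ⟨h1, (lt_unitMax_mul hL hm).2 ⟨i, rfl, p2⟩⟩
          have h3 : I * m ≤ i := (Nat.mul_le_mul_right m h2).trans (Nat.div_mul_le_self i m)
          obtain ⟨d, rfl⟩ : ∃ d, i = I * m + d := ⟨i - I * m, by omega⟩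
          exact k2 d (by omega) p2
        · intro c' hc'
          rw [lt_preMax hc']
          constructor
          · rintro ⟨c'', q1, q2⟩
            by_contra hcon
            exact k2 c'' (by omega) q2
          · intro q
            exact ⟨c, q, k1⟩

/-- Start of the descent: a single interval covers everything, so there is no later one. -/
theorem nextLarger_of_le {L j M : ℕ} (hL : M ≤ L) (hh : ∀ i, M ≤ i → h i = 0) :
    nextLarger h L j = 0 := by
  refine first_eq_zero fun i hi => ?_
  rcases Nat.eq_zero_or_pos L with rfl | hp
  · obtain ⟨h1, h2⟩ := hi
    simp [unitMax] at h2
  · obtain ⟨h1, h2⟩ := hi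
    obtain ⟨k, rfl, h3⟩ := (lt_unitMax hp).1 h2
    have : 1 ≤ k / L := (Nat.zero_le _).trans_lt h1
    have := (Nat.one_le_div_iff hp).1 this
    rw [hh k (by omega)] at h3
    exact absurd h3 (Nat.not_lt_zero _)

/-- Next smaller values as next larger values. -/
theorem nextLarger_eq_ns {g : ℕ → ℕ} {M C : ℕ} (hg : ∀ i, g i ≤ C) {j : ℕ} (hj : j < M) :
    nextLarger (fun i => if i < M then C - g i else 0) 1 j = ns g M j := by
  have : (fun i => j / 1 < i ∧ (if j < M then C - g j else 0) <
      unitMax (fun i => if i < M then C - g i else 0) 1 i) = fun i => j < i ∧ i < M ∧ g i < g j := by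
    funext i
    have h1 := hg i
    have h2 := hg j
    rw [unitMax_one, Nat.div_one, if_pos hj]
    refine propext ?_
    split_ifs <;> omega
  rw [nextLarger, this, first, ns]
  congr!

variable {κ : Type} {K : Type*} [Field K]

/-- Binary search for the first key whose tag is larger than `v`. -/
def bsearch (key : ℕ → κ) (v : ℕ) : ℕ → ℕ → RT κ ℕ
  | 0, lo => pure lo
  | a + 1, lo => RT.get (key (lo + 2 ^ a - 1)) >>= fun t =>
      if v < t then bsearch key v a lo else bsearch key v a (lo + 2 ^ a)

theorem bsearch_run (F : κ → ℕ) (key : ℕ → κ) (v a lo c m : ℕ) (h1 : lo ≤ c) (h2 : c < lo + 2 ^ a)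
    (hm : lo + 2 ^ a ≤ m) (h : ∀ c' < m, v < F (key c') ↔ c ≤ c') :
    (bsearch key v a lo).run F = c := by
  induction a generalizing lo with
  | zero =>
    rw [bsearch, RT.run_pure]
    omega
  | succ a ih =>
    have hp : 0 < 2 ^ a := by positivity
    rw [pow_succ] at h2 hm
    rw [bsearch, RT.run_bind, RT.run_get]
    have := h (lo + 2 ^ a - 1) (by omega)
    split_ifs with hv
    · exact ih lo h1 (by have := this.1 hv; omega) (by omega)
    · exact ih _ (by by_contra hc; exact hv (this.2 (by omega))) (by omega) (by omega)

theorem bsearch_cost (F : κ → ℕ) (key : ℕ → κ) (v a lo : ℕ) :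
    (bsearch key v a lo).cost F ≤ a := by
  induction a generalizing lo with
  | zero => exact le_rfl
  | succ a ih =>
    rw [bsearch, RT.cost_bind, RT.cost_get]
    split_ifs
    · have := ih lo; omega
    · have := ih (lo + 2 ^ a); omega

/-- Compute prefix maxima of the tags under `src 0, …, src (m - 1)`. -/
def maxTask (src : ℕ → κ) (m : ℕ) : RT κ (ℕ → ℕ × MExpr κ) :=
  blockTask src m (fun tag j => pure ((range (j + 1)).sup tag, .one)) m

theorem maxTask_out (F : κ → ℕ × Mat K) (src : ℕ → κ) {j : ℕ} (hj : j < m) :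
    (maxTask src m).out F j = ((range (j + 1)).sup fun i => (F (src i)).1, 1) := by
  rw [maxTask, blockTask_out _ _ _ _ hj, RT.val, RT.run_pure]
  refine Prod.ext ?_ rfl
  change (range (j + 1)).sup (tagsOf (fun k => (F k).1) src m) = _
  refine Finset.sup_congr rfl fun i hi => ?_
  rw [mem_range] at hi
  rw [tagsOf, if_pos (by omega)]

theorem maxTask_cost (F : κ → ℕ) (src : ℕ → κ) : (maxTask src m).cost F +
    9 * (blockVars m ((maxTask src m).run F)).card ≤ m := by
  have h1 : (maxTask src m).cost F = m := by
    rw [maxTask, blockTask_cost]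
    simp
  have h2 : (blockVars m ((maxTask src m).run F)).card ≤ 0 := by
    refine (blockTask_vars F _ _ _ _).trans ?_
    simp [MExpr.vars]
  omega

/-- Find the next larger interval of length `L` for the positions `b, …, b + m - 1`, which lie in
interval number `u` of length `L * m`: look at the intervals `src` in there, or else go down from
the interval of length `L * m` found under `down`. -/
noncomputable def nextTask (val down pre src : ℕ → κ) (m a L b u : ℕ) :
    RT κ (ℕ → ℕ × MExpr κ) :=
  blockTask src m (fun tag j => RT.get (val (b + j)) >>= fun v =>
    if first (fun c => c < m ∧ (b + j) / L < u * m + c ∧ v < tag c) ≠ 0 then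
      pure (u * m + first (fun c => c < m ∧ (b + j) / L < u * m + c ∧ v < tag c), .one)
    else RT.get (down (b + j)) >>= fun d =>
      if d = 0 then pure (0, .one)
      else bsearch (fun c => pre ((d - 1) * m + c)) v a 0 >>= fun c =>
        pure ((d - 1) * m + c + 1, .one)) m

theorem nextTask_out (F : κ → ℕ × Mat K) (val down pre src : ℕ → κ) {a L b u j : ℕ} (hj : j < m)
    (hL : 0 < L) (ha : m = 2 ^ a) (hu : (b + j) / (L * m) = u)
    (hval : (F (val (b + j))).1 = h (b + j))
    (hdown : (F (down (b + j))).1 = nextLarger h (L * m) (b + j))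
    (hpre : ∀ i, (F (pre i)).1 = preMax h m L i)
    (hsrc : ∀ c < m, (F (src c)).1 = unitMax h L (u * m + c)) :
    (nextTask val down pre src m a L b u).out F j = (nextLarger h L (b + j), 1) := by
  have hm : 0 < m := by omega
  subst hu
  have hfun : (fun c => c < m ∧ (b + j) / L < (b + j) / (L * m) * m + c ∧
      h (b + j) < tagsOf (fun k => (F k).1) src m c) = fun c => c < m ∧
      (b + j) / L < (b + j) / (L * m) * m + c ∧
      h (b + j) < unitMax h L ((b + j) / (L * m) * m + c) := by
    funext c
    refine propext (and_congr_right fun hc => ?_)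
    rw [tagsOf, if_pos hc, hsrc c hc]
  rw [nextTask, blockTask_out _ _ _ _ hj, RT.val]
  simp only [RT.run_bind, RT.run_get, hval, hfun]
  split_ifs with h1
  · obtain ⟨c, hc⟩ := Nat.exists_eq_succ_of_ne_zero h1
    rw [RT.run_pure, hc, nextLarger_of_sibling hc]
    rfl
  · rw [not_not] at h1
    simp only [RT.run_bind, RT.run_get, hdown]
    obtain ⟨g1, g2⟩ := nextLarger_of_no_sibling hL hm h1
    rcases hd : nextLarger h (L * m) (b + j) with _ | I
    · rw [g1 hd]
      rfl
    · obtain ⟨c, hc, e1, e2⟩ := g2 I hd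
      rw [if_neg (by omega), RT.run_bind, bsearch_run _ _ _ _ _ c m (by omega) (by omega) (by omega)]
      · rw [e1]
        rfl
      · simpa only [Nat.add_sub_cancel, hpre] using e2

/-- Reads only: m maxima of siblings for the whole block, and for each position its own value, the
answer one level up, and `a` steps of binary search. -/
theorem nextTask_cost (F : κ → ℕ) (val down pre src : ℕ → κ) (a L b u : ℕ) :
    (nextTask val down pre src m a L b u).cost F +
      9 * (blockVars m ((nextTask val down pre src m a L b u).run F)).card ≤ m + m * (a + 2) := by
  have h1 : (nextTask val down pre src m a L b u).cost F ≤ m + m * (a + 2) := by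
    rw [nextTask, blockTask_cost]
    refine Nat.add_le_add_left ((sum_le_card_nsmul _ _ (a + 2) fun j _ => ?_).trans (by simp)) _
    rw [RT.cost_bind, RT.cost_get]
    split_ifs
    · simp
    · rw [RT.cost_bind, RT.cost_get]
      split_ifs
      · simp
      · rw [RT.cost_bind, RT.cost_pure]
        have := bsearch_cost F (fun c => pre ((F (down (b + j)) - 1) * m + c)) (F (val (b + j))) a 0
        rw [RT.run_get, RT.run_get]
        omega
  have h2 : (blockVars m ((nextTask val down pre src m a L b u).run F)).card ≤ 0 := by
    refine (blockTask_vars F _ _ _ _).trans (le_of_eq (sum_eq_zero fun j _ => ?_))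
    rw [RT.run_bind, card_eq_zero]
    split_ifs
    · rfl
    · rw [RT.run_bind]
      split_ifs
      · rfl
      · rw [RT.run_bind]
        rfl
  omega

end Search

end AMPC

namespace AMPC

open Finset

set_option linter.unusedSectionVars false

/-! ### The arrays of the algorithm -/

inductive Scan | height | value | chain | root

/-- `ht` holds the contributions to the height, `level` the mirrored heights subtracted from 4N,
`pmax` their prefix maxima, `lay` the chain maps, and `out` the newly computed values, one for each
interval of length m^l. -/
inductive Kind | tok | ht | level | pmax | next | size | elt | lay | root | out | pre (c : Scan)
  | scan (c : Scan)

def Kind.all : List Kind :=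
  [.tok, .ht, .level, .pmax, .next, .size, .elt, .lay, .root, .out, .pre .height, .pre .value,
    .pre .chain, .pre .root, .scan .height, .scan .value, .scan .chain, .scan .root]

theorem Kind.mem_all (k : Kind) : k ∈ Kind.all := by
  unfold Kind.all
  cases k with
  | pre c => cases c <;> simp
  | scan c => cases c <;> simp
  | _ => simp

/-- Names of arrays: the kind, the phase, and the level. -/
abbrev Name := Kind × ℕ × ℕ

abbrev Key := Name × ℕ

section Cells

variable {K : Type*} [Field K]

/-- Compute `m` cells independently of each other. -/
def cellTask (cell : ℕ → RT Key (ℕ × MExpr Key)) (m B : ℕ) : RT Key (ℕ → ℕ × MExpr Key) :=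
  blockTask (fun _ => ((.tok, 0, 0), 0)) 0 (fun _ j => cell (B * m + j)) m

theorem cellTask_out (F : Key → ℕ × Mat K) (cell : ℕ → RT Key (ℕ × MExpr Key)) {m B j : ℕ}
    (hj : j < m) : (cellTask cell m B).out F j = (cell (B * m + j)).val F :=
  blockTask_out F _ _ _ hj

theorem cellTask_cost (F : Key → ℕ) (cell : ℕ → RT Key (ℕ × MExpr Key)) (m B c : ℕ)
    (h : ∑ j ∈ range m, ((cell (B * m + j)).cost F +
      9 * ((cell (B * m + j)).run F).2.vars.card) ≤ c) :
    (cellTask cell m B).cost F + 9 * (blockVars m ((cellTask cell m B).run F)).card ≤ c := by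
  have h1 : (cellTask cell m B).cost F = ∑ j ∈ range m, (cell (B * m + j)).cost F := by
    rw [cellTask, blockTask_cost, zero_add]
  have h2 : (blockVars m ((cellTask cell m B).run F)).card ≤
      ∑ j ∈ range m, ((cell (B * m + j)).run F).2.vars.card := blockTask_vars F _ _ _ _
  rw [sum_add_distrib, ← mul_sum] at h
  omega

theorem cellTask_cost_const (F : Key → ℕ) (cell : ℕ → RT Key (ℕ × MExpr Key)) (m B c : ℕ)
    (h : ∀ i, (cell i).cost F + 9 * ((cell i).run F).2.vars.card ≤ c) :
    (cellTask cell m B).cost F + 9 * (blockVars m ((cellTask cell m B).run F)).card ≤ m * c :=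
  cellTask_cost F cell m B _ ((sum_le_card_nsmul _ _ c fun j _ => h _).trans (by simp))

theorem vars_card_one : (MExpr.one : MExpr Key).vars.card = 0 := rfl

theorem vars_card_var (k : Key) : (MExpr.var k).vars.card = 1 := rfl

theorem vars_card_mul {κ : Type} (a b : MExpr κ) : (a.mul b).vars.card ≤ a.vars.card + b.vars.card := by
  classical exact card_union_le _ _

theorem vars_card_mulT {κ : Type} (a b : MExpr κ) : (a.mulT b).vars.card ≤ a.vars.card + b.vars.card := by
  classical exact card_union_le _ _

theorem vars_card_lam {κ : Type} (o : Op) (a b : MExpr κ) :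
    (MExpr.lam o a b).vars.card ≤ a.vars.card + b.vars.card := by
  classical exact card_union_le _ _

theorem vars_card_psi {κ : Type} (o : Op) (a : MExpr κ) : (MExpr.psi o a).vars.card = a.vars.card := rfl

abbrev tokA : Name := (.tok, 0, 0)
abbrev sizeA : Name := (.size, 0, 0)
abbrev nextA : Name := (.next, 0, 0)

/-! #### Tokens -/

/-- Read the code of symbol number `i` of the bracketed string. -/
def codeCell (n i : ℕ) : RT Key ℕ :=
  if i = 0 then pure 15 else if i ≤ n then RT.get (tokA, i - 1)
  else if i = n + 1 then pure 16 else pure 11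

def tokExpr (p c e : ℕ) (k : Key) : MExpr Key :=
  if e = 0 ∧ c = 10 then .lit (opOf (prevOp p)) (.var k) else if e = 1 ∧ c < 10 then .dig c else .one

def tokCell (n i : ℕ) : RT Key (ℕ × MExpr Key) :=
  codeCell n (i / 3 - 1) >>= fun p => codeCell n (i / 3) >>= fun c =>
    codeCell n (i / 3 + 1) >>= fun q =>
      pure (tokTag p c q (i % 3), tokExpr p c (i % 3) (tokA, i / 3 - 1))

/-- In round 0 every array name reads as the raw input, so `tokA` stands for the string here and for
the tokens in later rounds. -/
theorem codeCell_run {w : List (Sym K)} {F : Key → ℕ × Mat K}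
    (hF : ∀ i, F (tokA, i) = (w[i]?).elim (0, 1) fun c => (c.cell.1, Matrix.of fun _ _ => c.cell.2))
    (i : ℕ) : (codeCell w.length i).run (fun k => (F k).1) = symCode w i := by
  unfold codeCell symCode
  split_ifs
  · rfl
  · rw [RT.run_get, hF]
    cases w[i - 1]? <;> rfl
  · rfl
  · rfl

theorem codeCell_cost (F : Key → ℕ) (n i : ℕ) : (codeCell n i).cost F ≤ 1 := by
  unfold codeCell
  split_ifs <;> simp

theorem tokCell_val {w : List (Sym K)} {F : Key → ℕ × Mat K}
    (hF : ∀ i, F (tokA, i) = (w[i]?).elim (0, 1) fun c => (c.cell.1, Matrix.of fun _ _ => c.cell.2))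
    (i : ℕ) : (tokCell w.length i).val F = wordTok w i := by
  simp only [tokCell, RT.val, RT.run_bind, codeCell_run hF, RT.run_pure, wordTok, tokOf]
  refine Prod.ext rfl ?_
  dsimp only
  unfold tokExpr tokMat
  split_ifs with h1 h2
  · have hi : i / 3 ≠ 0 ∧ i / 3 ≤ w.length := by
      have := h1.2
      unfold symCode at this
      split_ifs at this <;> omega
    rw [MExpr.eval, MExpr.eval, hF, symMat, if_neg (by omega),
      List.getElem?_eq_getElem (by omega)]
    rfl
  · rfl
  · rfl

theorem tokCell_cost (F : Key → ℕ) (n i : ℕ) :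
    (tokCell n i).cost F + 9 * ((tokCell n i).run F).2.vars.card ≤ 12 := by
  simp only [tokCell, RT.cost_bind, RT.run_bind, RT.run_pure, RT.cost_pure]
  have h1 := codeCell_cost F n (i / 3 - 1)
  have h2 := codeCell_cost F n (i / 3)
  have h3 := codeCell_cost F n (i / 3 + 1)
  unfold tokExpr
  split_ifs
  · have : (MExpr.lit (opOf (prevOp ((codeCell n (i / 3 - 1)).run F)))
      (.var ((tokA, i / 3 - 1) : Key))).vars.card = 1 := rfl
    omega
  · have : (MExpr.dig ((codeCell n (i / 3)).run F) : MExpr Key).vars.card = 0 := rfl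
    omega
  · rw [vars_card_one]
    omega

/-! #### Heights and sizes -/

def htCell (i : ℕ) : RT Key (ℕ × MExpr Key) :=
  RT.get (tokA, i) >>= fun t => pure (heightTag t, .one)

def levelCell (N D i : ℕ) : RT Key (ℕ × MExpr Key) :=
  RT.get ((.scan .height, 0, D), if i < N then i else 2 * N - 1 - i) >>= fun t =>
    pure (4 * N - (t + if i < N then i else 2 * N - 1 - i), .one)

def sizeCell (N j : ℕ) : RT Key (ℕ × MExpr Key) :=
  RT.get (nextA, j) >>= fun t => RT.get (nextA, 2 * N - 1 - j) >>= fun t' =>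
    pure (if t = 0 ∨ t' = 0 then 0 else t + t' - (2 * N + 1), .one)

theorem sizeCell_val {F : Key → ℕ × Mat K} {H : ℕ → ℕ} {N : ℕ}
    (hF : ∀ i, (F (nextA, i)).1 = ns (mirror H N) (2 * N) i) (j : ℕ) :
    (sizeCell N j).val F = (sz H N j, 1) := by
  simp only [sizeCell, RT.val, RT.run_bind, RT.run_get, RT.run_pure, hF]
  rfl

theorem levelCell_val {F : Key → ℕ × Mat K} {T : ℕ → ℕ} {N D : ℕ}
    (hF : ∀ i, (F ((.scan .height, 0, D), i)).1 = T i) (i : ℕ) :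
    (levelCell N D i).val F = (4 * N - mirror (fun j => T j + j) N i, 1) := by
  simp only [levelCell, RT.val, RT.run_bind, RT.run_get, RT.run_pure, hF, mirror]
  refine Prod.ext ?_ rfl
  dsimp only
  split_ifs <;> rfl

/-! #### Scans -/

def combX (f : ℕ → ℕ → ℕ) (t t' : ℕ) (k k' : Key) : ℕ × MExpr Key :=
  (f t t', if t = 0 then .mul (.var k) (.var k') else .var k)

theorem combX_eval (f : ℕ → ℕ → ℕ) (t t' : ℕ) (k k' : Key) (env : Key → Mat K) :
    ((combX f t t' k k').1, (combX f t t' k k').2.eval env) = comb f (t, env k) (t', env k') := by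
  unfold combX comb
  dsimp only
  split_ifs <;> rfl

theorem combX_vars (f : ℕ → ℕ → ℕ) (t t' : ℕ) (k k' : Key) :
    (combX f t t' k k').2.vars.card ≤ 2 := by
  unfold combX
  dsimp only
  split_ifs
  · exact vars_card_mul _ _
  · rw [vars_card_var]
    omega

def scanCell (f : ℕ → ℕ → ℕ) (c : Scan) (l m : ℕ) : ℕ → ℕ → RT Key (ℕ × MExpr Key)
  | 0, j => RT.get ((.pre c, l, 0), j) >>= fun t => pure (t, .var ((.pre c, l, 0), j))
  | r + 1, j => RT.get ((.scan c, l, r), j) >>= fun t =>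
      RT.get ((.pre c, l, r + 1), j / m ^ (r + 1) + 1) >>= fun t' =>
        pure (if j / m ^ (r + 1) % m = m - 1 then (t, .var ((.scan c, l, r), j))
          else combX f t t' ((.scan c, l, r), j) ((.pre c, l, r + 1), j / m ^ (r + 1) + 1))

theorem scanCell_val_zero {f : ℕ → ℕ → ℕ} {F : Key → ℕ × Mat K} {x : ℕ → ℕ × Mat K} {m l : ℕ}
    {c : Scan} {j : ℕ} (hF : F ((.pre c, l, 0), j) = preScan f x m 0 j) :
    (scanCell f c l m 0 j).val F = blockScan f x m 0 j := by
  rw [blockScan_zero, ← hF]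
  rfl

theorem scanCell_val_succ {f : ℕ → ℕ → ℕ} (hf : TagOp f) {F : Key → ℕ × Mat K}
    {x : ℕ → ℕ × Mat K} {m l r : ℕ} (hm : 0 < m) {c : Scan} {j : ℕ}
    (hF : F ((.scan c, l, r), j) = blockScan f x m r j)
    (hF' : ∀ i, F ((.pre c, l, r + 1), i) = preScan f x m (r + 1) i) :
    (scanCell f c l m (r + 1) j).val F = blockScan f x m (r + 1) j := by
  rw [blockScan_succ hf hm, ← hF, ← hF']
  simp only [scanCell, RT.val, RT.run_bind, RT.run_get, RT.run_pure]
  split_ifs with h1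
  · rfl
  · exact combX_eval _ _ _ _ _ _

theorem scanCell_cost (f : ℕ → ℕ → ℕ) (F : Key → ℕ) (c : Scan) (l m r j : ℕ) :
    (scanCell f c l m r j).cost F + 9 * ((scanCell f c l m r j).run F).2.vars.card ≤ 20 := by
  cases r with
  | zero =>
    simp [scanCell, RT.cost_bind, RT.run_bind, vars_card_var]
  | succ r =>
    simp only [scanCell, RT.cost_bind, RT.run_bind, RT.run_pure, RT.cost_pure, RT.cost_get]
    split_ifs
    · rw [vars_card_var]
      omega
    · have := combX_vars f (F ((.scan c, l, r), j)) (F ((.pre c, l, r + 1), j / m ^ (r + 1) + 1))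
        ((.scan c, l, r), j) ((.pre c, l, r + 1), j / m ^ (r + 1) + 1)
      simp only [RT.run_get]
      omega

/-! #### Phases -/

variable {tok : ℕ → ℕ × Mat K} {H : ℕ → ℕ} {N D l s s' : ℕ} {F : Key → ℕ × Mat K}

def IsSmall (z s : ℕ) : Prop := 0 < z ∧ z < s

instance (z s : ℕ) : Decidable (IsSmall z s) := inferInstanceAs (Decidable (_ ∧ _))

def firstCell (j : ℕ) : RT Key (ℕ × MExpr Key) :=
  RT.get (tokA, j) >>= fun t => pure (if t = 0 then (0, .var (tokA, j)) else (j + 1, .one))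

theorem firstCell_val (hT : ∀ i, F (tokA, i) = tok i) (j : ℕ) :
    (firstCell j).val F = firstElt tok j := by
  simp only [firstCell, RT.val, RT.run_bind, RT.run_get, RT.run_pure, hT, firstElt]
  split_ifs
  · exact Prod.ext rfl (by change (F (tokA, j)).2 = _; rw [hT])
  · rfl

theorem firstCell_cost (F : Key → ℕ) (j : ℕ) :
    (firstCell j).cost F + 9 * ((firstCell j).run F).2.vars.card ≤ 10 := by
  simp only [firstCell, RT.cost_bind, RT.run_bind, RT.run_pure, RT.cost_pure, RT.cost_get]
  split_ifs <;> simp [vars_card_var, vars_card_one]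

/-- The elements after phase `l`. -/
def eltCell (l s s' j : ℕ) : RT Key (ℕ × MExpr Key) :=
  RT.get (tokA, j) >>= fun t => RT.get (sizeA, j) >>= fun z => RT.get (sizeA, j + 1) >>= fun z' =>
    RT.get ((.elt, l, 0), j) >>= fun x =>
      pure (if IsSmall z s' then (0, .one)
        else if 2 ≤ t ∧ IsSmall z' s' then
          if IsSmall z' s then (x, .var ((.elt, l, 0), j)) else (0, .var ((.out, l, 0), j / s))
        else if t = 0 then (0, .var (tokA, j)) else (j + 1, .one))

theorem eltCell_val {x : ℕ → ℕ × Mat K} {o : ℕ → Mat K} {j : ℕ} (hT : ∀ i, F (tokA, i) = tok i)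
    (hZ : ∀ i, (F (sizeA, i)).1 = sz H N i) (hX : F ((.elt, l, 0), j) = x j)
    (hO : (F ((.out, l, 0), j / s)).2 = o (j / s)) :
    (eltCell l s s' j).val F = nextElt tok H N s s' x o j := by
  simp only [eltCell, RT.val, RT.run_bind, RT.run_get, RT.run_pure, hT, hZ, hX, nextElt]
  change _ = if IsSmall (sz H N j) s' then _ else if 2 ≤ (tok j).1 ∧ IsSmall (sz H N (j + 1)) s' then
    if IsSmall (sz H N (j + 1)) s then _ else _ else _
  split_ifs
  · rfl
  · exact Prod.ext rfl (by change (F ((.elt, l, 0), j)).2 = _; rw [hX])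
  · exact Prod.ext rfl hO
  · exact Prod.ext rfl (by change (F (tokA, j)).2 = _; rw [hT])
  · rfl

theorem eltCell_cost (F : Key → ℕ) (l s s' j : ℕ) :
    (eltCell l s s' j).cost F + 9 * ((eltCell l s s' j).run F).2.vars.card ≤ 13 := by
  simp only [eltCell, RT.cost_bind, RT.run_bind, RT.run_pure, RT.cost_pure, RT.cost_get]
  split_ifs <;> simp [vars_card_var, vars_card_one]

def rootCell (s s' j : ℕ) : RT Key (ℕ × MExpr Key) :=
  RT.get (tokA, j) >>= fun t => RT.get (sizeA, j) >>= fun z => RT.get (sizeA, j + 1) >>= fun z' =>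
    pure (if 2 ≤ t ∧ ¬ IsSmall z' s ∧ IsSmall z' s' ∧ ¬ IsSmall z s' then (j + 1, .one)
      else (0, .one))

theorem rootCell_val (hT : ∀ i, F (tokA, i) = tok i) (hZ : ∀ i, (F (sizeA, i)).1 = sz H N i)
    (j : ℕ) : (rootCell s s' j).val F = rootElt tok H N s s' j := by
  simp only [rootCell, RT.val, RT.run_bind, RT.run_get, RT.run_pure, hT, hZ, rootElt]
  change _ = if 2 ≤ (tok j).1 ∧ ¬ IsSmall (sz H N (j + 1)) s ∧ IsSmall (sz H N (j + 1)) s' ∧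
    ¬ IsSmall (sz H N j) s' then _ else _
  split_ifs <;> rfl

theorem rootCell_cost (F : Key → ℕ) (s s' j : ℕ) :
    (rootCell s s' j).cost F + 9 * ((rootCell s s' j).run F).2.vars.card ≤ 3 := by
  simp only [rootCell, RT.cost_bind, RT.run_bind, RT.run_pure, RT.cost_pure, RT.cost_get]
  split_ifs <;> simp [vars_card_one]

def layCell (l D j : ℕ) : RT Key (ℕ × MExpr Key) :=
  RT.get ((.elt, l, 0), j) >>= fun x => RT.get (tokA, j) >>= fun t =>
    RT.get ((.scan .value, l, D), j + 1) >>= fun p => RT.get (tokA, p - 1) >>= fun t' =>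
      RT.get (nextA, p) >>= fun k => RT.get ((.scan .value, l, D), k - 2 + 1) >>= fun p' =>
        RT.get (tokA, p' - 1) >>= fun t'' =>
          pure (if x = 0 then (0, .one) else if t < 2 then (j + 1, .one)
            else if p = 0 then (j + 1, .one) else if t' < 2 then (j + 1, .one)
            else if p' = 0 then (j + 1, .one) else if 2 ≤ t'' then (j + 1, .one)
            else (0, .lam (opOf t') (.var ((.scan .value, l, D), j + 1))
              (.var ((.scan .value, l, D), k - 2 + 1))))

theorem layCell_val {x S : ℕ → ℕ × Mat K} {j : ℕ} (hT : ∀ i, F (tokA, i) = tok i)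
    (hn : ∀ i, (F (nextA, i)).1 = ns (mirror H N) (2 * N) i) (hX : F ((.elt, l, 0), j) = x j)
    (hS : ∀ i, F ((.scan .value, l, D), i) = S i) :
    (layCell l D j).val F = layer tok (nx H N) x S j := by
  have hn' : ∀ i, (F (nextA, i)).1 - 2 = nx H N i := fun i => by rw [hn, nx]
  simp only [layCell, RT.val, RT.run_bind, RT.run_get, RT.run_pure, hT, hn', hX, hS, layer]
  split_ifs
  all_goals first | rfl | skip
  simp only [MExpr.eval, hS]

theorem layCell_cost (F : Key → ℕ) (l D j : ℕ) :
    (layCell l D j).cost F + 9 * ((layCell l D j).run F).2.vars.card ≤ 25 := by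
  simp only [layCell, RT.cost_bind, RT.run_bind, RT.run_pure, RT.cost_pure, RT.cost_get]
  split_ifs
  all_goals first | (rw [vars_card_one]; omega) | skip
  have : ∀ (o : Op) (k k' : Key), (MExpr.lam o (.var k) (.var k')).vars.card ≤ 2 :=
    fun _ _ _ => vars_card_lam _ _ _
  have := this (opOf (F (tokA, F ((.scan .value, l, D), j + 1) - 1)))
    ((.scan .value, l, D), j + 1)
    ((.scan .value, l, D), F (nextA, F ((.scan .value, l, D), j + 1)) - 2 + 1)
  simp only [RT.run_get]
  omega

/-- Evaluate the word from `j` on up to the end of the group around `j`. -/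
def contentRT (l D : ℕ) : ℕ → ℕ → RT Key (MExpr Key)
  | 0, _ => pure .one
  | n + 1, j => RT.get ((.scan .value, l, D), j) >>= fun p =>
      RT.get (tokA, p - 1) >>= fun t => RT.get ((.scan .chain, l, D), p - 1) >>= fun e =>
        RT.get (nextA, p) >>= fun k =>
          if p = 0 then pure .one else if t < 2 then pure (.var ((.scan .value, l, D), j))
          else contentRT l D n e >>= fun a => contentRT l D n (k - 2 + 1) >>= fun b =>
            pure (.mul (.mul (.var ((.scan .value, l, D), j))
              (.psi (opOf t) (.mulT a (.var ((.scan .chain, l, D), p - 1))))) b)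

variable {S S' : ℕ → ℕ × Mat K}

/-- Each call makes 4 queries and brings in at most 2 new matrices of 9 numbers, hence 22 = 4 + 2·9.
-/
theorem contentRT_run (hT : ∀ i, F (tokA, i) = tok i)
    (hn : ∀ i, (F (nextA, i)).1 = ns (mirror H N) (2 * N) i)
    (hS : ∀ i, F ((.scan .value, l, D), i) = S i)
    (hS' : ∀ i, F ((.scan .chain, l, D), i) = S' i) (n j : ℕ) :
    (((contentRT l D n j).run fun k => (F k).1).eval fun k => (F k).2) =
      content tok (nx H N) S S' n j ∧
    (contentRT l D n j).cost (fun k => (F k).1) +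
      9 * ((contentRT l D n j).run fun k => (F k).1).vars.card ≤
      22 * calls tok (nx H N) S S' n j := by
  have hn' : ∀ i, (F (nextA, i)).1 - 2 = nx H N i := fun i => by rw [hn, nx]
  induction n generalizing j with
  | zero => exact ⟨rfl, by simp [contentRT, calls, vars_card_one]⟩
  | succ n ih =>
    simp only [contentRT, RT.run_bind, RT.run_get, RT.cost_bind, RT.cost_get, hT, hn', hS, hS',
      content, calls]
    by_cases h0 : (S j).1 = 0
    · simp only [h0, if_true]
      exact ⟨rfl, by simp [vars_card_one]⟩
    · by_cases h1 : (tok ((S j).1 - 1)).1 < 2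
      · simp only [h0, h1, if_true, if_false]
        refine ⟨by rw [RT.run_pure, MExpr.eval, hS], by simp [vars_card_var]⟩
      · simp only [h0, h1, if_false, RT.run_bind, RT.run_pure, RT.cost_bind, RT.cost_pure]
        obtain ⟨a1, a2⟩ := ih (S' ((S j).1 - 1)).1
        obtain ⟨b1, b2⟩ := ih (nx H N (S j).1 + 1)
        refine ⟨?_, ?_⟩
        · simp only [MExpr.eval, a1, b1, hS, hS']
        · have hv : ∀ (o : Op) (k k' : Key) (a b : MExpr Key),
              (MExpr.mul (.mul (.var k) (.psi o (.mulT a (.var k')))) b).vars.card ≤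
                2 + a.vars.card + b.vars.card := by
            intro o k k' a b
            have h1 := vars_card_mul (.mul (.var k) (.psi o (.mulT a (.var k')))) b
            have h2 := vars_card_mul (.var k) (.psi o (.mulT a (.var k')))
            have h3 := vars_card_mulT a (.var k')
            rw [vars_card_psi, vars_card_var] at h2
            rw [vars_card_var] at h3
            omega
          refine (Nat.add_le_add_left (Nat.mul_le_mul_left 9 (hv _ _ _ _ _)) _).trans ?_
          omega

/-- The value of the group that starts in interval number `u` of length `s`. -/
def outCell (l D N s u : ℕ) : RT Key (ℕ × MExpr Key) :=
  RT.get ((.scan .root, l, D), u * s) >>= fun p =>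
    RT.get (tokA, p - 1) >>= fun t => RT.get ((.scan .chain, l, D), p - 1) >>= fun e =>
      if p ≠ 0 ∧ (p - 1) / s = u then contentRT l D (2 * N) e >>= fun a =>
        pure (0, .psi (opOf t) (.mulT a (.var ((.scan .chain, l, D), p - 1))))
      else pure (0, .one)

/-- The summand 12 pays for three queries and the nine entries of the chain matrix. -/
theorem outCell_val {R : ℕ → ℕ × Mat K} (hT : ∀ i, F (tokA, i) = tok i)
    (hn : ∀ i, (F (nextA, i)).1 = ns (mirror H N) (2 * N) i)
    (hS : ∀ i, F ((.scan .value, l, D), i) = S i)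
    (hS' : ∀ i, F ((.scan .chain, l, D), i) = S' i)
    (hR : ∀ i, F ((.scan .root, l, D), i) = R i) (u : ℕ) :
    (outCell l D N s u).val F =
      (0, slotVal tok (nx H N) S S' (2 * N) s (R (u * s)).1 u) ∧
    (outCell l D N s u).cost (fun k => (F k).1) +
      9 * ((outCell l D N s u).run fun k => (F k).1).2.vars.card ≤
      12 + 22 * slotCalls tok (nx H N) S S' (2 * N) s (R (u * s)).1 u := by
  simp only [outCell, RT.val, RT.run_bind, RT.run_get, RT.cost_bind, RT.cost_get, hT, hS', hR,
    slotVal, slotCalls]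
  split_ifs with h
  · obtain ⟨a1, a2⟩ := contentRT_run hT hn hS hS' (2 * N) (S' ((R (u * s)).1 - 1)).1
    simp only [RT.run_bind, RT.run_pure, RT.cost_bind, RT.cost_pure]
    refine ⟨?_, ?_⟩
    · simp only [MExpr.eval, a1, hS']
    · have hv : ∀ (o : Op) (k' : Key) (a : MExpr Key),
          (MExpr.psi o (.mulT a (.var k'))).vars.card ≤ a.vars.card + 1 := by
        intro o k' a
        rw [vars_card_psi]
        exact vars_card_mulT a (.var k')
      refine (Nat.add_le_add_left (Nat.mul_le_mul_left 9 (hv _ _ _)) _).trans ?_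
      omega
  · exact ⟨rfl, by simp [vars_card_one]⟩

end Cells

end AMPC

namespace AMPC

open Finset

set_option linter.unusedSectionVars false

/-! ### The algorithm -/

/-- The parameters of the algorithm for inputs of length `n`. -/
structure Params (n : ℕ) where
  m : ℕ
  a : ℕ
  N : ℕ
  NB : ℕ
  D : ℕ
  m_eq : m = 2 ^ a
  le_N : 3 * n + 7 ≤ N
  NB_mul : NB * m = 2 * N
  le_pow : 2 * N ≤ m ^ D

def Scan.op : Scan → ℕ → ℕ → ℕ
  | .height => (· + ·)
  | _ => firstTag

theorem Scan.tagOp (c : Scan) : TagOp c.op := by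
  cases c
  · exact tagOp_add
  all_goals exact tagOp_first

/-- The array that is scanned. -/
def Scan.src : Scan → ℕ → Name
  | .height, _ => (.ht, 0, 0)
  | .value, l => (.elt, l, 0)
  | .chain, l => (.lay, l, 0)
  | .root, l => (.root, l, 0)

namespace Params

variable {n : ℕ} (p : Params n)

theorem m_pos : 0 < p.m := by
  rw [p.m_eq]
  positivity

/-- The round in which phase `l` begins. -/
def phase (l : ℕ) : ℕ := 3 * p.D + 8 + l * (2 * p.D + 7)

def base : Scan → ℕ → ℕ
  | .height, _ => 2
  | .chain, l => p.phase l + p.D + 4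
  | _, l => p.phase l + 1

/-- A scan with base β has level r of `pre` in round β + r and of `scan` in round β + r + 1, so it
ends in round β + D + 1. A phase has two dependent scans, `value` and `chain`, plus the rounds for
`elt`, `lay` and `out`: 2D + 7 rounds. The levels of `next` are computed downwards, from r = D to r
= 0. -/
def stage : Name → ℕ
  | (.tok, _, _) => 0
  | (.ht, _, _) => 1
  | (.level, _, _) => p.D + 4
  | (.pmax, _, r) => p.D + 5 + r
  | (.next, _, r) => 2 * p.D + 6 + (p.D - r)
  | (.size, _, _) => 3 * p.D + 7
  | (.elt, l, _) => p.phase l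
  | (.lay, l, _) => p.phase l + p.D + 3
  | (.root, l, _) => p.phase l
  | (.out, l, _) => p.phase l + 2 * p.D + 6
  | (.pre c, l, r) => p.base c l + r
  | (.scan c, l, r) => p.base c l + r + 1

/-- Where the maximum of an interval of length `m ^ r` stands. -/
def unitKey : ℕ → ℕ → Key
  | 0, i => ((.level, 0, 0), i)
  | r + 1, i => ((.pmax, 0, r), p.m * i + (p.m - 1))

def preKey (c : Scan) (l : ℕ) : ℕ → ℕ → Key
  | 0, i => (c.src l, i)
  | r + 1, i => ((.pre c, l, r), p.m * i)

noncomputable def body : Name → ℕ → RT Key (ℕ → ℕ × MExpr Key)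
  | (.tok, _, _), B => cellTask (tokCell n) p.m B
  | (.ht, _, _), B => cellTask htCell p.m B
  | (.level, _, _), B => cellTask (levelCell p.N p.D) p.m B
  | (.pmax, _, r), B => maxTask (fun c => p.unitKey r (B * p.m + c)) p.m
  -- All positions of block B lie in the interval number B / m^r of length m^(r+1), so one list of m
  -- siblings serves the whole block.
  | (.next, _, r), B => nextTask (fun j => ((.level, 0, 0), j)) (fun j => ((.next, 0, r + 1), j))
      (fun i => ((.pmax, 0, r), i)) (fun c => p.unitKey r (B / p.m ^ r * p.m + c)) p.m p.a
      (p.m ^ r) (B * p.m) (B / p.m ^ r)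
  | (.size, _, _), B => cellTask (sizeCell p.N) p.m B
  | (.elt, 0, _), B => cellTask firstCell p.m B
  | (.elt, l + 1, _), B => cellTask (eltCell l (p.m ^ l) (p.m ^ (l + 1))) p.m B
  | (.lay, l, _), B => cellTask (layCell l p.D) p.m B
  | (.root, l, _), B => cellTask (rootCell (p.m ^ l) (p.m ^ (l + 1))) p.m B
  | (.out, l, _), B => cellTask (outCell l p.D p.N (p.m ^ l)) p.m B
  | (.pre c, l, r), B => preTask c.op (fun i => p.preKey c l r (B * p.m + i)) p.m
  | (.scan c, l, r), B => cellTask (scanCell c.op c l p.m r) p.m B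

open Classical in
-- All pairs (phase, level) are allowed for every kind, although many of these arrays coincide. The
-- waste is a factor of order (D + 1)², which is polylogarithmic.
noncomputable def layout (b : ℕ) : Layout Name where
  names := Kind.all.toFinset ×ˢ range (p.D + 1) ×ˢ range (p.D + 1)
  m := p.m
  NB := p.NB
  S := 300 * p.m * (p.a + 1)
  b := b
  T := p.phase p.D + 1
  n := n
  root := (.elt, p.D, 0)
  stage := p.stage
  body := p.body

theorem mem_names {b : ℕ} {k : Kind} {l r : ℕ} :
    (k, l, r) ∈ (p.layout b).names ↔ l ≤ p.D ∧ r ≤ p.D := by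
  classical
  simp [layout, Kind.mem_all]

theorem card_names (b : ℕ) : (p.layout b).names.card ≤ 18 * (p.D + 1) ^ 2 := by
  classical
  have h : Kind.all.toFinset.card ≤ 18 := Kind.all.toFinset_card_le
  simp only [layout, card_product, card_range]
  rw [sq]
  exact Nat.mul_le_mul_right _ h

/-! ### Intended contents of the arrays, and their verification. -/

section Values

variable {K : Type*} [Field K] (w : List (Sym K))

def htV (i : ℕ) : ℕ × Mat K := (heightTag (wordTok w i).1, 1)

/-- The number of open brackets, up to a constant. -/
def height (j : ℕ) : ℕ := (suf (· + ·) (htV w) (2 * p.N) j).1 + j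

noncomputable def valS (x : ℕ → ℕ × Mat K) : ℕ → ℕ × Mat K := suf firstTag x (2 * p.N)

noncomputable def layV (x : ℕ → ℕ × Mat K) : ℕ → ℕ × Mat K :=
  layer (wordTok w) (nx (p.height w) p.N) x (p.valS x)

noncomputable def rootV (l : ℕ) : ℕ → ℕ × Mat K :=
  rootElt (wordTok w) (p.height w) p.N (p.m ^ l) (p.m ^ (l + 1))

noncomputable def outV (l : ℕ) (x : ℕ → ℕ × Mat K) (u : ℕ) : Mat K :=
  slotVal (wordTok w) (nx (p.height w) p.N) (p.valS x) (p.valS (p.layV w x)) (2 * p.N) (p.m ^ l)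
    (p.valS (p.rootV w l) (u * p.m ^ l)).1 u

/-- The elements of phase `l`. -/
noncomputable def eltV : ℕ → ℕ → ℕ × Mat K
  | 0 => firstElt (wordTok w)
  | l + 1 => nextElt (wordTok w) (p.height w) p.N (p.m ^ l) (p.m ^ (l + 1)) (eltV l)
      (p.outV w l (eltV l))

noncomputable def scanV : Scan → ℕ → ℕ → ℕ × Mat K
  | .height, _ => htV w
  | .value, l => p.eltV w l
  | .chain, l => p.layV w (p.eltV w l)
  | .root, l => p.rootV w l

noncomputable def levelV (i : ℕ) : ℕ := if i < 2 * p.N then 4 * p.N - mirror (p.height w) p.N i else 0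

/-- The contents of the arrays. -/
noncomputable def arr : Name → ℕ → ℕ × Mat K
  | (.tok, _, _) => wordTok w
  | (.ht, _, _) => htV w
  | (.level, _, _) => fun i => (p.levelV w i, 1)
  | (.pmax, _, r) => fun i => (preMax (p.levelV w) p.m (p.m ^ r) i, 1)
  | (.next, _, r) => fun i => (nextLarger (p.levelV w) (p.m ^ r) i, 1)
  | (.size, _, _) => fun i => (sz (p.height w) p.N i, 1)
  | (.elt, l, _) => p.eltV w l
  | (.lay, l, _) => p.layV w (p.eltV w l)
  | (.root, l, _) => p.rootV w l
  | (.out, l, _) => fun u => (0, p.outV w l (p.eltV w l) u)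
  | (.pre c, l, r) => preScan c.op (cut (2 * p.N) (p.scanV w c l)) p.m r
  | (.scan c, l, r) => blockScan c.op (cut (2 * p.N) (p.scanV w c l)) p.m r

theorem arr_src (c : Scan) (l : ℕ) : p.arr w (c.src l) = p.scanV w c l := by
  cases c <;> rfl

variable {w}

theorem suf_cut {f : ℕ → ℕ → ℕ} (x : ℕ → ℕ × Mat K) (M j : ℕ) : suf f (cut M x) M j = suf f x M j :=
  scanN_congr fun i h1 h2 => by rw [cut, if_pos (by omega)]

theorem heightTag_le (t : ℕ) : heightTag t ≤ 2 := by
  unfold heightTag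
  split_ifs <;> omega

theorem height_le {j : ℕ} (hj : j ≤ 2 * p.N) : p.height w j ≤ 4 * p.N := by
  have h := scanN_tag_le_add (M := 2 * p.N) (x := htV w) (fun i => heightTag_le _) j (2 * p.N - j)
  change (suf (· + ·) (cut (2 * p.N) (htV w)) (2 * p.N) j).1 ≤ _ at h
  rw [suf_cut] at h
  unfold height
  omega

theorem mirror_le (i : ℕ) : mirror (p.height w) p.N i ≤ 4 * p.N := by
  unfold mirror
  split_ifs
  · exact p.height_le (by omega)
  · exact p.height_le (by omega)

theorem isHeight : IsHeight (wordTok w) (p.height w) p.N := by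
  intro i hi
  have := suf_step (f := (· + ·)) (htV w) (M := 2 * p.N) (j := i) (by omega)
  have h1 : (suf (· + ·) (htV w) (2 * p.N) i).1 =
      heightTag (wordTok w i).1 + (suf (· + ·) (htV w) (2 * p.N) (i + 1)).1 := by
    rw [this]
    rfl
  unfold height
  omega

theorem levelV_of_le {i : ℕ} (hi : 2 * p.N ≤ i) : p.levelV w i = 0 := by
  rw [levelV, if_neg (by omega)]

theorem sz_of_le (H : ℕ → ℕ) {N j : ℕ} (hj : 2 * N ≤ j) : sz H N j = 0 := by
  rw [sz, if_pos]
  left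
  apply ns_eq_zero
  intros
  omega

theorem eltV_tag (l j : ℕ) : (p.eltV w l j).1 = 0 ∨ (p.eltV w l j).1 = j + 1 := by
  induction l with
  | zero =>
    simp only [eltV, firstElt]
    split_ifs <;> simp
  | succ l ih =>
    simp only [eltV, nextElt]
    split_ifs <;> simp [ih]

theorem scanV_tag_le (c : Scan) (hc : c ≠ .height) (l i : ℕ) :
    (cut (2 * p.N) (p.scanV w c l) i).1 ≤ 2 * p.N := by
  unfold cut
  split_ifs with hi
  · have : (p.scanV w c l i).1 = 0 ∨ (p.scanV w c l i).1 = i + 1 := by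
      cases c
      · exact (hc rfl).elim
      · exact p.eltV_tag l i
      · exact layer_tag _ _ i
      · exact rootElt_tag i
    omega
  · exact Nat.zero_le _

theorem scan_tag_le (c : Scan) (l j k : ℕ) :
    (scanN c.op (cut (2 * p.N) (p.scanV w c l)) j k).1 ≤ 4 * p.N := by
  by_cases hc : c = .height
  · subst hc
    have := scanN_tag_le_add (M := 2 * p.N) (x := htV w) (fun i => heightTag_le _) j k
    refine this.trans ?_
    omega
  · have hop : c.op = firstTag := by cases c <;> first | rfl | exact (hc rfl).elim
    rw [hop]
    exact (scanN_tag_le (p.scanV_tag_le c hc l) j k).trans (by omega)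

theorem tokTag_le (a b c e : ℕ) : tokTag a b c e ≤ 14 := by
  unfold tokTag prevOp
  split_ifs <;> omega

theorem arr_tag_le (ν : Name) {i : ℕ} (hi : i < 2 * p.N) : (p.arr w ν i).1 ≤ 4 * p.N + 14 := by
  have hlev : ∀ i, p.levelV w i ≤ 4 * p.N := fun i => by
    unfold levelV
    split_ifs <;> omega
  obtain ⟨k, l, r⟩ := ν
  cases k with
  | tok => exact (tokTag_le _ _ _ _).trans (by omega)
  | ht => exact (heightTag_le _).trans (by omega)
  | level => exact (hlev i).trans (by omega)
  | pmax =>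
    have : preMax (p.levelV w) p.m (p.m ^ r) i ≤ 4 * p.N := Finset.sup_le fun i _ => hlev i
    exact this.trans (by omega)
  | next =>
    change nextLarger (p.levelV w) (p.m ^ r) i ≤ _
    have hL : 0 < p.m ^ r := Nat.pow_pos p.m_pos
    rcases first_cases (fun i' => i / p.m ^ r < i' ∧ p.levelV w i <
      unitMax (p.levelV w) (p.m ^ r) i') with ⟨h, -⟩ | ⟨i', h, ⟨-, h1⟩, -⟩
    · rw [nextLarger, h]
      omega
    · rw [nextLarger, h]
      obtain ⟨k, rfl, h2⟩ := (lt_unitMax hL).1 h1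
      have h3 : k / p.m ^ r ≤ k := Nat.div_le_self _ _
      have h4 : k < 2 * p.N := by
        by_contra hcon
        rw [p.levelV_of_le (i := k) (by omega)] at h2
        exact absurd h2 (Nat.not_lt_zero _)
      omega
  | size => exact (sz_le _ _ _).trans (by omega)
  | elt =>
    have : (p.eltV w l i).1 = 0 ∨ (p.eltV w l i).1 = i + 1 := p.eltV_tag l i
    change (p.eltV w l i).1 ≤ _
    omega
  | lay =>
    have : (p.layV w (p.eltV w l) i).1 = 0 ∨ (p.layV w (p.eltV w l) i).1 = i + 1 := layer_tag _ _ i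
    change (p.layV w (p.eltV w l) i).1 ≤ _
    omega
  | root =>
    have : (p.rootV w l i).1 = 0 ∨ (p.rootV w l i).1 = i + 1 := rootElt_tag i
    change (p.rootV w l i).1 ≤ _
    omega
  | out => exact Nat.zero_le _
  | pre c => exact (p.scan_tag_le c l _ _).trans (by omega)
  | scan c => exact (p.scan_tag_le c l _ _).trans (by omega)

/-! #### Reading the arrays -/

variable {b t : ℕ}

/-- Cells beyond 2N are absent and read as neutral, which is how `cut` continues the array. -/
theorem read {ν : Name} (hν : ν ∈ (p.layout b).names) (ht : p.stage ν < t) (i : ℕ) :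
    (p.layout b).store w (p.arr w) t (ν, i) = cut (2 * p.N) (p.arr w ν) i := by
  rw [Layout.store_of_stage_lt hν ht]
  change (if i < p.NB * p.m then _ else _) = _
  rw [p.NB_mul, cut]

theorem read_pre (c : Scan) {l r : ℕ} (hl : l ≤ p.D) (hr : r ≤ p.D) (ht : p.base c l + r < t)
    (i : ℕ) : (p.layout b).store w (p.arr w) t ((.pre c, l, r), i) =
      preScan c.op (cut (2 * p.N) (p.scanV w c l)) p.m r i := by
  rw [p.read (p.mem_names.2 ⟨hl, hr⟩) ht, cut]
  split_ifs with hi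
  · rfl
  · rw [preScan_cut_of_le c.tagOp p.m_pos (by omega)]

theorem read_scan (c : Scan) {l r : ℕ} (hl : l ≤ p.D) (hr : r ≤ p.D) (ht : p.base c l + r + 1 < t)
    (i : ℕ) : (p.layout b).store w (p.arr w) t ((.scan c, l, r), i) =
      blockScan c.op (cut (2 * p.N) (p.scanV w c l)) p.m r i := by
  rw [p.read (p.mem_names.2 ⟨hl, hr⟩) ht, cut]
  split_ifs with hi
  · rfl
  · rw [blockScan_cut_of_le c.tagOp (by omega)]

theorem read_suf (c : Scan) {l : ℕ} (hl : l ≤ p.D) (ht : p.base c l + p.D + 1 < t) (i : ℕ) :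
    (p.layout b).store w (p.arr w) t ((.scan c, l, p.D), i) =
      suf c.op (p.scanV w c l) (2 * p.N) i := by
  rw [p.read_scan c hl le_rfl ht, blockScan_eq_suf c.tagOp]
  exact p.le_pow.trans (Nat.pow_le_pow_right p.m_pos (by omega))

theorem read_level (ht : p.D + 4 < t) (i : ℕ) :
    ((p.layout b).store w (p.arr w) t ((.level, 0, 0), i)).1 = p.levelV w i := by
  rw [p.read (p.mem_names.2 ⟨by omega, by omega⟩) ht, cut]
  split_ifs with hi
  · rfl
  · rw [p.levelV_of_le (by omega)]

theorem read_pmax {r : ℕ} (hr : r ≤ p.D) (ht : p.D + 5 + r < t) (i : ℕ) :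
    ((p.layout b).store w (p.arr w) t ((.pmax, 0, r), i)).1 =
      preMax (p.levelV w) p.m (p.m ^ r) i := by
  rw [p.read (p.mem_names.2 ⟨by omega, hr⟩) ht, cut]
  split_ifs with hi
  · rfl
  · refine (Nat.le_zero.1 (Finset.sup_le fun i' hi' => ?_)).symm
    rw [mem_Ico] at hi'
    rw [p.levelV_of_le]
    refine le_trans ?_ hi'.1
    have h1 : 2 * p.N ≤ i - i % p.m := by
      have h2 : p.NB ≤ i / p.m := by
        rw [Nat.le_div_iff_mul_le p.m_pos, p.NB_mul]
        omega
      have h3 := Nat.mul_le_mul_right p.m h2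
      have h4 := Nat.div_add_mod i p.m
      rw [mul_comm] at h4
      rw [p.NB_mul] at h3
      omega
    exact h1.trans (Nat.le_mul_of_pos_right _ (Nat.pow_pos p.m_pos))

theorem read_unit {r : ℕ} (hr : r ≤ p.D + 1) (ht : p.D + 4 + r < t) (i : ℕ) :
    ((p.layout b).store w (p.arr w) t (p.unitKey r i)).1 = unitMax (p.levelV w) (p.m ^ r) i := by
  cases r with
  | zero => rw [unitKey, p.read_level (by omega), pow_zero, unitMax_one]
  | succ r => rw [unitKey, p.read_pmax (by omega) (by omega), preMax_last p.m_pos, pow_succ]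

theorem read_nextLarger {r : ℕ} (hr : r ≤ p.D) (ht : 2 * p.D + 6 + (p.D - r) < t) {i : ℕ}
    (hi : i < 2 * p.N) : ((p.layout b).store w (p.arr w) t ((.next, 0, r), i)).1 =
      nextLarger (p.levelV w) (p.m ^ r) i := by
  rw [p.read (p.mem_names.2 ⟨by omega, hr⟩) ht, cut, if_pos hi]
  rfl

theorem read_next (ht : 3 * p.D + 6 < t) (i : ℕ) :
    ((p.layout b).store w (p.arr w) t (nextA, i)).1 = ns (mirror (p.height w) p.N) (2 * p.N) i := by
  rcases Nat.lt_or_ge i (2 * p.N) with hi | hi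
  · rw [p.read_nextLarger (by omega) (by omega) hi, pow_zero, ← nextLarger_eq_ns p.mirror_le hi]
    rfl
  · rw [p.read (p.mem_names.2 ⟨by omega, by omega⟩) (by simp only [stage]; omega), cut,
      if_neg (by omega), ns_eq_zero]
    intros
    omega

theorem read_size (ht : 3 * p.D + 7 < t) (i : ℕ) :
    ((p.layout b).store w (p.arr w) t (sizeA, i)).1 = sz (p.height w) p.N i := by
  rw [p.read (p.mem_names.2 ⟨by omega, by omega⟩) ht, cut]
  split_ifs with hi
  · rfl
  · rw [sz_of_le _ (by omega)]

theorem read_tok (hw : ∀ j, 3 * w.length + 3 < j → wordTok w j = (0, 1)) (hn : w.length = n)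
    (ht : 0 < t) (i : ℕ) : (p.layout b).store w (p.arr w) t (tokA, i) = wordTok w i := by
  rw [p.read (p.mem_names.2 ⟨by omega, by omega⟩) ht, cut]
  split_ifs with hi
  · rfl
  · have := p.le_N
    rw [hw i (by omega)]

/-! #### Correctness -/

theorem closed {v : K} (hv : HasValue w v) (hn : w.length = n) : Closed (wordTok w) p.N := by
  obtain ⟨⟨k, s, t, X, -, hg, -⟩, hw⟩ := wordTok_spec hv
  have hN := p.le_N
  refine ⟨fun q hq => ?_⟩
  rcases Nat.eq_zero_or_pos q with rfl | hq0
  · exact ⟨_, X, by omega, hg⟩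
  · have hle : q < 3 * w.length + 3 := by
      by_contra hc
      rcases (not_lt.1 hc).eq_or_lt with h | h
      · have := hg.cl
        rw [h] at this
        omega
      · rw [hw q h] at hq
        simp at hq
    obtain ⟨k', Y, h1, h2⟩ := hg.seg.exists_grp q (by omega) hle hq
    exact ⟨k', Y, by omega, h2⟩

theorem contracted {v : K} (hv : HasValue w v) (hn : w.length = n) (l : ℕ) :
    Contracted (wordTok w) (p.height w) p.N (p.m ^ l) (p.eltV w l) := by
  induction l with
  | zero =>
    rw [pow_zero]
    exact contracted_first
  | succ l ih =>
    exact ih.next p.isHeight (p.closed hv hn) (Nat.pow_pos p.m_pos)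
      (Nat.pow_le_pow_right p.m_pos (by omega))

/-- The outer group has operator +, so the last row of its matrix is (0, X₂₀ + X₂₁, X₂₂) = (0, ks +
kt, k); the final division cancels k. -/
theorem eltV_final {v : K} (hv : HasValue w v) (hn : w.length = n) :
    ∃ k s t : K, k ≠ 0 ∧ (p.eltV w p.D 0).2 2 1 = k * s + k * t ∧ (p.eltV w p.D 0).2 2 2 = k ∧
      s + t = v := by
  obtain ⟨⟨k, s, t, X, hk, hg, h11, h0, h1, h2, hst⟩, -⟩ := wordTok_spec hv
  have hN := p.le_N
  have hD := p.le_pow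
  have := (p.contracted hv hn p.D).final p.isHeight (by omega) (by omega) hg
  refine ⟨k, s, t, hk, ?_, ?_, hst⟩
  · rw [this, h11, ← h0, ← h1]
    rfl
  · rw [this, h11, ← h2]
    rfl

theorem stage_src_lt (c : Scan) (l : ℕ) : p.stage (c.src l) < p.base c l := by
  cases c <;> simp only [Scan.src, stage, base] <;> omega

theorem read_preKey (c : Scan) {l r : ℕ} (hl : l ≤ p.D) (hr : r ≤ p.D) {B j : ℕ} (hj : j < p.m) :
    scanN c.op (fun i => (p.layout b).store w (p.arr w) (p.base c l + r)
      (p.preKey c l r (B * p.m + i))) j (p.m - j) =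
      preScan c.op (cut (2 * p.N) (p.scanV w c l)) p.m r (B * p.m + j) := by
  cases r with
  | zero =>
    rw [← preScan_zero hj]
    congr 1
    funext i
    have hmem : c.src l ∈ (p.layout b).names := by
      cases c <;> exact p.mem_names.2 ⟨by omega, by omega⟩
    rw [preKey, add_zero, p.read hmem (p.stage_src_lt c l), arr_src]
  | succ r =>
    rw [← preScan_succ c.tagOp hj]
    congr 1
    funext i
    rw [preKey, p.read_pre c hl (by omega) (by omega)]

/-- The dearest array is `out`, with 12 + 22·9 = 210 per cell by `sum_slotCalls`; the summand `a` is
needed for the binary searches of `next`. -/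
theorem body_spec {v : K} (hv : HasValue w v) (hn : w.length = n) {ν : Name}
    (hν : ν ∈ (p.layout b).names) {B : ℕ} (hB : B < p.NB) :
    (∀ j < p.m, (p.body ν B).out ((p.layout b).store w (p.arr w) (p.stage ν)) j =
      p.arr w ν (B * p.m + j)) ∧
    (p.body ν B).cost (fun k => ((p.layout b).store w (p.arr w) (p.stage ν) k).1) +
      9 * (blockVars p.m ((p.body ν B).run
        fun k => ((p.layout b).store w (p.arr w) (p.stage ν) k).1)).card ≤
      p.m * (210 + p.a) := by
  have hm := p.m_pos
  have hw := (wordTok_spec hv).2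
  have hlt : ∀ {j}, j < p.m → B * p.m + j < 2 * p.N := by
    intro j hj
    have := Nat.mul_le_mul_right p.m (Nat.succ_le_of_lt hB)
    rw [Nat.succ_mul, p.NB_mul] at this
    omega
  have hcell : ∀ (cell : ℕ → RT Key (ℕ × MExpr Key)) (c : ℕ) (G : Key → ℕ × Mat K), c ≤ 210 →
      (∀ i, (cell i).cost (fun k => (G k).1) +
        9 * ((cell i).run fun k => (G k).1).2.vars.card ≤ c) →
      (cellTask cell p.m B).cost (fun k => (G k).1) +
        9 * (blockVars p.m ((cellTask cell p.m B).run fun k => (G k).1)).card ≤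
        p.m * (210 + p.a) := fun cell c G hc h =>
    (cellTask_cost_const _ cell p.m B c h).trans (Nat.mul_le_mul_left _ (by omega))
  obtain ⟨k, l, r⟩ := ν
  obtain ⟨hl, hr⟩ := p.mem_names.1 hν
  cases k with
  | tok =>
    refine ⟨fun j hj => ?_, hcell _ 12 _ (by omega) fun i => tokCell_cost _ _ i⟩
    rw [body, cellTask_out _ _ hj]
    subst hn
    exact tokCell_val (fun i => rfl) _
  | ht =>
    refine ⟨fun j hj => ?_, hcell _ 1 _ (by omega) fun i => le_rfl⟩
    rw [body, cellTask_out _ _ hj]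
    simp only [htCell, RT.val, RT.run_bind, RT.run_get, RT.run_pure,
      p.read_tok hw hn (show 0 < p.stage (.ht, l, r) from one_pos)]
    rfl
  | level =>
    refine ⟨fun j hj => ?_, hcell _ 1 _ (by omega) fun i => le_rfl⟩
    rw [body, cellTask_out _ _ hj, levelCell_val
      (T := fun i => (suf (· + ·) (htV w) (2 * p.N) i).1)]
    · change (_, _) = (p.levelV w _, _)
      rw [levelV, if_pos (hlt hj)]
      rfl
    · intro i
      rw [p.read_suf .height (by omega) (by simp only [base, stage]; omega)]
      rfl
  | pmax =>
    refine ⟨fun j hj => ?_, (maxTask_cost _ _).trans (Nat.le_mul_of_pos_right _ (by omega))⟩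
    rw [body, maxTask_out _ _ hj]
    simp only [p.read_unit (show r ≤ p.D + 1 by omega)
      (show p.D + 4 + r < p.stage (.pmax, l, r) by simp only [stage]; omega), preMax_eq hj]
    rfl
  | next =>
    refine ⟨fun j hj => ?_, (nextTask_cost _ _ _ _ _ _ _ _ _).trans ?_⟩
    · have hst : p.stage (.next, l, r) = 2 * p.D + 6 + (p.D - r) := rfl
      rw [body, nextTask_out (h := p.levelV w) _ _ _ _ _ hj (Nat.pow_pos hm) p.m_eq]
      · rfl
      · rw [mul_comm (p.m ^ r), ← Nat.div_div_eq_div_mul, mul_comm B, Nat.mul_add_div hm,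
          Nat.div_eq_of_lt hj, add_zero]
      · exact p.read_level (by omega) _
      · rw [← pow_succ]
        rcases hr.eq_or_lt with rfl | hr'
        -- The top level refers to an array that does not exist. It reads as 0, which is the right
        -- answer there.
        · have hni : ((.next, 0, p.D + 1) : Name) ∉ (p.layout b).names := by
            rw [p.mem_names]
            omega
          obtain ⟨t, ht⟩ : ∃ t, p.stage (.next, l, p.D) = t + 1 := ⟨2 * p.D + 5, by omega⟩
          rw [nextLarger_of_le (p.le_pow.trans (Nat.pow_le_pow_right hm (by omega)))
            fun i hi => p.levelV_of_le hi, ht]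
          simp [Layout.store, hni]
        · exact p.read_nextLarger hr' (by omega) (hlt hj)
      · exact p.read_pmax hr (by omega)
      · exact fun c _ => p.read_unit (by omega) (by omega) _
    · rw [mul_add, mul_add]
      omega
  | size =>
    refine ⟨fun j hj => ?_, hcell _ 2 _ (by omega) fun i => le_rfl⟩
    rw [body, cellTask_out _ _ hj, sizeCell_val (p.read_next (by simp only [stage]; omega))]
    rfl
  | elt =>
    have ht : ∀ i, (p.layout b).store w (p.arr w) (p.stage (.elt, l, r)) (tokA, i) = wordTok w i :=
      p.read_tok hw hn (by simp only [stage, phase]; omega)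
    cases l with
    | zero =>
      refine ⟨fun j hj => ?_, hcell _ 10 _ (by omega) fun i => firstCell_cost _ i⟩
      rw [body, cellTask_out _ _ hj, firstCell_val ht]
      rfl
    | succ l =>
      refine ⟨fun j hj => ?_, hcell _ 13 _ (by omega) fun i => eltCell_cost _ _ _ _ i⟩
      have hph : p.phase (l + 1) = p.phase l + (2 * p.D + 7) := by
        simp only [phase]
        ring
      rw [body, cellTask_out _ _ hj, eltCell_val (x := p.eltV w l) (o := p.outV w l (p.eltV w l)) ht
        (p.read_size (by simp only [stage, phase]; omega))]
      · rfl
      · rw [p.read (p.mem_names.2 ⟨by omega, by omega⟩) (by simp only [stage]; omega), cut,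
          if_pos (hlt hj)]
        rfl
      · rw [p.read (p.mem_names.2 ⟨by omega, by omega⟩) (by simp only [stage]; omega), cut,
          if_pos ((Nat.div_le_self _ _).trans_lt (hlt hj))]
        rfl
  | lay =>
    refine ⟨fun j hj => ?_, hcell _ 25 _ (by omega) fun i => layCell_cost _ _ _ i⟩
    rw [body, cellTask_out _ _ hj, layCell_val (x := p.eltV w l) (S := p.valS (p.eltV w l))
      (p.read_tok hw hn (by simp only [stage, phase]; omega))
      (p.read_next (by simp only [stage, phase]; omega))]
    · rfl
    · rw [p.read (p.mem_names.2 ⟨by omega, by omega⟩) (by simp only [stage]; omega), cut,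
        if_pos (hlt hj)]
      rfl
    · exact p.read_suf .value hl (by simp only [base, stage]; omega)
  | root =>
    refine ⟨fun j hj => ?_, hcell _ 3 _ (by omega) fun i => rootCell_cost _ _ _ i⟩
    rw [body, cellTask_out _ _ hj, rootCell_val
      (p.read_tok hw hn (by simp only [stage, phase]; omega))
      (p.read_size (by simp only [stage, phase]; omega))]
    rfl
  | out =>
    have key := outCell_val (N := p.N) (H := p.height w) (s := p.m ^ l) (l := l) (D := p.D)
      (S := p.valS (p.eltV w l)) (S' := p.valS (p.layV w (p.eltV w l))) (R := p.valS (p.rootV w l))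
      (p.read_tok hw hn (show 0 < p.stage (.out, l, r) by simp only [stage, phase]; omega))
      (p.read_next (by simp only [stage, phase]; omega))
      (p.read_suf (b := b) .value hl (by simp only [base, stage]; omega))
      (p.read_suf .chain hl (by simp only [base, stage]; omega))
      (p.read_suf .root hl (by simp only [base, stage]; omega))
    refine ⟨fun j hj => ?_, ?_⟩
    · rw [body, cellTask_out _ _ hj, (key _).1]
      rfl
    · refine cellTask_cost _ _ _ _ _ ((sum_le_sum fun j _ => (key _).2).trans ?_)
      have := sum_slotCalls (p.contracted hv hn l) p.isHeight (p.closed hv hn)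
        (Nat.pow_pos (n := l) hm) (s' := p.m ^ (l + 1)) (m := p.m) (by rw [pow_succ, mul_comm]) hm
        (B * p.m)
      rw [sum_add_distrib, ← mul_sum, sum_const, card_range, smul_eq_mul, mul_add]
      change ∑ j ∈ range p.m, slotCalls (wordTok w) (nx (p.height w) p.N) (p.valS (p.eltV w l))
        (p.valS (p.layV w (p.eltV w l))) (2 * p.N) (p.m ^ l)
        (p.valS (p.rootV w l) ((B * p.m + j) * p.m ^ l)).1 (B * p.m + j) ≤ 9 * p.m at this
      omega
  | pre c =>
    refine ⟨fun j hj => ?_, (preTask_cost _ _).trans ?_⟩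
    · rw [body, preTask_out _ _ hj]
      exact p.read_preKey c hl hr hj
    · rw [mul_comm]
      exact Nat.mul_le_mul_left _ (by omega)
  | scan c =>
    refine ⟨fun j hj => ?_, hcell _ 20 _ (by omega) fun i => scanCell_cost _ _ _ _ _ _ i⟩
    rw [body, cellTask_out _ _ hj]
    have hst : p.stage (.scan c, l, r) = p.base c l + r + 1 := rfl
    cases r with
    | zero => exact scanCell_val_zero (p.read_pre c hl hr (by omega) _)
    | succ r =>
      exact scanCell_val_succ c.tagOp hm (p.read_scan c hl (by omega) (by omega) _)
        (p.read_pre c hl hr (by omega))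

/-- The bound on 2^b covers the keys, fewer than 9·18·(D+1)²·2N, and the tags, at most 4N + 14. -/
theorem outputs {v : K} (hv : HasValue w v) (hn : w.length = n)
    (hb : 1000 * (p.D + 1) ^ 2 * p.N ≤ 2 ^ b) : (p.layout b).design.algorithm.Outputs w v := by
  have hm := p.m_pos
  have hN := p.le_N
  have hNb : 1000 * p.N ≤ 2 ^ b := by
    refine le_trans (Nat.mul_le_mul_right _ ?_) hb
    exact Nat.le_mul_of_pos_right _ (by positivity)
  have hNB : 0 < p.NB := by
    by_contra hc
    have := p.NB_mul
    rw [Nat.eq_zero_of_not_pos hc] at this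
    omega
  have hS : 300 * p.m * (p.a + 1) = p.m * (210 + p.a) + (90 * p.m + 299 * (p.m * p.a)) := by ring
  have hruns : (p.layout b).design.Runs w ((p.layout b).store w (p.arr w)) := by
    refine Layout.runs hm hn (fun ν hν B hB j hj => (p.body_spec hv hn hν hB).1 j hj)
      (fun ν hν B hB => ?_) (fun ν _ i hi => ?_) ?_
    · have := (p.body_spec hv hn hν hB).2
      change (p.body ν B).cost _ + 9 * (blockVars p.m _).card + 9 * p.m + 10 ≤ 300 * p.m * (p.a + 1)
      change (p.body ν B).cost (fun k => ((p.layout b).store w (p.arr w) (p.stage ν) k).1) +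
        9 * (blockVars p.m ((p.body ν B).run fun k =>
          ((p.layout b).store w (p.arr w) (p.stage ν) k).1)).card + 9 * p.m + 10 ≤ _
      omega
    · have h1 : i < 2 * p.N := by
        rw [← p.NB_mul]
        exact hi
      have := p.arr_tag_le (w := w) ν h1
      change _ < 2 ^ b
      omega
    · change 19 * p.m + 10 ≤ 300 * p.m * (p.a + 1)
      omega
  obtain ⟨k, s, t, hk, h1, h2, hst⟩ := p.eltV_final hv hn
  have := Layout.outputs (d := p.layout b) hm hruns (by change n ≤ 2 ^ b; omega) ?_
    (p.mem_names.2 ⟨le_rfl, by omega⟩) hNB (Nat.lt_succ_self _)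
    (by change 10 ≤ 300 * p.m * (p.a + 1); omega)
    (by change (p.eltV w p.D 0).2 2 2 ≠ 0; rw [h2]; exact hk)
  · change (p.layout b).design.algorithm.Outputs w ((p.eltV w p.D 0).2 2 1 / (p.eltV w p.D 0).2 2 2)
      at this
    rwa [h1, h2, ← mul_add, mul_div_cancel_left₀ _ hk, hst] at this
  · refine le_trans ?_ hb
    change 9 * ((p.layout b).names.card * p.NB * p.m) ≤ _
    rw [mul_assoc, p.NB_mul]
    calc 9 * ((p.layout b).names.card * (2 * p.N)) ≤ 9 * (18 * (p.D + 1) ^ 2 * (2 * p.N)) := by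
          gcongr
          exact p.card_names b
      _ = 324 * ((p.D + 1) ^ 2 * p.N) := by ring
      _ ≤ 1000 * ((p.D + 1) ^ 2 * p.N) := by gcongr; omega
      _ = _ := by ring

end Values

end Params

end AMPC

namespace AMPC

/-! ### The choice of the parameters -/

section Asymptotics

/-- With a = ⌊log₂ n^(ε/2)⌋ + 1 the block size 2^a is at most 2·n^(ε/2). Its square is bounded
because a machine needs memory of order m(a + 1) ≤ m². -/
theorem exists_block_size {ε : ℝ} (hε : 0 < ε) (hε1 : ε < 1) {n : ℕ} (hn : 1 ≤ n) :
    ∃ a : ℕ, 1 ≤ a ∧ ε / 2 * Real.log n ≤ a * Real.log 2 ∧ (a : ℝ) ≤ 1 + Real.log n ∧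
      (2 ^ a : ℝ) ≤ 2 * n ∧ (2 ^ a : ℝ) ^ 2 ≤ 4 * (n : ℝ) ^ ε := by
  have hn' : (1 : ℝ) ≤ n := by exact_mod_cast hn
  have hlog : 0 ≤ Real.log n := Real.log_nonneg hn'
  have h2 : 0 < Real.log 2 := Real.log_pos one_lt_two
  have h2' := Real.log_two_gt_d9
  set x := ε / 2 * Real.log n / Real.log 2 with hx
  have hx0 : 0 ≤ x := by positivity
  have hxl : x * Real.log 2 = ε / 2 * Real.log n := by
    rw [hx]
    field_simp
  have h3 := Nat.floor_le hx0
  have h4 := Nat.lt_floor_add_one x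
  have h5 : (⌊x⌋₊ : ℝ) * Real.log 2 ≤ ε / 2 * Real.log n := by
    rw [← hxl]
    gcongr
  have h6 : ε / 2 * Real.log n ≤ 1 / 2 * Real.log n := by gcongr
  refine ⟨⌊x⌋₊ + 1, by omega, ?_, ?_, ?_, ?_⟩
  · rw [← hxl]
    push_cast
    gcongr
  · have : (1 / 2 : ℝ) * ⌊x⌋₊ ≤ Real.log 2 * ⌊x⌋₊ := by
      gcongr
      linarith
    push_cast
    linarith
  · rw [← Real.log_le_log_iff (by positivity) (by positivity), Real.log_pow,
      Real.log_mul (by norm_num) (by positivity)]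
    push_cast
    linarith
  · rw [← Real.log_le_log_iff (by positivity) (by positivity), Real.log_pow, Real.log_pow,
      Real.log_mul (by norm_num) (by positivity), Real.log_rpow (by positivity),
      show (4 : ℝ) = 2 ^ 2 by norm_num, Real.log_pow]
    push_cast
    linarith

/-- Both bounds on D come from m^(D−1) < 2N ≤ 32n: with m ≥ n^(ε/2) it is O(1/ε), which bounds the
rounds, and with m ≥ 2 it is O(1 + log n) uniformly in ε, which bounds the total memory. -/
theorem exists_params {ε : ℝ} (hε : 0 < ε) (hε1 : ε < 1) {n : ℕ} (hn : 1 ≤ n) :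
    ∃ p : Params n, (p.D : ℝ) ≤ 8 / ε ∧ (p.D + 1 : ℝ) ≤ 10 * (1 + Real.log n) ∧
      (p.a : ℝ) ≤ 1 + Real.log n ∧ p.N ≤ 12 * n ∧ (p.m : ℝ) ^ 2 ≤ 4 * (n : ℝ) ^ ε := by
  obtain ⟨a, h1, h2, h3, h4, h5⟩ := exists_block_size hε hε1 hn
  have hn' : (1 : ℝ) ≤ n := by exact_mod_cast hn
  have hlog : 0 ≤ Real.log n := Real.log_nonneg hn'
  have hl2 := Real.log_two_gt_d9
  have hm : 1 < 2 ^ a := Nat.one_lt_two_pow (by omega)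
  have hm2 : 2 ^ a ≤ 2 * n := by exact_mod_cast h4
  have hdm := Nat.div_add_mod (3 * n + 7) (2 ^ a)
  have hmod := Nat.mod_lt (3 * n + 7) (show 0 < 2 ^ a by omega)
  set q := (3 * n + 7) / 2 ^ a
  -- N is the first multiple of m above 3n + 7, so that 2N cells split into whole blocks.
  have hN : (q + 1) * 2 ^ a = 2 ^ a * q + 2 ^ a := by ring
  have hD := Nat.pow_pred_clog_lt_self hm (show 1 < 2 * ((q + 1) * 2 ^ a) by omega)
  set D := Nat.clog (2 ^ a) (2 * ((q + 1) * 2 ^ a)) with hDdef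
  have hD1 : 1 ≤ D := Nat.clog_pos hm (by omega)
  have hlD : ((D : ℝ) - 1) * (a * Real.log 2) ≤ 5 * Real.log 2 + Real.log n := by
    have h6 : (2 ^ a) ^ (D - 1) ≤ 2 ^ 5 * n := by
      rw [Nat.pred_eq_sub_one] at hD
      omega
    have h7 : ((2 : ℝ) ^ a) ^ (D - 1) ≤ 2 ^ 5 * n := by exact_mod_cast h6
    rw [← Real.log_le_log_iff (by positivity) (by positivity), Real.log_pow, Real.log_pow,
      Real.log_mul (by norm_num) (by positivity), Real.log_pow, Nat.cast_sub hD1] at h7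
    push_cast at h7
    exact h7
  have hDr : (1 : ℝ) ≤ D := by exact_mod_cast hD1
  have ha1 : (1 : ℝ) ≤ a := by exact_mod_cast h1
  have hal : Real.log 2 ≤ a * Real.log 2 := le_mul_of_one_le_left (by linarith) ha1
  refine ⟨⟨2 ^ a, a, (q + 1) * 2 ^ a, 2 * (q + 1), D, rfl, by omega, by ring,
    Nat.le_pow_clog hm _⟩, ?_, ?_, h3, by change (q + 1) * 2 ^ a ≤ 12 * n; omega,
    by push_cast; exact h5⟩
  · change (D : ℝ) ≤ 8 / ε
    have h8 : ((D : ℝ) - 1) * (a * Real.log 2) ≤ (5 + 2 / ε) * (a * Real.log 2) := by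
      have h9 : Real.log n ≤ 2 / ε * (a * Real.log 2) := by
        have := mul_le_mul_of_nonneg_left h2 (show 0 ≤ 2 / ε by positivity)
        have h10 : 2 / ε * (ε / 2 * Real.log n) = Real.log n := by field_simp
        linarith
      linarith
    have h9 := le_of_mul_le_mul_right h8 (by linarith)
    have h10 : 1 ≤ 1 / ε := by rw [le_div_iff₀ hε]; linarith
    have h11 : 8 / ε = 8 * (1 / ε) := by ring
    have h12 : 2 / ε = 2 * (1 / ε) := by ring
    linarith
  · change (D : ℝ) + 1 ≤ _
    have h8 : ((D : ℝ) - 1) * Real.log 2 ≤ ((D : ℝ) - 1) * (a * Real.log 2) :=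
      mul_le_mul_of_nonneg_left hal (by linarith)
    have h9 : ((D : ℝ) - 1 - 5) * Real.log 2 ≤ Real.log n := by linarith
    by_contra hc
    push Not at hc
    have h10 : (D - 1 - 5 : ℝ) * (1 / 2) ≤ (D - 1 - 5 : ℝ) * Real.log 2 :=
      mul_le_mul_of_nonneg_left (by linarith) (by linarith)
    linarith

/-- The factor (D + 1)² costs only 2·log(1 + log n) + O(1) bits, and log(1 + log n) ≤ log n. -/
theorem exists_wordBits {n : ℕ} (hn : 1 ≤ n) (p : Params n)
    (hD : (p.D + 1 : ℝ) ≤ 10 * (1 + Real.log n)) (hN : p.N ≤ 12 * n) :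
    ∃ b : ℕ, 1000 * (p.D + 1) ^ 2 * p.N ≤ 2 ^ b ∧ (b : ℝ) ≤ 30 * (1 + Real.log n) := by
  have hn' : (1 : ℝ) ≤ n := by exact_mod_cast hn
  have hlog : 0 ≤ Real.log n := Real.log_nonneg hn'
  have hl2 := Real.log_two_gt_d9
  have hNp := p.le_N
  set x := 1000 * (p.D + 1) ^ 2 * p.N with hx
  have hx1 : 1 < x := by
    have : 1 ≤ (p.D + 1) ^ 2 := Nat.one_le_pow _ _ (by omega)
    calc 1 < 1000 * 1 * p.N := by omega
      _ ≤ x := by rw [hx]; gcongr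
  refine ⟨Nat.clog 2 x, Nat.le_pow_clog one_lt_two _, ?_⟩
  have h1 := Nat.pow_pred_clog_lt_self one_lt_two hx1
  have hb := Nat.clog_pos one_lt_two hx1
  set b := Nat.clog 2 x
  rw [Nat.pred_eq_sub_one] at h1
  have h2 : (x : ℝ) ≤ 2 ^ 21 * (1 + Real.log n) ^ 2 * n := by
    have hN' : (p.N : ℝ) ≤ 12 * n := by exact_mod_cast hN
    have : (x : ℝ) = 1000 * (p.D + 1) ^ 2 * p.N := by rw [hx]; push_cast; ring
    rw [this]
    calc (1000 * (p.D + 1) ^ 2 * p.N : ℝ) ≤ 1000 * (10 * (1 + Real.log n)) ^ 2 * (12 * n) := by gcongr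
      _ = 1200000 * ((1 + Real.log n) ^ 2 * n) := by ring
      _ ≤ 2 ^ 21 * ((1 + Real.log n) ^ 2 * n) := by gcongr; norm_num
      _ = _ := by ring
  have h3 : (2 : ℝ) ^ (b - 1) ≤ 2 ^ 21 * (1 + Real.log n) ^ 2 * n := by
    refine le_trans ?_ h2
    exact_mod_cast h1.le
  have h5 : Real.log (1 + Real.log n) ≤ Real.log n := by
    have := Real.log_le_sub_one_of_pos (show 0 < 1 + Real.log n by linarith)
    linarith
  rw [← Real.log_le_log_iff (by positivity) (by positivity), Real.log_pow,
    Real.log_mul (by positivity) (by positivity), Real.log_mul (by positivity) (by positivity),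
    Real.log_pow, Real.log_pow, Nat.cast_sub hb] at h3
  push_cast at h3
  by_contra hc
  push Not at hc
  have h6 : ((b : ℝ) - 22) * (1 / 2) ≤ (b - 22) * Real.log 2 :=
    mul_le_mul_of_nonneg_left (by linarith) (by linarith)
  linarith

/-- The cube of the logarithm consists of (D + 1)² for the number of arrays and a + 1 for the memory
needed per cell. -/
theorem exists_algorithm {ε : ℝ} (hε : 0 < ε) (hε1 : ε < 1) {n : ℕ} (hn : 1 ≤ n) :
    ∃ A : Algorithm, (A.rounds : ℝ) ≤ 10 ^ 8 / ε ^ 2 ∧ (A.memory : ℝ) ≤ 10 ^ 8 * (n : ℝ) ^ ε ∧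
      (A.machines : ℝ) * (A.memory : ℝ) ≤ 10 ^ 8 * (n : ℝ) * (1 + Real.log n) ^ 3 ∧
      (A.wordBits : ℝ) ≤ 10 ^ 8 * (1 + Real.log n) ∧
      ∀ (K : Type*) [Field K] (w : List (Sym K)) (v : K),
        w.length = n → HasValue w v → A.Outputs w v := by
  obtain ⟨p, h1, h2, h3, h4, h5⟩ := exists_params hε hε1 hn
  obtain ⟨b, hb, hb'⟩ := exists_wordBits hn p h2 h4
  have hn' : (1 : ℝ) ≤ n := by exact_mod_cast hn
  have hlog : 0 ≤ Real.log n := Real.log_nonneg hn'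
  have hm1 : (1 : ℝ) ≤ p.m := by exact_mod_cast p.m_pos
  have hmem : (300 * p.m * (p.a + 1) + 1 : ℝ) ≤ 301 * p.m * (p.a + 1) := by
    have : (1 : ℝ) * 1 ≤ p.m * (p.a + 1) := by
      gcongr
      linarith [(Nat.cast_nonneg p.a : (0 : ℝ) ≤ p.a)]
    linarith
  refine ⟨(p.layout b).design.algorithm, ?_, ?_, ?_, ?_,
    fun K _ w v hw hv => p.outputs hv hw hb⟩
  · change ((p.phase p.D + 1 + 1 : ℕ) : ℝ) ≤ _
    have h6 : 1 ≤ 1 / ε := by rw [le_div_iff₀ hε]; linarith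
    have h7 : (p.D : ℝ) ≤ 8 * (1 / ε) := by linarith [show 8 / ε = 8 * (1 / ε) by ring]
    have h8 : (p.D : ℝ) ^ 2 ≤ (8 * (1 / ε)) ^ 2 := by gcongr
    have h9 : 1 / ε ≤ (1 / ε) ^ 2 := by
      rw [sq]
      exact le_mul_of_one_le_left (by linarith) h6
    have h10 : (10 : ℝ) ^ 8 / ε ^ 2 = 10 ^ 8 * (1 / ε) ^ 2 := by rw [one_div, inv_pow]; rfl
    rw [h10]
    simp only [Params.phase]
    push_cast
    linarith
  · change ((300 * p.m * (p.a + 1) + 1 : ℕ) : ℝ) ≤ _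
    have h6 : (p.a + 1 : ℝ) ≤ p.m := by
      have : p.a + 1 ≤ p.m := by
        rw [p.m_eq]
        exact Nat.lt_two_pow_self
      exact_mod_cast this
    have h7 : (301 * p.m * (p.a + 1) : ℝ) ≤ 301 * p.m * p.m := by gcongr
    have h8 : 0 ≤ (n : ℝ) ^ ε := by positivity
    push_cast
    linarith
  · change (((p.layout b).names.card * p.NB : ℕ) : ℝ) * ((300 * p.m * (p.a + 1) + 1 : ℕ) : ℝ) ≤ _
    have h6 : ((p.layout b).names.card : ℝ) ≤ 18 * (p.D + 1) ^ 2 := by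
      exact_mod_cast p.card_names b
    have h7 : (p.NB * p.m : ℝ) = 2 * p.N := by exact_mod_cast p.NB_mul
    have h8 : (p.N : ℝ) ≤ 12 * n := by exact_mod_cast h4
    push_cast
    calc ((p.layout b).names.card * p.NB * (300 * p.m * (p.a + 1) + 1) : ℝ)
        ≤ 18 * (p.D + 1) ^ 2 * p.NB * (301 * p.m * (p.a + 1)) := by gcongr
      _ = 5418 * (p.D + 1) ^ 2 * (p.NB * p.m) * (p.a + 1) := by ring
      _ = 10836 * (p.D + 1) ^ 2 * p.N * (p.a + 1) := by rw [h7]; ring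
      _ ≤ 10836 * (10 * (1 + Real.log n)) ^ 2 * (12 * n) * (2 * (1 + Real.log n)) := by
          gcongr
          linarith
      _ = 26006400 * (n * (1 + Real.log n) ^ 3) := by ring
      _ ≤ 10 ^ 8 * (n * (1 + Real.log n) ^ 3) := by gcongr; norm_num
      _ = _ := by ring
  · change (b : ℝ) ≤ _
    linarith

end Asymptotics

end AMPC

theorem mainTheorem4 :
    ∃ (C : ℝ) (k : ℕ), ∀ ε : ℝ, 0 < ε → ε < 1 →
      ∃ A : ℕ → AMPC.Algorithm, ∀ n : ℕ, 1 ≤ n →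
        ((A n).rounds : ℝ) ≤ C / ε ^ 2 ∧
        ((A n).memory : ℝ) ≤ C * (n : ℝ) ^ ε ∧
        ((A n).machines : ℝ) * ((A n).memory : ℝ) ≤ C * (n : ℝ) * (1 + Real.log n) ^ k ∧
        ((A n).wordBits : ℝ) ≤ C * (1 + Real.log n) ∧
        ∀ (K : Type*) [Field K] (w : List (AMPC.Sym K)) (v : K),
          w.length = n → AMPC.HasValue w v → (A n).Outputs w v := by
  refine ⟨10 ^ 8, 3, fun ε hε hε1 => ?_⟩
  -- Algorithms are chosen for n ≥ 1 only; below, `max 1 n` supplies a value at n = 0.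
  choose A hA using fun n : {n : ℕ // 1 ≤ n} => AMPC.exists_algorithm hε hε1 n.2
  exact ⟨fun n => A ⟨max 1 n, le_max_left _ _⟩, fun n hn => by
    have h := hA ⟨max 1 n, le_max_left _ _⟩
    simpa only [max_eq_right hn] using h⟩
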